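/- Notation. Let $(A_0,A_1)$ be a compatible couple of quasi-Banach spaces (both continuously embedded in one Hausdorff topological vector space) with $A_0\cap A_1\neq\{0\}$, and for $f\in A_0+A_1$, $t>0$ let $K(t,f)=K(t,f;A_0,A_1)=\inf\{\|f_0\|_{A_0}+t\|f_1\|_{A_1}: f=f_0+f_1,\ f_i\in A_i\}$. A positive Lebesgue measurable function $b$ on $(0,\infty)$ is slowly varying, $b\in SV$, if for each $\varepsilon>0$ the function $t^{\varepsilon}b(t)$ is equivalent to a non-decreasing function and $t^{-\varepsilon}b(t)$ is equivalent to a non-increasing function. $\|\cdot\|_{q,(\alpha,\beta)}$ is the (quasi-)norm of $L_q(\alpha,\beta)$, $0<q\le\infty$, and $1/\infty=0$. For $0\le\theta\le1$, $0<s,r,q\le\infty$ and positive weights $a,b,c$ on $(0,\infty)$ define the following spaces of all $f\in A_0+A_1$ with finite (quasi-)norm: - $\bar A_{\theta,q;b}=(A_0,A_1)_{\theta,q;b}$: $\ \|u^{-\theta-1/q}b(u)K(u,f)\|_{q,(0,\infty)}$; - $\bar A^{\mathcal R}_{\theta,r,b,q,a}$: $\ \big\|t^{-1/r}b(t)\|u^{-\theta-1/q}a(u)K(u,f)\|_{q,(t,\infty)}\big\|_{r,(0,\infty)}$;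 - $\bar A^{\mathcal R,\mathcal L}_{\theta,s,c,r,b,q,a}$: $\ \Big\|t^{-1/s}c(t)\big\|u^{-1/r}b(u)\|v^{-\theta-1/q}a(v)K(v,f)\|_{q,(u,t)}\big\|_{r,(0,t)}\Big\|_{s,(0,\infty)}$; - $\bar A^{\mathcal R,\mathcal R}_{\theta,s,c,r,b,q,a}$: $\ \Big\|t^{-1/s}c(t)\big\|u^{-1/r}b(u)\|v^{-\theta-1/q}a(v)K(v,f)\|_{q,(u,\infty)}\big\|_{r,(t,\infty)}\Big\|_{s,(0,\infty)}$. Equality of spaces means equality as sets with equivalent quasi-norms; an intersection carries the maximum of the quasi-norms. Theorem. Let $0<r,r_0,q_0,r_1,q_1\le\infty$ and $a,a_0,b_0,a_1,b_1\in SV$, and suppose that $$\|s^{-1/r_0}b_0(s)\|_{r_0,(0,1)}<\infty,\qquad \big\|s^{-1/r_0}b_0(s)\|u^{-1/q_0}a_0(u)\|_{q_0,(s,\infty)}\big\|_{r_0,(1,\infty)}<\infty,\qquad \big\|s^{-1/r_1}b_1(s)\|u^{-1/q_1}a_1(u)\|_{q_1,(s,1)}\big\|_{r_1,(0,1)}<\infty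 .$$ Put $$\chi_0(t)=\big\|s^{-1/r_0}b_0(s)\|u^{-1/q_0}a_0(u)\|_{q_0,(s,\infty)}\big\|_{r_0,(t,\infty)}+\|s^{-1/r_0}b_0(s)\|_{r_0,(0,t)}\,\|u^{-1/q_0}a_0(u)\|_{q_0,(t,\infty)},$$ $$\chi_1(t)=\big\|s^{-1/r_1}b_1(s)\|u^{-1/q_1}a_1(u)\|_{q_1,(s,t)}\big\|_{r_1,(0,t)},\qquad \rho(t)=t\,\frac{\chi_0(t)}{\chi_1(t)},$$ $X_0=\bar A^{\mathcal R}_{0,r_0,b_0,q_0,a_0}$, $X_1=\bar A^{\mathcal R}_{1,r_1,b_1,q_1,a_1}$ and, for $0\le\theta\le1$, $a^{\#}=\chi_0^{1-\theta}\chi_1^{\theta}\,(a\circ\rho)$. (i) If $0<\theta<1$, then $(X_0,X_1)_{\theta,r;a}=\bar A_{\theta,r;a^{\#}}$. (ii) If $\|s^{-1/r}a(s)\|_{r,(1,\infty)}<\infty$, then $(X_0,X_1)_{0,r;a}=\bar A_{0,r;a^{\#}}\cap\bar A^{\mathcal R,\mathcal L}_{0,r,a\circ\rho,r_0,b_0,q_0,a_0}$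 (with $\theta=0$ in $a^{\#}$). (iii) If $\|s^{-1/r}a(s)\|_{r,(0,1)}<\infty$, then $(X_0,X_1)_{1,r;a}=\bar A_{1,r;a^{\#}}\cap\bar A^{\mathcal R}_{1,r,B_1,q_1,a_1}\cap\bar A^{\mathcal R,\mathcal R}_{1,r,a\circ\rho,r_1,b_1,q_1,a_1}$ (with $\theta=1$ in $a^{\#}$), where $B_1(t)=\|s^{-1/r_1}b_1(s)\|_{r_1,(0,t)}\,a(\rho(t))$. -/

import Mathlib

open Set MeasureTheory Filter Topology
open scoped ENNReal NNReal

/-! ### Slowly varying functions and weighted Lebesgue norms -/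

/-- Two functions are equivalent on `(0, ∞)`: each is bounded by a constant times the other. -/
def EquivFun (f g : ℝ → ℝ) : Prop :=
  ∃ C : ℝ, 0 < C ∧ ∀ t : ℝ, 0 < t → f t ≤ C * g t ∧ g t ≤ C * f t

/-- The class `SV` of slowly varying functions on `(0, ∞)`: positive Lebesgue measurable functions
`b` such that, for every `ε > 0`, `t ^ ε * b t` is equivalent to a non-decreasing function and
`t ^ (-ε) * b t` is equivalent to a non-increasing function. (Real-valued Lebesgue measurable
functions are the `AEMeasurable` ones.) -/
structure SlowlyVarying (b : ℝ → ℝ) : Prop where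
  pos : ∀ t : ℝ, 0 < t → 0 < b t
  measurable : AEMeasurable b (volume.restrict (Ioi 0))
  equiv_increasing : ∀ ε : ℝ, 0 < ε →
    ∃ g : ℝ → ℝ, MonotoneOn g (Ioi 0) ∧ EquivFun (fun t => t ^ ε * b t) g
  equiv_decreasing : ∀ ε : ℝ, 0 < ε →
    ∃ g : ℝ → ℝ, AntitoneOn g (Ioi 0) ∧ EquivFun (fun t => t ^ (-ε) * b t) g

/-- `wnorm q I θ b F` is `‖u ^ (-θ - 1/q) b(u) F(u)‖_{q, I}`, the usual (quasi-)norm of the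
Lebesgue space `L_q` on `I ⊆ (0, ∞)`, with `1/∞ = 0`. -/
noncomputable def wnorm (q : ℝ≥0∞) (I : Set ℝ) (θ : ℝ) (b : ℝ → ℝ) (F : ℝ → ℝ≥0∞) : ℝ≥0∞ :=
  eLpNorm (fun u => ENNReal.ofReal (u ^ (-θ - (1 / q).toReal) * b u) * F u) q (volume.restrict I)

/-! ### Quasi-normed spaces inside an ambient vector space -/

/-- A set of vectors of an ambient space `E` with a size function on it. The values of `qnorm`
outside `carrier` are irrelevant. -/
structure QSpace (E : Type*) where
  carrier : Set E
  qnorm : E → ℝ≥0∞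

/-- `X` is a vector subspace of `E` and `qnorm` is a complete quasi-norm on it. -/
structure QSpace.IsQuasiBanach (𝕜 : Type*) [RCLike 𝕜] {E : Type*} [AddCommGroup E] [Module 𝕜 E]
    (X : QSpace E) : Prop where
  zero_mem : (0 : E) ∈ X.carrier
  add_mem : ∀ f ∈ X.carrier, ∀ g ∈ X.carrier, f + g ∈ X.carrier
  smul_mem : ∀ c : 𝕜, ∀ f ∈ X.carrier, c • f ∈ X.carrier
  qnorm_lt_top : ∀ f ∈ X.carrier, X.qnorm f < ∞
  qnorm_eq_zero_iff : ∀ f ∈ X.carrier, (X.qnorm f = 0 ↔ f = 0)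
  qnorm_smul : ∀ c : 𝕜, ∀ f ∈ X.carrier, X.qnorm (c • f) = ‖c‖ₑ * X.qnorm f
  qnorm_add_le : ∃ C : ℝ≥0, ∀ f ∈ X.carrier, ∀ g ∈ X.carrier,
    X.qnorm (f + g) ≤ C * (X.qnorm f + X.qnorm g)
  complete : ∀ u : ℕ → E, (∀ n, u n ∈ X.carrier) →
    (∀ ε : ℝ≥0∞, 0 < ε → ∃ N : ℕ, ∀ m ≥ N, ∀ n ≥ N, X.qnorm (u m - u n) < ε) →
    ∃ f ∈ X.carrier, Tendsto (fun n => X.qnorm (u n - f)) atTop (𝓝 0)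

/-- The inclusion of the (linear) space `X` into the ambient topological vector space is
continuous. -/
def QSpace.EmbedsIn (E : Type*) [AddCommGroup E] [TopologicalSpace E] (X : QSpace E) : Prop :=
  ∀ U ∈ 𝓝 (0 : E), ∃ δ : ℝ≥0∞, 0 < δ ∧ ∀ f ∈ X.carrier, X.qnorm f < δ → f ∈ U

/-- A compatible couple of quasi-Banach spaces, that is, two quasi-Banach spaces continuously
embedded in one (Hausdorff) topological vector space, with `A₀ ∩ A₁ ≠ {0}`. -/
structure CompatibleCouple (𝕜 : Type*) [RCLike 𝕜] {E : Type*} [AddCommGroup E] [Module 𝕜 E]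
    [TopologicalSpace E] (A₀ A₁ : QSpace E) : Prop where
  quasiBanach₀ : A₀.IsQuasiBanach 𝕜
  quasiBanach₁ : A₁.IsQuasiBanach 𝕜
  embeds₀ : A₀.EmbedsIn E
  embeds₁ : A₁.EmbedsIn E
  exists_ne_zero : ∃ f ∈ A₀.carrier ∩ A₁.carrier, f ≠ 0

/-- `X ⊂ Y`: continuous embedding of quasi-normed spaces. -/
def QSpace.Sub {E : Type*} (X Y : QSpace E) : Prop :=
  X.carrier ⊆ Y.carrier ∧ ∃ C : ℝ≥0, ∀ f ∈ X.carrier, Y.qnorm f ≤ C * X.qnorm f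

/-- `X = Y` for quasi-normed spaces: the same elements, with equivalent quasi-norms. -/
def QSpace.Same {E : Type*} (X Y : QSpace E) : Prop :=
  X.Sub Y ∧ Y.Sub X

/-- The intersection of two quasi-normed spaces. -/
noncomputable def QSpace.inter {E : Type*} (X Y : QSpace E) : QSpace E where
  carrier := X.carrier ∩ Y.carrier
  qnorm f := max (X.qnorm f) (Y.qnorm f)

/-! ### The `K`-functional and the interpolation spaces -/

section Interpolation

variable {E : Type*} [AddCommGroup E]

/-- The sum `A₀ + A₁`. -/
def sumSet (A₀ A₁ : QSpace E) : Set E :=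
  {f | ∃ f₀ ∈ A₀.carrier, ∃ f₁ ∈ A₁.carrier, f = f₀ + f₁}

/-- Peetre's functional `K(t, f; A₀, A₁)`. -/
noncomputable def Kfun (A₀ A₁ : QSpace E) (t : ℝ) (f : E) : ℝ≥0∞ :=
  ⨅ (f₀ ∈ A₀.carrier) (f₁ ∈ A₁.carrier) (_ : f = f₀ + f₁),
    A₀.qnorm f₀ + ENNReal.ofReal t * A₁.qnorm f₁

/-- The set of all `f ∈ A₀ + A₁` for which `N f` is finite, with `N` as quasi-norm. -/
def finiteSpace (A₀ A₁ : QSpace E) (N : E → ℝ≥0∞) : QSpace E where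
  carrier := {f | f ∈ sumSet A₀ A₁ ∧ N f < ∞}
  qnorm := N

/-- The standard space `(A₀, A₁)_{θ, q; b}`. -/
noncomputable def stdSpace (A₀ A₁ : QSpace E) (θ : ℝ) (q : ℝ≥0∞) (b : ℝ → ℝ) : QSpace E :=
  finiteSpace A₀ A₁ fun f => wnorm q (Ioi 0) θ b fun u => Kfun A₀ A₁ u f

/-- The limiting space `(A₀, A₁)^R_{θ, r, b, q, a}`. -/
noncomputable def spaceR (A₀ A₁ : QSpace E) (θ : ℝ) (r : ℝ≥0∞) (b : ℝ → ℝ) (q : ℝ≥0∞)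
    (a : ℝ → ℝ) : QSpace E :=
  finiteSpace A₀ A₁ fun f =>
    wnorm r (Ioi 0) 0 b fun t => wnorm q (Ioi t) θ a fun u => Kfun A₀ A₁ u f

/-- The extremal space `(A₀, A₁)^{R,L}_{θ, s, c, r, b, q, a}`. -/
noncomputable def spaceRL (A₀ A₁ : QSpace E) (θ : ℝ) (s : ℝ≥0∞) (c : ℝ → ℝ) (r : ℝ≥0∞)
    (b : ℝ → ℝ) (q : ℝ≥0∞) (a : ℝ → ℝ) : QSpace E :=
  finiteSpace A₀ A₁ fun f =>
    wnorm s (Ioi 0) 0 c fun t => wnorm r (Ioo 0 t) 0 b fun u =>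
      wnorm q (Ioo u t) θ a fun v => Kfun A₀ A₁ v f

/-- The extremal space `(A₀, A₁)^{R,R}_{θ, s, c, r, b, q, a}`. -/
noncomputable def spaceRR (A₀ A₁ : QSpace E) (θ : ℝ) (s : ℝ≥0∞) (c : ℝ → ℝ) (r : ℝ≥0∞)
    (b : ℝ → ℝ) (q : ℝ≥0∞) (a : ℝ → ℝ) : QSpace E :=
  finiteSpace A₀ A₁ fun f =>
    wnorm s (Ioi 0) 0 c fun t => wnorm r (Ioi t) 0 b fun u =>
      wnorm q (Ioi u) θ a fun v => Kfun A₀ A₁ v f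

end Interpolation

/-! ### The auxiliary functions of the reiteration formulae

The norms below are finite for all `t > 0` under the assumptions of the theorem, so that `toReal`
only changes their type. -/

/-- `χ₀(t) = ‖s^{-1/r₀} b₀(s) ‖u^{-1/q₀} a₀(u)‖_{q₀,(s,∞)}‖_{r₀,(t,∞)}
  + ‖s^{-1/r₀} b₀(s)‖_{r₀,(0,t)} ‖u^{-1/q₀} a₀(u)‖_{q₀,(t,∞)}`. -/
noncomputable def chiZero (r₀ : ℝ≥0∞) (b₀ : ℝ → ℝ) (q₀ : ℝ≥0∞) (a₀ : ℝ → ℝ) (t : ℝ) : ℝ :=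
  (wnorm r₀ (Ioi t) 0 b₀ (fun s => wnorm q₀ (Ioi s) 0 a₀ fun _ => 1)
    + wnorm r₀ (Ioo 0 t) 0 b₀ (fun _ => 1) * wnorm q₀ (Ioi t) 0 a₀ (fun _ => 1)).toReal

/-- `χ₁(t) = ‖s^{-1/r₁} b₁(s) ‖u^{-1/q₁} a₁(u)‖_{q₁,(s,t)}‖_{r₁,(0,t)}`. -/
noncomputable def chiOne (r₁ : ℝ≥0∞) (b₁ : ℝ → ℝ) (q₁ : ℝ≥0∞) (a₁ : ℝ → ℝ) (t : ℝ) : ℝ :=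
  (wnorm r₁ (Ioo 0 t) 0 b₁ (fun s => wnorm q₁ (Ioo s t) 0 a₁ fun _ => 1)).toReal

/-! With `t = exp x`, slow variation becomes `w x ≤ C * exp (ε * |x - y|) * w y` for every `ε > 0`
(`SVar`), the power `u ^ (-1/q)` cancels the Jacobian, and `k = klog A₀ A₁ f` is increasing while
`twist k` is decreasing.

The core is a Holmstedt formula, `exists_klog_rows_equiv`: at the parameter `R x = log (ρ (exp x))`
the `K`-functional of `(X₀, X₁)` is equivalent to `holm`, a sum of a head term (the `X₀`-norm
restricted to `s < u < x`), a middle term `χ₀ k`, and cross and tail terms (the `X₁`-norm restricted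
to `u > x`). For the upper bound, a nearly optimal decomposition `f = g + l` at `x` is used: the
`K`-functional of `g` is controlled by `k` up to `x` and by the constant `k x` beyond, that of `l`
behaves symmetrically, and the constant pieces contribute exactly `χ₀ k`. For the lower bound,
`holm` is quasi-subadditive and is controlled by the `X₀`-norm and by `exp (R x)` times the
`X₁`-norm (`exists_holm_le_low`, `exists_holm_le_up`).

It remains to take a weighted `L_r` norm. Since `R x - x` is the logarithm of the slowly varying
function `χ₀ / χ₁`, `R` is a coarse isometry, and `L_r` norms of functions of moderate growth are
invariant under composition with it up to constants (`exists_lpOn_comp_le`). The middle term then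
yields the weight `a^#`, by `exp_mul_rpow_eq`. If `θ > 0` the weight decays to the right and the
head is absorbed into the middle term (`exists_headRow_norm_le`); if `θ < 1` the cross and tail
terms are absorbed (`exists_tail_norm_le`). What cannot be absorbed at `θ = 0` or `θ = 1` is the
extra limiting or extremal space. Both absorptions rest on the maximal inequality
`exists_lpOn_le_of_local`, valid for every `r > 0`. -/

/-! ### Exponentials and `L_q` quasi-norms on subsets of the line -/

/-- The exponential function with values in `ℝ≥0∞`. -/
noncomputable def expE (x : ℝ) : ℝ≥0∞ := ENNReal.ofReal (Real.exp x)

lemma expE_add (x y : ℝ) : expE (x + y) = expE x * expE y := by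
  rw [expE, expE, expE, Real.exp_add, ENNReal.ofReal_mul (Real.exp_pos x).le]

lemma expE_ne_zero (x : ℝ) : expE x ≠ 0 := by
  simpa [expE] using Real.exp_pos x

lemma expE_ne_top (x : ℝ) : expE x ≠ ∞ := ENNReal.ofReal_ne_top

@[simp] lemma expE_zero : expE 0 = 1 := by simp [expE]

lemma expE_le_expE {x y : ℝ} (h : x ≤ y) : expE x ≤ expE y :=
  ENNReal.ofReal_le_ofReal (Real.exp_le_exp.2 h)

lemma expE_mul_expE_neg (x : ℝ) : expE x * expE (-x) = 1 := by
  rw [← expE_add]; simp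

lemma expE_rpow (x p : ℝ) : expE x ^ p = expE (x * p) := by
  rw [expE, expE, ENNReal.ofReal_rpow_of_pos (Real.exp_pos x), Real.exp_mul]

lemma measurable_expE : Measurable expE :=
  ENNReal.measurable_ofReal.comp Real.measurable_exp

/-- The `L_q` quasi-norm of `G` on `I`, with respect to Lebesgue measure. -/
noncomputable def lpOn (q : ℝ≥0∞) (I : Set ℝ) (G : ℝ → ℝ≥0∞) : ℝ≥0∞ :=
  eLpNorm G q (volume.restrict I)

section lpOn

variable {q : ℝ≥0∞} {I J : Set ℝ} {F G : ℝ → ℝ≥0∞}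

lemma lpOn_eq_lintegral (h0 : q ≠ 0) (ht : q ≠ ∞) :
    lpOn q I G = (∫⁻ x in I, G x ^ q.toReal) ^ (1 / q.toReal) := by
  simp [lpOn, eLpNorm_eq_lintegral_rpow_enorm_toReal h0 ht]

lemma lpOn_top : lpOn ∞ I G = essSup G (volume.restrict I) := by
  simp [lpOn, eLpNormEssSup_eq_essSup_enorm]

lemma lpOn_mono_set (h : I ⊆ J) : lpOn q I G ≤ lpOn q J G :=
  eLpNorm_mono_measure _ (Measure.restrict_mono_set _ h)

lemma lpOn_mono_on (hI : MeasurableSet I) (h : ∀ x ∈ I, F x ≤ G x) : lpOn q I F ≤ lpOn q I G := by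
  refine eLpNorm_mono_enorm_ae ?_
  filter_upwards [ae_restrict_mem hI] with x hx
  simpa using h x hx

lemma lpOn_mono (h : ∀ x, F x ≤ G x) : lpOn q I F ≤ lpOn q I G :=
  eLpNorm_mono_enorm (by simpa using h)

lemma lpOn_const_mul {c : ℝ≥0∞} (hc : c ≠ ∞) : lpOn q I (fun x => c * G x) = c * lpOn q I G := by
  rcases eq_or_ne q 0 with rfl | h0
  · simp [lpOn]
  rcases eq_or_ne q ∞ with rfl | ht
  · simp only [lpOn_top, ENNReal.essSup_const_mul]
  have hq := ENNReal.toReal_pos h0 ht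
  simp only [lpOn_eq_lintegral h0 ht, ENNReal.mul_rpow_of_nonneg _ _ hq.le]
  rw [lintegral_const_mul' _ _ (ENNReal.rpow_ne_top_of_nonneg hq.le hc),
    ENNReal.mul_rpow_of_nonneg _ _ (by positivity), ← ENNReal.rpow_mul,
    mul_one_div_cancel hq.ne', ENNReal.rpow_one]

lemma lpOn_le_mul {c : ℝ≥0∞} (hc : c ≠ ∞) (hI : MeasurableSet I)
    (h : ∀ x ∈ I, F x ≤ c * G x) : lpOn q I F ≤ c * lpOn q I G :=
  (lpOn_mono_on hI h).trans (lpOn_const_mul hc).le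

lemma mul_le_lpOn {c : ℝ≥0∞} (hc : c ≠ ∞) (hI : MeasurableSet I)
    (h : ∀ x ∈ I, c * F x ≤ G x) : c * lpOn q I F ≤ lpOn q I G :=
  (lpOn_const_mul hc).ge.trans (lpOn_mono_on hI h)

lemma lpOn_congr_ae_set (h : I =ᵐ[volume] J) : lpOn q I G = lpOn q J G := by
  rw [lpOn, lpOn, Measure.restrict_congr_set h]

lemma lpOn_Ici (x : ℝ) : lpOn q (Ici x) G = lpOn q (Ioi x) G :=
  lpOn_congr_ae_set Ioi_ae_eq_Ici.symm

lemma lpOn_comp_add (d : ℝ) (I : Set ℝ) :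
    lpOn q I G = lpOn q ((· + d) ⁻¹' I) (fun s => G (s + d)) := by
  have hmp := measurePreserving_add_right (volume : Measure ℝ) d
  have he := measurableEmbedding_addRight d
  have := he.eLpNorm_map_measure (g := G) (p := q) (μ := volume.restrict ((· + d) ⁻¹' I))
  rw [← he.restrict_map, hmp.map_eq] at this
  exact this

lemma lpOn_Ioi_comp (x y : ℝ) : lpOn q (Ioi x) G = lpOn q (Ioi y) (fun s => G (s + (x - y))) := by
  rw [lpOn_comp_add (x - y)]; simp

lemma lpOn_Iio_comp (x y : ℝ) : lpOn q (Iio x) G = lpOn q (Iio y) (fun s => G (s + (x - y))) := by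
  rw [lpOn_comp_add (x - y)]; simp

lemma lpOn_Ioo_comp (a x y : ℝ) :
    lpOn q (Ioo (a + (x - y)) x) G = lpOn q (Ioo a y) (fun s => G (s + (x - y))) := by
  rw [lpOn_comp_add (x - y)]; simp

/-- Only the domain is split, so no measurability of `G` is needed. For finite `q` the constant
comes from `(a + b) ^ (1/q) ≤ (2 * max a b) ^ (1/q)`, which covers `q < 1` as well. -/
lemma lpOn_union (q : ℝ≥0∞) : ∃ C : ℝ≥0, ∀ I J G,
    lpOn q (I ∪ J) G ≤ C * (lpOn q I G + lpOn q J G) := by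
  rcases eq_or_ne q 0 with rfl | h0
  · exact ⟨0, fun I J G => by simp [lpOn]⟩
  rcases eq_or_ne q ∞ with rfl | ht
  · refine ⟨1, fun I J G => ?_⟩
    simp only [lpOn_top, ENNReal.coe_one, one_mul]
    refine essSup_le_of_ae_le _ ((ae_restrict_union_iff _ _ _).2 ⟨?_, ?_⟩)
    · filter_upwards [ENNReal.ae_le_essSup G] with x hx using hx.trans le_self_add
    · filter_upwards [ENNReal.ae_le_essSup G] with x hx using hx.trans le_add_self
  have hq := ENNReal.toReal_pos h0 ht
  obtain ⟨C, hC⟩ : ∃ C : ℝ≥0, ∀ a b : ℝ≥0∞,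
      (a + b) ^ (1 / q.toReal) ≤ C * (a ^ (1 / q.toReal) + b ^ (1 / q.toReal)) := by
    refine ⟨2 ^ (1 / q.toReal), fun a b => ?_⟩
    have hp : 0 ≤ 1 / q.toReal := by positivity
    calc (a + b) ^ (1 / q.toReal) ≤ (2 * max a b) ^ (1 / q.toReal) := by
          rw [two_mul]; gcongr <;> simp
      _ = 2 ^ (1 / q.toReal) * (max a b) ^ (1 / q.toReal) := ENNReal.mul_rpow_of_nonneg _ _ hp
      _ ≤ _ := by
          rw [ENNReal.coe_rpow_of_nonneg _ hp]
          gcongr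
          · simp
          · rcases max_cases a b with h | h <;> rw [h.1]
            · exact le_self_add
            · exact le_add_self
  refine ⟨C, fun I J G => ?_⟩
  simp only [lpOn_eq_lintegral h0 ht]
  refine le_trans ?_ (hC _ _)
  gcongr
  exact lintegral_union_le _ _ _

end lpOn

/-! ### Functions of moderate growth and slowly varying functions -/

/-- `G` changes at most by the factor `C * exp (M * |x - y|)` between `x` and `y`. -/
def VaryBound (C : ℝ≥0) (M : ℝ) (G : ℝ → ℝ≥0∞) : Prop :=
  ∀ x y, G x ≤ C * expE (M * |x - y|) * G y

/-- Slowly varying functions in the logarithmic variable. -/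
structure SVar (w : ℝ → ℝ≥0∞) : Prop where
  ne_zero : ∀ x, w x ≠ 0
  ne_top : ∀ x, w x ≠ ∞
  vary : ∀ ε : ℝ, 0 < ε → ∃ C, VaryBound C ε w

lemma VaryBound.mul {C D : ℝ≥0} {M N : ℝ} {F G : ℝ → ℝ≥0∞} (hF : VaryBound C M F)
    (hG : VaryBound D N G) : VaryBound (C * D) (M + N) (fun x => F x * G x) := by
  intro x y
  calc F x * G x ≤ (C * expE (M * |x - y|) * F y) * (D * expE (N * |x - y|) * G y) :=
        mul_le_mul' (hF x y) (hG x y)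
    _ = _ := by rw [add_mul, expE_add]; push_cast; ring

lemma VaryBound.add {C D : ℝ≥0} {M : ℝ} {F G : ℝ → ℝ≥0∞} (hF : VaryBound C M F)
    (hG : VaryBound D M G) : VaryBound (C + D) M (fun x => F x + G x) := by
  intro x y
  calc F x + G x ≤ (C * expE (M * |x - y|) * F y) + (D * expE (M * |x - y|) * G y) :=
        add_le_add (hF x y) (hG x y)
    _ ≤ (C + D) * expE (M * |x - y|) * F y + (C + D) * expE (M * |x - y|) * G y := by
        gcongr <;> simp
    _ = _ := by push_cast; ring

lemma VaryBound.inv {C : ℝ≥0} {M : ℝ} {F : ℝ → ℝ≥0∞} (hF : VaryBound C M F)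
    (h0 : ∀ x, F x ≠ 0) : VaryBound C M (fun x => (F x)⁻¹) := by
  intro x y
  have h := hF y x
  rw [abs_sub_comm] at h
  have hC : (C : ℝ≥0∞) ≠ 0 := by
    rintro hC
    have := hF x x
    simp [hC] at this
    exact h0 x this
  set c := (C : ℝ≥0∞) * expE (M * |x - y|) with hc
  have hc0 : c ≠ 0 := mul_ne_zero hC (expE_ne_zero _)
  have hct : c ≠ ∞ := ENNReal.mul_ne_top ENNReal.coe_ne_top (expE_ne_top _)
  have := ENNReal.inv_le_inv.2 h
  rw [ENNReal.mul_inv (Or.inl hc0) (Or.inl hct)] at this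
  calc (F x)⁻¹ = c * (c⁻¹ * (F x)⁻¹) := by
        rw [← mul_assoc, ENNReal.mul_inv_cancel hc0 hct, one_mul]
    _ ≤ _ := by gcongr

lemma VaryBound.le_of_dist_le {C : ℝ≥0} {M D : ℝ} {G : ℝ → ℝ≥0∞} (hG : VaryBound C M G)
    (hM : 0 ≤ M) {x y : ℝ} (h : |x - y| ≤ D) : G x ≤ C * expE (M * D) * G y := by
  refine (hG x y).trans ?_
  gcongr
  exact expE_le_expE (by gcongr)

lemma varyBound_expE (θ : ℝ) : VaryBound 1 |θ| (fun x => expE (θ * x)) := by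
  intro x y
  rw [ENNReal.coe_one, one_mul, ← expE_add]
  refine expE_le_expE ?_
  have : θ * (x - y) ≤ |θ| * |x - y| := (le_abs_self _).trans (abs_mul _ _).le
  linarith

/-- Monotonicity settles `x ≤ y` with factor `1`; for `y ≤ x` the antitone companion loses at most
`exp (x - y)`. Every `K`-functional satisfies both hypotheses. -/
lemma VaryBound.of_monotone {k : ℝ → ℝ≥0∞} (h : Monotone k)
    (h' : Antitone fun x => expE (-x) * k x) : VaryBound 1 1 k := by
  intro x y
  rw [ENNReal.coe_one, one_mul, one_mul]
  rcases le_total x y with hxy | hxy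
  · calc k x ≤ 1 * k y := by simpa using h hxy
      _ ≤ _ := by gcongr; rw [← expE_zero]; exact expE_le_expE (abs_nonneg _)
  · have := h' hxy
    calc k x = expE x * (expE (-x) * k x) := by
          rw [← mul_assoc, expE_mul_expE_neg, one_mul]
      _ ≤ expE x * (expE (-y) * k y) := by gcongr
      _ = expE (x - y) * k y := by rw [← mul_assoc, ← expE_add, sub_eq_add_neg]
      _ ≤ _ := by gcongr; exact expE_le_expE (le_abs_self _)

lemma SVar.mul {F G : ℝ → ℝ≥0∞} (hF : SVar F) (hG : SVar G) : SVar fun x => F x * G x where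
  ne_zero x := mul_ne_zero (hF.ne_zero x) (hG.ne_zero x)
  ne_top x := ENNReal.mul_ne_top (hF.ne_top x) (hG.ne_top x)
  vary ε hε := by
    obtain ⟨C, hC⟩ := hF.vary (ε / 2) (by positivity)
    obtain ⟨D, hD⟩ := hG.vary (ε / 2) (by positivity)
    exact ⟨C * D, by simpa using hC.mul hD⟩

lemma SVar.inv {F : ℝ → ℝ≥0∞} (hF : SVar F) : SVar fun x => (F x)⁻¹ where
  ne_zero x := ENNReal.inv_ne_zero.2 (hF.ne_top x)
  ne_top x := ENNReal.inv_ne_top.2 (hF.ne_zero x)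
  vary ε hε := by
    obtain ⟨C, hC⟩ := hF.vary ε hε
    exact ⟨C, hC.inv hF.ne_zero⟩

lemma SVar.div {F G : ℝ → ℝ≥0∞} (hF : SVar F) (hG : SVar G) : SVar fun x => F x / G x := by
  simpa [div_eq_mul_inv] using hF.mul hG.inv

/-- The inequality part of slow variation, for a function which is finite somewhere and nowhere
zero. -/
lemma SVar.of_vary {w : ℝ → ℝ≥0∞} (h : ∀ ε : ℝ, 0 < ε → ∃ C, VaryBound C ε w)
    (h0 : ∀ x, w x ≠ 0) {y : ℝ} (ht : w y ≠ ∞) : SVar w where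
  ne_zero := h0
  vary := h
  ne_top x := by
    obtain ⟨C, hC⟩ := h 1 one_pos
    exact ne_top_of_le_ne_top
      (ENNReal.mul_ne_top (ENNReal.mul_ne_top ENNReal.coe_ne_top (expE_ne_top _)) ht) (hC x y)

/-! ### Norms over half-lines with a moving endpoint inherit moderate growth. -/

section closure

variable {q r : ℝ≥0∞} {C D : ℝ≥0} {M N : ℝ} {w a b : ℝ → ℝ≥0∞}

lemma VaryBound.shift (hw : VaryBound C M w) (x y s : ℝ) :
    w (s + (x - y)) ≤ C * expE (M * |x - y|) * w s := by
  simpa using hw (s + (x - y)) s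

lemma varyConst_ne_top (C : ℝ≥0) (z : ℝ) : (C : ℝ≥0∞) * expE z ≠ ∞ :=
  ENNReal.mul_ne_top ENNReal.coe_ne_top (expE_ne_top _)

/-- Translation by `x - y` carries one half-line to the other, and the pointwise bound on `w` passes
through the norm with the same constants. -/
lemma VaryBound.lpOn_Ioi (hw : VaryBound C M w) : VaryBound C M fun x => lpOn q (Ioi x) w := by
  intro x y
  simp only
  rw [lpOn_Ioi_comp x y]
  exact lpOn_le_mul (varyConst_ne_top _ _) measurableSet_Ioi fun s _ => hw.shift x y s

lemma VaryBound.lpOn_Iio (hw : VaryBound C M w) : VaryBound C M fun x => lpOn q (Iio x) w := by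
  intro x y
  simp only
  rw [lpOn_Iio_comp x y]
  exact lpOn_le_mul (varyConst_ne_top _ _) measurableSet_Iio fun s _ => hw.shift x y s

lemma VaryBound.lpOn_Iio_lpOn_Ioo (hb : VaryBound C M b) (ha : VaryBound D N a) :
    VaryBound (C * D) (M + N) fun x => lpOn r (Iio x) fun s => b s * lpOn q (Ioo s x) a := by
  intro x y
  simp only
  rw [lpOn_Iio_comp x y]
  refine lpOn_le_mul (varyConst_ne_top _ _) measurableSet_Iio fun s _ => ?_
  rw [lpOn_Ioo_comp s x y]
  calc _ ≤ (C * expE (M * |x - y|) * b s) * (D * expE (N * |x - y|) * lpOn q (Ioo s y) a) :=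
        mul_le_mul' (hb.shift x y s)
          (lpOn_le_mul (varyConst_ne_top _ _) measurableSet_Ioo fun s _ => ha.shift x y s)
    _ = _ := by rw [add_mul, expE_add]; push_cast; ring

end closure

/-! ### Regularisation, triangle inequality and local bounds -/

/-- A step function comparable with `G` when `G` has moderate growth. -/
noncomputable def stepReg (G : ℝ → ℝ≥0∞) (x : ℝ) : ℝ≥0∞ := G (⌊x⌋ : ℤ)

lemma measurable_stepReg (G : ℝ → ℝ≥0∞) : Measurable (stepReg G) :=
  (measurable_from_top (f := fun n : ℤ => G n)).comp Int.measurable_floor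

lemma abs_sub_floor_le (x : ℝ) : |x - (⌊x⌋ : ℤ)| ≤ 1 := by
  rw [abs_of_nonneg (sub_nonneg.2 (Int.floor_le x))]
  linarith [Int.lt_floor_add_one x]

lemma VaryBound.le_stepReg {C : ℝ≥0} {M : ℝ} {G : ℝ → ℝ≥0∞} (hG : VaryBound C M G) (hM : 0 ≤ M)
    (x : ℝ) : G x ≤ C * expE M * stepReg G x := by
  simpa [stepReg] using hG.le_of_dist_le hM (abs_sub_floor_le x)

lemma VaryBound.stepReg_le {C : ℝ≥0} {M : ℝ} {G : ℝ → ℝ≥0∞} (hG : VaryBound C M G) (hM : 0 ≤ M)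
    (x : ℝ) : stepReg G x ≤ C * expE M * G x := by
  have := hG.le_of_dist_le hM (abs_sub_comm _ x ▸ abs_sub_floor_le x)
  simpa [stepReg] using this

lemma exists_nnreal_eq {c : ℝ≥0∞} (h : c ≠ ∞) : ∃ C : ℝ≥0, (C : ℝ≥0∞) = c :=
  ⟨c.toNNReal, ENNReal.coe_toNNReal h⟩

/-- The weight `w` carries no measurability assumption, so the quasi-triangle inequality of `L_q` is
applied with the measurable comparable weight `stepReg w`. -/
lemma VaryBound.lpOn_mul_add {C : ℝ≥0} {M : ℝ} {w : ℝ → ℝ≥0∞} (hw : VaryBound C M w) (hM : 0 ≤ M)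
    (q : ℝ≥0∞) : ∃ D : ℝ≥0, ∀ I F G, Measurable F → Measurable G →
      lpOn q I (fun x => w x * (F x + G x)) ≤
        D * (lpOn q I (fun x => w x * F x) + lpOn q I (fun x => w x * G x)) := by
  set c : ℝ≥0∞ := C * expE M with hc
  have hct : c ≠ ∞ := ENNReal.mul_ne_top ENNReal.coe_ne_top (expE_ne_top _)
  have hL := (ENNReal.LpAddConst_lt_top q).ne
  obtain ⟨D, hD⟩ := exists_nnreal_eq (ENNReal.mul_ne_top (ENNReal.mul_ne_top hct hL) hct)
  refine ⟨D, fun I F G hF hG => ?_⟩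
  have key : ∀ H : ℝ → ℝ≥0∞, lpOn q I (fun x => stepReg w x * H x)
      ≤ c * lpOn q I (fun x => w x * H x) := by
    intro H
    rw [← lpOn_const_mul hct]
    refine lpOn_mono fun x => ?_
    rw [← mul_assoc]
    gcongr
    exact hw.stepReg_le hM x
  calc lpOn q I (fun x => w x * (F x + G x))
      ≤ lpOn q I (fun x => c * (stepReg w x * F x + stepReg w x * G x)) := by
        refine lpOn_mono fun x => ?_
        rw [← mul_add, ← mul_assoc]
        gcongr
        exact hw.le_stepReg hM x
    _ = c * lpOn q I ((fun x => stepReg w x * F x) + fun x => stepReg w x * G x) :=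
        lpOn_const_mul hct
    _ ≤ c * (ENNReal.LpAddConst q * (lpOn q I (fun x => stepReg w x * F x) +
          lpOn q I fun x => stepReg w x * G x)) := by
        gcongr
        exact eLpNorm_add_le' ((measurable_stepReg w).mul hF).aestronglyMeasurable
          ((measurable_stepReg w).mul hG).aestronglyMeasurable q
    _ ≤ c * (ENNReal.LpAddConst q * (c * lpOn q I (fun x => w x * F x) +
          c * lpOn q I fun x => w x * G x)) := by gcongr <;> exact key _
    _ = _ := by rw [hD]; ring

/-- On a unit interval next to `x` the function `G` is at least a fixed multiple of `G x`. This
converts point values into norms, for every `q ≠ 0`. -/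
lemma exists_le_lpOn {q : ℝ≥0∞} (hq : q ≠ 0) (C : ℝ≥0) {M : ℝ} (hM : 0 ≤ M) :
    ∃ D : ℝ≥0, ∀ G, VaryBound C M G → ∀ (x : ℝ) (I : Set ℝ),
      Ioo (x - 1) x ⊆ I ∨ Ioo x (x + 1) ⊆ I → G x ≤ D * lpOn q I G := by
  obtain ⟨D, hD⟩ := exists_nnreal_eq (varyConst_ne_top C M)
  have hDt : (D : ℝ≥0∞) ≠ ∞ := ENNReal.coe_ne_top
  refine ⟨D, fun G hG x I hI => ?_⟩
  have key : ∀ J : Set ℝ, MeasurableSet J → volume J = 1 → (∀ y ∈ J, |x - y| ≤ 1) →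
      G x ≤ D * lpOn q J G := by
    intro J hJ hv hd
    have : lpOn q J (fun _ => G x) = G x := by
      rw [lpOn, eLpNorm_const _ hq (by simp [hv])]
      simp [hv]
    rw [← this]
    refine lpOn_le_mul hDt hJ fun y hy => ?_
    rw [hD]
    simpa using hG.le_of_dist_le hM (hd y hy)
  rcases hI with hI | hI
  · refine (key (Ioo (x - 1) x) measurableSet_Ioo (by simp) fun y hy => ?_).trans
      (by gcongr; exact lpOn_mono_set hI)
    rw [abs_le]; constructor <;> linarith [hy.1, hy.2]
  · refine (key (Ioo x (x + 1)) measurableSet_Ioo (by simp) fun y hy => ?_).trans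
      (by gcongr; exact lpOn_mono_set hI)
    rw [abs_le]; constructor <;> linarith [hy.1, hy.2]

lemma lpOn_univ_const_top {q : ℝ≥0∞} (hq : q ≠ 0) {I : Set ℝ} (hI : volume I ≠ 0) :
    lpOn q I (fun _ => ∞) = ∞ := by
  rw [lpOn, eLpNorm_const _ hq (by simpa using hI)]
  rcases eq_or_ne q ∞ with rfl | ht
  · simp
  · simp only [enorm_eq_self, MeasurableSet.univ, Measure.restrict_apply, univ_inter]
    refine ENNReal.top_mul ?_
    simp [ENNReal.rpow_eq_zero_iff, hI]

/-! ### Exponential kernels -/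

lemma lintegral_expE_neg_abs_lt_top {δ : ℝ} (hδ : 0 < δ) :
    ∫⁻ u, expE (-δ * |u|) < ∞ := by
  have h1 : IntegrableOn (fun u : ℝ => Real.exp (-δ * |u|)) (Iic 0) :=
    (integrableOn_exp_mul_Iic hδ 0).congr_fun
      (fun u hu => by simp [abs_of_nonpos (show u ≤ 0 from hu)]) measurableSet_Iic
  have h2 : IntegrableOn (fun u : ℝ => Real.exp (-δ * |u|)) (Ioi 0) :=
    (integrableOn_exp_mul_Ioi (neg_lt_zero.2 hδ) 0).congr_fun
      (fun u hu => by simp [abs_of_pos (show 0 < u from hu)]) measurableSet_Ioi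
  have h := (h1.union h2)
  rw [Iic_union_Ioi, integrableOn_univ] at h
  exact h.lintegral_lt_top

lemma lintegral_expE_neg_abs_sub (δ x : ℝ) :
    ∫⁻ u, expE (-δ * |x - u|) = ∫⁻ u, expE (-δ * |u|) := by
  rw [← lintegral_sub_left_eq_self (fun u => expE (-δ * |u|)) x]

lemma exists_lpOn_expE_le (q : ℝ≥0∞) {δ : ℝ} (hδ : 0 < δ) :
    ∃ C : ℝ≥0, ∀ x I, lpOn q I (fun u => expE (-δ * |x - u|)) ≤ C := by
  rcases eq_or_ne q 0 with rfl | h0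
  · exact ⟨0, fun x I => by simp [lpOn]⟩
  rcases eq_or_ne q ∞ with rfl | ht
  · refine ⟨1, fun x I => ?_⟩
    rw [lpOn_top]
    refine essSup_le_of_ae_le _ (Eventually.of_forall fun u => ?_)
    simp only [ENNReal.coe_one]
    rw [← expE_zero]
    exact expE_le_expE (by nlinarith [abs_nonneg (x - u)])
  have hq := ENNReal.toReal_pos h0 ht
  have hfin := lintegral_expE_neg_abs_lt_top (mul_pos hδ hq)
  obtain ⟨C, hC⟩ := exists_nnreal_eq
    (ENNReal.rpow_ne_top_of_nonneg (y := 1 / q.toReal) (by positivity) hfin.ne)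
  refine ⟨C, fun x I => ?_⟩
  rw [lpOn_eq_lintegral h0 ht, hC, ← lintegral_expE_neg_abs_sub _ x]
  refine ENNReal.rpow_le_rpow ?_ (by positivity)
  refine (setLIntegral_le_lintegral _ _).trans (lintegral_mono fun u => ?_)
  rw [expE_rpow]
  exact expE_le_expE (le_of_eq (by ring))

/-- Half of the decay pays for replacing `w u` by `w x`; the other half keeps the norm of the kernel
bounded, uniformly in `x` and `I`. -/
lemma SVar.exists_lpOn_mul_expE_le {w : ℝ → ℝ≥0∞} (hw : SVar w) (q : ℝ≥0∞) {δ : ℝ} (hδ : 0 < δ) :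
    ∃ C : ℝ≥0, ∀ x I, MeasurableSet I →
      lpOn q I (fun u => w u * expE (-δ * |x - u|)) ≤ C * w x := by
  obtain ⟨C, hC⟩ := hw.vary (δ / 2) (by positivity)
  obtain ⟨D, hD⟩ := exists_lpOn_expE_le q (δ := δ / 2) (by positivity)
  refine ⟨C * D, fun x I hI => ?_⟩
  have ht : C * w x ≠ ∞ := ENNReal.mul_ne_top ENNReal.coe_ne_top (hw.ne_top x)
  refine (lpOn_le_mul (G := fun u => expE (-(δ / 2) * |x - u|)) ht hI fun u _ => ?_).trans ?_
  · calc w u * expE (-δ * |x - u|) ≤ (C * expE (δ / 2 * |u - x|) * w x) * expE (-δ * |x - u|) := by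
          gcongr; exact hC u x
      _ = C * w x * (expE (δ / 2 * |u - x|) * expE (-δ * |x - u|)) := by ring
      _ = _ := by rw [← expE_add, abs_sub_comm u x]; ring_nf
  · calc _ ≤ C * w x * D := by gcongr; exact hD x I
      _ = _ := by push_cast; ring

/-! ### A maximal inequality of Hardy type -/

/-- The hypothesis says that `F x` is at most `A` times the supremum over `u` of `exp (-δ * |x - u|)
* G u`. By moderate growth this supremum is dominated by the `L_r` norm in `u` of the same
expression; for finite `r`, Tonelli's theorem then integrates out the kernel. No convexity is used,
so `r < 1` is allowed. -/
lemma exists_lpOn_le_of_local {r : ℝ≥0∞} (hr : r ≠ 0) (C : ℝ≥0) {M : ℝ} (hM : 0 ≤ M)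
    {δ : ℝ} (hδ : 0 < δ) :
    ∃ D : ℝ≥0, ∀ G, VaryBound C M G → ∀ (A : ℝ≥0) (F : ℝ → ℝ≥0∞),
      (∀ x m, m ≠ ∞ → (∀ u, expE (-δ * |x - u|) * G u ≤ m) → F x ≤ A * m) →
        lpOn r univ F ≤ D * (A + 1) * lpOn r univ G := by
  have hloc : ∀ G, VaryBound C M G → ∀ x,
      VaryBound C (δ + M) fun u => expE (-δ * |x - u|) * G u := by
    intro G hG x u v
    calc expE (-δ * |x - u|) * G u
        ≤ (expE (δ * |u - v|) * expE (-δ * |x - v|)) * (C * expE (M * |u - v|) * G v) := by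
          rw [← expE_add]
          refine mul_le_mul' (expE_le_expE ?_) (hG u v)
          have : |x - v| ≤ |x - u| + |u - v| := abs_sub_le _ _ _
          nlinarith
      _ = _ := by rw [add_mul, expE_add]; ring
  obtain ⟨D, hD⟩ := exists_le_lpOn hr C (add_nonneg hδ.le hM)
  have hF : ∀ G, VaryBound C M G → ∀ (A : ℝ≥0) (F : ℝ → ℝ≥0∞),
      (∀ x m, m ≠ ∞ → (∀ u, expE (-δ * |x - u|) * G u ≤ m) → F x ≤ A * m) → ∀ x,
        F x ≤ (A + 1) * (D * lpOn r univ fun u => expE (-δ * |x - u|) * G u) := by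
    intro G hG A F h x
    -- The hypothesis accepts only finite `m`; in the infinite case the factor `A + 1`, rather than
    -- `A`, keeps the right-hand side infinite even if `A = 0`.
    by_cases ht : (D * lpOn r univ fun u => expE (-δ * |x - u|) * G u) = ∞
    · rw [ht, ENNReal.mul_top (by simp)]; exact le_top
    · refine (h x _ ht fun u => hD _ (hloc G hG x) u univ (Or.inl (subset_univ _))).trans ?_
      gcongr; simp
  rcases eq_or_ne r ∞ with rfl | ht
  · refine ⟨D, fun G hG A F h => ?_⟩
    rw [lpOn_top]
    refine essSup_le_of_ae_le _ (Eventually.of_forall fun x => (hF G hG A F h x).trans ?_)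
    rw [mul_comm (D : ℝ≥0∞) (A + 1), mul_assoc]
    refine mul_le_mul' le_rfl (mul_le_mul' le_rfl ?_)
    refine lpOn_mono fun u => ?_
    refine mul_le_of_le_one_left' ?_
    rw [← expE_zero]
    exact expE_le_expE (by nlinarith [abs_nonneg (x - u)])
  have hrp := ENNReal.toReal_pos hr ht
  set p := r.toReal with hp
  have hK := lintegral_expE_neg_abs_lt_top (mul_pos hδ hrp)
  set K := ∫⁻ u, expE (-(δ * p) * |u|) with hKdef
  set c : ℝ≥0∞ := C * expE M with hc
  have hct : c ≠ ∞ := varyConst_ne_top C M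
  have hKt : K ^ (1 / p) ≠ ∞ := ENNReal.rpow_ne_top_of_nonneg (by positivity) hK.ne
  obtain ⟨B, hB⟩ := exists_nnreal_eq (ENNReal.mul_ne_top (ENNReal.mul_ne_top
    (ENNReal.mul_ne_top (ENNReal.coe_ne_top (r := D)) hct) hKt) hct)
  refine ⟨B, fun G hG A F h => ?_⟩
  have hA : (A : ℝ≥0∞) + 1 ≠ ∞ := by simp
  -- Tonelli's theorem needs a measurable integrand, which `G` itself need not provide.
  set G' := stepReg G with hG'
  have hmeas : Measurable G' := measurable_stepReg G
  -- Inner and outer exponents agree, so the inner root cancels against the outer power.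
  have hbound : lpOn r univ (fun x => lpOn r univ fun u => expE (-δ * |x - u|) * G' u)
      = K ^ (1 / p) * lpOn r univ G' := by
    simp only [lpOn_eq_lintegral hr ht, Measure.restrict_univ, ← hp]
    rw [← ENNReal.mul_rpow_of_nonneg _ _ (by positivity)]
    congr 1
    simp only [← ENNReal.rpow_mul]
    rw [one_div_mul_cancel hrp.ne']
    simp only [ENNReal.rpow_one, ENNReal.mul_rpow_of_nonneg _ _ hrp.le, expE_rpow]
    rw [lintegral_lintegral_swap, ← lintegral_const_mul _ (hmeas.pow_const _)]
    · refine lintegral_congr fun u => ?_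
      rw [lintegral_mul_const, hKdef, ← lintegral_expE_neg_abs_sub _ u]
      · congr 1
        refine lintegral_congr fun x => ?_
        rw [abs_sub_comm]; congr 1; ring
      · exact measurable_expE.comp (by fun_prop)
    · refine Measurable.aemeasurable ?_
      refine (measurable_expE.comp (by fun_prop)).mul ?_
      exact (hmeas.pow_const _).comp measurable_snd
  calc lpOn r univ F
      ≤ lpOn r univ (fun x => ((A + 1) * D * c) *
          lpOn r univ fun u => expE (-δ * |x - u|) * G' u) := by
        refine lpOn_mono fun x => (hF G hG A F h x).trans ?_
        rw [mul_assoc ((A : ℝ≥0∞) + 1), mul_assoc ((A : ℝ≥0∞) + 1), mul_assoc (D : ℝ≥0∞)]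
        gcongr
        refine lpOn_le_mul hct MeasurableSet.univ fun u _ => ?_
        calc expE (-δ * |x - u|) * G u ≤ expE (-δ * |x - u|) * (c * G' u) := by
              gcongr; exact hG.le_stepReg hM u
          _ = _ := by ring
    _ = ((A + 1) * D * c) * (K ^ (1 / p) * lpOn r univ G') := by
        rw [lpOn_const_mul (ENNReal.mul_ne_top
          (ENNReal.mul_ne_top hA ENNReal.coe_ne_top) hct), hbound]
    _ ≤ ((A + 1) * D * c) * (K ^ (1 / p) * (c * lpOn r univ G)) := by
        gcongr
        exact lpOn_le_mul hct MeasurableSet.univ fun u _ => hG.stepReg_le hM u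
    _ = _ := by rw [hB]; ring

/-! ### Change of variables along coarse isometries -/

/-- Coarse surjectivity without continuity: moving `x` by `y - R x` reduces the error `|R x - y|` to
at most half of it plus `c`, so a nearly minimal error cannot be large. -/
lemma exists_abs_sub_le_of_coarse {R : ℝ → ℝ} {c : ℝ}
    (hR : ∀ x y, |R x - R y - (x - y)| ≤ 1 / 2 * |x - y| + c) (y : ℝ) :
    ∃ x, |R x - y| ≤ 2 * c + 2 := by
  have hc : 0 ≤ c := by simpa using hR 0 0
  by_contra! hcon
  set d := ⨅ x, |R x - y| with hd
  have hbdd : BddBelow (range fun x => |R x - y|) := ⟨0, by rintro _ ⟨x, rfl⟩; exact abs_nonneg _⟩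
  have hd1 : 2 * c + 2 ≤ d := le_ciInf fun x => (hcon x).le
  obtain ⟨x, hx⟩ := exists_lt_of_ciInf_lt (show (⨅ x, |R x - y|) < d + 1 / 2 by linarith)
  have h1 := hR (x + (y - R x)) x
  have h2 : d ≤ |R (x + (y - R x)) - y| := ciInf_le hbdd _
  have e1 : R (x + (y - R x)) - R x - (x + (y - R x) - x) = R (x + (y - R x)) - y := by ring
  have e2 : |x + (y - R x) - x| = |R x - y| := by
    rw [add_sub_cancel_left, abs_sub_comm]
  rw [e1, e2] at h1
  linarith

lemma abs_sub_le_of_coarse {R : ℝ → ℝ} {c : ℝ}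
    (hR : ∀ x y, |R x - R y - (x - y)| ≤ 1 / 2 * |x - y| + c) (x y : ℝ) :
    |R x - R y| ≤ 3 / 2 * |x - y| + c := by
  have := hR x y
  have h2 := abs_add_le (R x - R y - (x - y)) (x - y)
  rw [sub_add_cancel] at h2
  linarith

lemma VaryBound.comp_coarse {C : ℝ≥0} {M : ℝ} {G : ℝ → ℝ≥0∞} (hG : VaryBound C M G) (hM : 0 ≤ M)
    {R : ℝ → ℝ} {c : ℝ} (hR : ∀ x y, |R x - R y - (x - y)| ≤ 1 / 2 * |x - y| + c) :
    ∃ D, VaryBound D (3 / 2 * M) fun x => G (R x) := by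
  obtain ⟨D, hD⟩ := exists_nnreal_eq (varyConst_ne_top C (M * c))
  refine ⟨D, fun x y => (hG _ (R y)).trans ?_⟩
  rw [hD, mul_assoc (C : ℝ≥0∞) (expE (M * c)), ← expE_add]
  refine mul_le_mul' (mul_le_mul' le_rfl (expE_le_expE ?_)) le_rfl
  nlinarith [abs_sub_le_of_coarse hR x y]

/-- `R` may be neither injective nor continuous, so no change of variables formula applies. For
finite `r` both integrals are compared with that of `P y` over the strip `|R x - y| ≤ T`: its
sections at fixed `x` have length `2 * T`, and those at fixed `y` have measure between `1` and a
constant. -/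
lemma exists_lpOn_comp_le {r : ℝ≥0∞} (hr : r ≠ 0) (C : ℝ≥0) {M : ℝ} (hM : 0 ≤ M)
    {R : ℝ → ℝ} (hRm : Measurable R) {c : ℝ}
    (hR : ∀ x y, |R x - R y - (x - y)| ≤ 1 / 2 * |x - y| + c) :
    ∃ D : ℝ≥0, ∀ G, VaryBound C M G →
      lpOn r univ (fun x => G (R x)) ≤ D * lpOn r univ G ∧
        lpOn r univ G ≤ D * lpOn r univ fun x => G (R x) := by
  have hc : 0 ≤ c := by simpa using hR 0 0
  -- `2 * c + 2` for reaching `y` coarsely, plus `3 / 2 + c` for moving the preimage by at most `1`,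
  -- rounded up.
  set T : ℝ := 3 * c + 4 with hT
  set d : ℝ≥0∞ := C * expE (M * T) with hd
  have hdt : d ≠ ∞ := varyConst_ne_top C _
  have hnear : ∀ y, ∃ x₀, ∀ x, |x - x₀| ≤ 1 → |R x - y| ≤ T := by
    intro y
    obtain ⟨x₀, hx₀⟩ := exists_abs_sub_le_of_coarse hR y
    refine ⟨x₀, fun x hx => ?_⟩
    have := abs_sub_le_of_coarse hR x x₀
    have := abs_sub_le (R x) (R x₀) y
    linarith
  rcases eq_or_ne r ∞ with rfl | ht
  · obtain ⟨D, hD⟩ := exists_le_lpOn (q := ∞) ENNReal.top_ne_zero C hM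
    obtain ⟨E, hE⟩ := exists_nnreal_eq hdt
    refine ⟨D + E, fun G hG => ⟨?_, ?_⟩⟩
    · conv_lhs => rw [lpOn_top]
      refine essSup_le_of_ae_le _ (Eventually.of_forall fun x => ?_)
      exact (hD G hG (R x) univ (Or.inl (subset_univ _))).trans (mul_le_mul' (by simp) le_rfl)
    · conv_lhs => rw [lpOn_top]
      refine essSup_le_of_ae_le _ (Eventually.of_forall fun y => ?_)
      obtain ⟨x₀, hx₀⟩ := hnear y
      have h1 : lpOn ∞ (Ioo (x₀ - 1) x₀) (fun _ => G y) = G y := by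
        rw [lpOn, eLpNorm_const _ ENNReal.top_ne_zero (by simp)]
        simp
      calc G y = lpOn ∞ (Ioo (x₀ - 1) x₀) (fun _ => G y) := h1.symm
        _ ≤ d * lpOn ∞ (Ioo (x₀ - 1) x₀) (fun x => G (R x)) := by
          refine lpOn_le_mul hdt measurableSet_Ioo fun x hx => ?_
          refine hG.le_of_dist_le hM ?_
          rw [abs_sub_comm]
          refine hx₀ x ?_
          rw [abs_le]; constructor <;> linarith [hx.1, hx.2]
        _ ≤ (D + E : ℝ≥0) * lpOn ∞ univ (fun x => G (R x)) := by
          gcongr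
          · rw [← hE]; simp
          · exact lpOn_mono_set (subset_univ _)
  have hp := ENNReal.toReal_pos hr ht
  set p := r.toReal with hpdef
  set e : ℝ≥0∞ := C * expE M with he
  have het : e ≠ ∞ := varyConst_ne_top C _
  set b : ℝ≥0∞ := (d * e) ^ p with hb
  have hbt : b ≠ ∞ := ENNReal.rpow_ne_top_of_nonneg hp.le (ENNReal.mul_ne_top hdt het)
  set V : ℝ≥0∞ := ENNReal.ofReal (2 * (4 * T + 2 * c)) + ENNReal.ofReal (2 * T) with hV
  have hVt : V ≠ ∞ := ENNReal.add_ne_top.2 ⟨ENNReal.ofReal_ne_top, ENNReal.ofReal_ne_top⟩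
  obtain ⟨D, hD⟩ := exists_nnreal_eq
    (ENNReal.rpow_ne_top_of_nonneg (y := 1 / p) (by positivity) (ENNReal.mul_ne_top hbt hVt))
  obtain ⟨e', he'⟩ := exists_nnreal_eq het
  refine ⟨D * e', fun G hG => ?_⟩
  set P : ℝ → ℝ≥0∞ := fun y => stepReg G y ^ p with hP
  have hPm : Measurable P := (measurable_stepReg G).pow_const _
  set S : Set (ℝ × ℝ) := {z | |R z.1 - z.2| ≤ T} with hS
  have hSm : MeasurableSet S := by
    refine measurableSet_le ?_ measurable_const
    exact ((hRm.comp measurable_fst).sub measurable_snd).norm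
  have hIm : Measurable (S.indicator fun z : ℝ × ℝ => P z.2) :=
    (hPm.comp measurable_snd).indicator hSm
  set I : ℝ≥0∞ := ∫⁻ x, ∫⁻ y, S.indicator (fun z : ℝ × ℝ => P z.2) (x, y) with hI
  have hx : ∀ x, ∫⁻ y, S.indicator (fun z : ℝ × ℝ => P z.2) (x, y)
      = ∫⁻ y in Icc (R x - T) (R x + T), P y := by
    intro x
    rw [← lintegral_indicator measurableSet_Icc]
    refine lintegral_congr fun y => ?_
    simp only [indicator, hS, mem_ofPred_eq, mem_Icc]
    congr 1
    rw [abs_le, eq_iff_iff]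
    constructor <;> rintro ⟨h1, h2⟩ <;> constructor <;> linarith
  have hy : ∀ y, ∫⁻ x, S.indicator (fun z : ℝ × ℝ => P z.2) (x, y)
      = P y * volume {x | |R x - y| ≤ T} := by
    intro y
    have hm : MeasurableSet {x | |R x - y| ≤ T} :=
      measurableSet_le (hRm.sub measurable_const).norm measurable_const
    rw [← setLIntegral_const, ← lintegral_indicator hm]
    rfl
  have hswap : I = ∫⁻ y, P y * volume {x | |R x - y| ≤ T} := by
    rw [hI, lintegral_lintegral_swap
      (f := fun x y => S.indicator (fun z : ℝ × ℝ => P z.2) (x, y)) hIm.aemeasurable]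
    exact lintegral_congr hy
  have hvol_le : ∀ y, volume {x | |R x - y| ≤ T} ≤ V := by
    intro y
    obtain ⟨x₀, hx₀⟩ := hnear y
    have h0 := hx₀ x₀ (by simp)
    -- Two points of the section have images at distance at most `2 * T`; solving `|x - x₀| ≤ 2 * T
    -- + |x - x₀| / 2 + c` gives the radius.
    refine (measure_mono (t := Metric.closedBall x₀ (4 * T + 2 * c)) fun x hx => ?_).trans ?_
    · rw [Metric.mem_closedBall, Real.dist_eq]
      have h1 := hR x x₀
      have h2 := abs_sub_le (R x) y (R x₀)
      rw [abs_sub_comm y] at h2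
      have h3 : |x - x₀| ≤ |R x - R x₀| + |R x - R x₀ - (x - x₀)| := by
        have := abs_sub (R x - R x₀) (R x - R x₀ - (x - x₀))
        rwa [sub_sub_cancel] at this
      have h4 : |R x - y| ≤ T := hx
      linarith
    · rw [Real.volume_closedBall]; exact le_self_add
  have hle_vol : ∀ y, 1 ≤ volume {x | |R x - y| ≤ T} := by
    intro y
    obtain ⟨x₀, hx₀⟩ := hnear y
    calc (1 : ℝ≥0∞) ≤ volume (Metric.closedBall x₀ 1) := by
          rw [Real.volume_closedBall]; simp
      _ ≤ _ := measure_mono fun x hx => hx₀ x (by simpa [Real.dist_eq] using hx)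
  have h1 : ∀ x y, |R x - y| ≤ T → G (R x) ^ p ≤ b * P y := by
    intro x y h
    rw [hb, hP, ← ENNReal.mul_rpow_of_nonneg _ _ hp.le]
    refine ENNReal.rpow_le_rpow ?_ hp.le
    calc G (R x) ≤ d * G y := hG.le_of_dist_le hM h
      _ ≤ d * (e * stepReg G y) := by gcongr; exact hG.le_stepReg hM y
      _ = _ := by ring
  have h2 : ∀ x y, |R x - y| ≤ T → P y ≤ b * G (R x) ^ p := by
    intro x y h
    rw [hb, hP, ← ENNReal.mul_rpow_of_nonneg _ _ hp.le]
    refine ENNReal.rpow_le_rpow ?_ hp.le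
    calc stepReg G y ≤ e * G y := hG.stepReg_le hM y
      _ ≤ e * (d * G (R x)) := by
        gcongr; exact hG.le_of_dist_le hM (by rwa [abs_sub_comm])
      _ = _ := by ring
  have hTpos : 0 < T := by positivity
  have habs : ∀ x y, y ∈ Icc (R x - T) (R x + T) → |R x - y| ≤ T := by
    intro x y hy
    rw [abs_le]; constructor <;> linarith [hy.1, hy.2]
  have A1 : ∫⁻ x, G (R x) ^ p ≤ b * V * ∫⁻ y, P y := by
    calc ∫⁻ x, G (R x) ^ p ≤ ∫⁻ x, b * ∫⁻ y, S.indicator (fun z : ℝ × ℝ => P z.2) (x, y) := by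
          refine lintegral_mono fun x => ?_
          rw [hx, ← lintegral_const_mul' _ _ hbt]
          calc G (R x) ^ p ≤ G (R x) ^ p * volume (Icc (R x - T) (R x + T)) := by
                refine le_mul_of_one_le_right' ?_
                rw [Real.volume_Icc, ← ENNReal.ofReal_one]
                exact ENNReal.ofReal_le_ofReal (by linarith)
            _ = ∫⁻ y in Icc (R x - T) (R x + T), G (R x) ^ p := (setLIntegral_const _ _).symm
            _ ≤ _ := setLIntegral_mono' measurableSet_Icc fun y hy => h1 x y (habs x y hy)
      _ = b * I := lintegral_const_mul' _ _ hbt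
      _ ≤ b * ∫⁻ y, V * P y := by
          rw [hswap]
          refine mul_le_mul' le_rfl (lintegral_mono fun y => ?_)
          rw [mul_comm V]
          exact mul_le_mul' le_rfl (hvol_le y)
      _ = _ := by rw [lintegral_const_mul' _ _ hVt, mul_assoc]
  have A2 : ∫⁻ y, P y ≤ b * V * ∫⁻ x, G (R x) ^ p := by
    calc ∫⁻ y, P y ≤ I := by
          rw [hswap]
          exact lintegral_mono fun y => le_mul_of_one_le_right' (hle_vol y)
      _ ≤ ∫⁻ x, b * V * G (R x) ^ p := by
          refine lintegral_mono fun x => ?_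
          rw [hx]
          calc ∫⁻ y in Icc (R x - T) (R x + T), P y
              ≤ ∫⁻ y in Icc (R x - T) (R x + T), b * G (R x) ^ p :=
                setLIntegral_mono' measurableSet_Icc fun y hy => h2 x y (habs x y hy)
            _ = b * G (R x) ^ p * ENNReal.ofReal (2 * T) := by
                rw [setLIntegral_const, Real.volume_Icc]; congr 2; ring
            _ ≤ b * G (R x) ^ p * V := by gcongr; exact le_add_self
            _ = _ := by ring
      _ = _ := lintegral_const_mul' _ _ (ENNReal.mul_ne_top hbt hVt)
  have hroot : ∀ F H : ℝ → ℝ≥0∞, ∫⁻ x, F x ^ p ≤ b * V * ∫⁻ x, H x ^ p →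
      lpOn r univ F ≤ D * lpOn r univ H := by
    intro F H h
    simp only [lpOn_eq_lintegral hr ht, Measure.restrict_univ, ← hpdef]
    rw [hD, ← ENNReal.mul_rpow_of_nonneg _ _ (by positivity)]
    gcongr
  rw [ENNReal.coe_mul, he']
  constructor
  · refine (hroot _ _ A1).trans ?_
    rw [mul_assoc]
    gcongr
    exact lpOn_le_mul het MeasurableSet.univ fun x _ => hG.stepReg_le hM x
  · calc lpOn r univ G ≤ e * lpOn r univ (stepReg G) :=
          lpOn_le_mul het MeasurableSet.univ fun x _ => hG.le_stepReg hM x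
      _ ≤ e * (D * lpOn r univ fun x => G (R x)) := by gcongr; exact hroot _ _ A2
      _ = _ := by ring

/-! ### Iterated norms -/

/-- Exponents and weights (in the logarithmic variable) of an iterated norm. -/
structure RowParams where
  r : ℝ≥0∞
  b : ℝ → ℝ≥0∞
  q : ℝ≥0∞
  a : ℝ → ℝ≥0∞

namespace RowParams

variable (P : RowParams)

/-- The iterated norm over `{(s, u) : s ∈ I, u ∈ J s}`. -/
noncomputable def row (I : Set ℝ) (J : ℝ → Set ℝ) (k : ℝ → ℝ≥0∞) : ℝ≥0∞ :=
  lpOn P.r I fun s => P.b s * lpOn P.q (J s) fun u => P.a u * k u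

/-- The iterated norm over `s < u < x`. -/
noncomputable def headRow (k : ℝ → ℝ≥0∞) (x : ℝ) : ℝ≥0∞ := P.row (Iio x) (fun s => Ioo s x) k

/-- The iterated norm over `x < s < u`. -/
noncomputable def tailRow (k : ℝ → ℝ≥0∞) (x : ℝ) : ℝ≥0∞ := P.row (Ioi x) Ioi k

/-- The iterated norm over `s < u`. -/
noncomputable def fullRow (k : ℝ → ℝ≥0∞) : ℝ≥0∞ := P.row univ Ioi k

/-- The product of the norm of `b` over `s < x` and the norm of `a * k` over `x < u`. -/
noncomputable def crossRow (k : ℝ → ℝ≥0∞) (x : ℝ) : ℝ≥0∞ :=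
  lpOn P.r (Iio x) P.b * lpOn P.q (Ioi x) fun u => P.a u * k u

/-- The weight `χ₀` in the logarithmic variable. -/
noncomputable def chiLow (x : ℝ) : ℝ≥0∞ := P.tailRow (fun _ => 1) x + P.crossRow (fun _ => 1) x

/-- The weight `χ₁` in the logarithmic variable. -/
noncomputable def chiUp (x : ℝ) : ℝ≥0∞ := P.headRow (fun _ => 1) x

/-- Nonzero exponents and slowly varying weights. -/
structure Regular : Prop where
  r_ne : P.r ≠ 0
  q_ne : P.q ≠ 0
  b_sv : SVar P.b
  a_sv : SVar P.a

/-- The finiteness conditions at the lower endpoint. -/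
structure Low : Prop extends P.Regular where
  norm_b : lpOn P.r (Iio 0) P.b ≠ ∞
  tail : P.tailRow (fun _ => 1) 0 ≠ ∞

/-- The finiteness condition at the upper endpoint. -/
structure Up : Prop extends P.Regular where
  head : P.headRow (fun _ => 1) 0 ≠ ∞

variable {P}

lemma row_mono_set {I I' : Set ℝ} {J J' : ℝ → Set ℝ} {k : ℝ → ℝ≥0∞} (hI : I ⊆ I')
    (hJ : ∀ s, J s ⊆ J' s) : P.row I J k ≤ P.row I' J' k :=
  (lpOn_mono_set hI).trans (lpOn_mono fun s => mul_le_mul' le_rfl (lpOn_mono_set (hJ s)))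

lemma headRow_le_fullRow (k : ℝ → ℝ≥0∞) (x : ℝ) : P.headRow k x ≤ P.fullRow k :=
  row_mono_set (subset_univ _) fun _ _ hu => hu.1

lemma tailRow_le_fullRow (k : ℝ → ℝ≥0∞) (x : ℝ) : P.tailRow k x ≤ P.fullRow k :=
  row_mono_set (subset_univ _) fun _ => subset_rfl

lemma headRow_mono (k : ℝ → ℝ≥0∞) : Monotone (P.headRow k) := fun _ _ h =>
  row_mono_set (Iio_subset_Iio h) fun _ => Ioo_subset_Ioo_right h

lemma tailRow_anti (k : ℝ → ℝ≥0∞) : Antitone (P.tailRow k) := fun _ _ h =>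
  row_mono_set (Ioi_subset_Ioi h) fun _ => subset_rfl

lemma measurable_crossRow (k : ℝ → ℝ≥0∞) : Measurable (P.crossRow k) := by
  refine Measurable.mul (Monotone.measurable fun x y h => ?_) (Antitone.measurable fun x y h => ?_)
  · exact lpOn_mono_set (Iio_subset_Iio h)
  · exact lpOn_mono_set (Ioi_subset_Ioi h)

lemma measurable_chiLow : Measurable P.chiLow :=
  (tailRow_anti _).measurable.add (measurable_crossRow _)

lemma measurable_chiUp : Measurable P.chiUp := (headRow_mono _).measurable

lemma crossRow_le_fullRow (k : ℝ → ℝ≥0∞) (x : ℝ) (h : lpOn P.q (Ioi x) (fun u => P.a u * k u) ≠ ∞) :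
    P.crossRow k x ≤ P.fullRow k := by
  rw [crossRow, mul_comm]
  refine (mul_le_lpOn h measurableSet_Iio fun s hs => ?_).trans (lpOn_mono_set (subset_univ _))
  rw [mul_comm]
  exact mul_le_mul' le_rfl (lpOn_mono_set (Ioi_subset_Ioi (le_of_lt hs)))

/-! ### Positivity, finiteness and slow variation of the weights `χ₀` and `χ₁`. -/

lemma Regular.exists_a_le (h : P.Regular) :
    ∃ C : ℝ≥0, ∀ x I, Ioo (x - 1) x ⊆ I ∨ Ioo x (x + 1) ⊆ I → P.a x ≤ C * lpOn P.q I P.a := by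
  obtain ⟨C, hC⟩ := h.a_sv.vary 1 one_pos
  obtain ⟨D, hD⟩ := exists_le_lpOn h.q_ne C zero_le_one
  exact ⟨D, fun x I hI => hD _ hC x I hI⟩

lemma Regular.exists_b_le (h : P.Regular) :
    ∃ C : ℝ≥0, ∀ x I, Ioo (x - 1) x ⊆ I ∨ Ioo x (x + 1) ⊆ I → P.b x ≤ C * lpOn P.r I P.b := by
  obtain ⟨C, hC⟩ := h.b_sv.vary 1 one_pos
  obtain ⟨D, hD⟩ := exists_le_lpOn h.r_ne C zero_le_one
  exact ⟨D, fun x I hI => hD _ hC x I hI⟩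

lemma ne_zero_of_le_mul {x y : ℝ≥0∞} {C : ℝ≥0} (hx : x ≠ 0) (h : x ≤ C * y) : y ≠ 0 := by
  rintro rfl
  exact hx (by simpa using h)

lemma Regular.norm_b_ne_zero (h : P.Regular) (x : ℝ) : lpOn P.r (Iio x) P.b ≠ 0 := by
  obtain ⟨C, hC⟩ := h.exists_b_le
  exact ne_zero_of_le_mul (h.b_sv.ne_zero x) (hC x _ (Or.inl fun _ hu => hu.2))

lemma Regular.norm_a_ne_zero (h : P.Regular) (x : ℝ) : lpOn P.q (Ioi x) P.a ≠ 0 := by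
  obtain ⟨C, hC⟩ := h.exists_a_le
  exact ne_zero_of_le_mul (h.a_sv.ne_zero x) (hC x _ (Or.inr fun _ hu => hu.1))

lemma Low.norm_b_ne_top (h : P.Low) (x : ℝ) : lpOn P.r (Iio x) P.b ≠ ∞ :=
  (SVar.of_vary (fun ε hε => (h.b_sv.vary ε hε).imp fun _ hC => hC.lpOn_Iio)
    h.norm_b_ne_zero h.norm_b).ne_top x

/-- Finiteness is extracted from the tail condition: the outer integrand `b s * ‖a‖_{(s,∞)}` has
moderate growth, so its value at `0` is bounded by its norm over `(0, ∞)`, and `b 0 ≠ 0`. -/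
lemma Low.norm_a_ne_top (h : P.Low) (x : ℝ) : lpOn P.q (Ioi x) P.a ≠ ∞ := by
  refine (SVar.of_vary (w := fun x => lpOn P.q (Ioi x) P.a) (y := 0)
    (fun ε hε => (h.a_sv.vary ε hε).imp fun _ hC => hC.lpOn_Ioi)
    h.norm_a_ne_zero ?_).ne_top x
  obtain ⟨C, hC⟩ := h.a_sv.vary 1 one_pos
  obtain ⟨D, hD⟩ := h.b_sv.vary 1 one_pos
  obtain ⟨A, hA⟩ := exists_le_lpOn h.r_ne (D * C) (M := 1 + 1) (by norm_num)
  have := hA _ (hD.mul (hC.lpOn_Ioi (q := P.q))) 0 (Ioi 0) (Or.inr fun _ hu => hu.1)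
  have ht := h.tail
  simp only [tailRow, row, mul_one] at ht
  have h2 := ne_top_of_le_ne_top (ENNReal.mul_ne_top ENNReal.coe_ne_top ht) this
  intro hcon
  rw [hcon, ENNReal.mul_top (h.b_sv.ne_zero 0)] at h2
  exact h2 rfl

lemma Low.chiLow_sv (h : P.Low) : SVar P.chiLow := by
  refine SVar.of_vary (y := 0) (fun ε hε => ?_) (fun x => ?_) ?_
  · obtain ⟨C, hC⟩ := h.a_sv.vary (ε / 2) (by positivity)
    obtain ⟨D, hD⟩ := h.b_sv.vary (ε / 2) (by positivity)
    have h1 := (hD.mul (hC.lpOn_Ioi (q := P.q))).lpOn_Ioi (q := P.r)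
    have h2 := (hD.lpOn_Iio (q := P.r)).mul (hC.lpOn_Ioi (q := P.q))
    have h3 := h1.add h2
    rw [add_halves] at h3
    refine ⟨D * C + D * C, ?_⟩
    intro x y
    simpa only [chiLow, tailRow, crossRow, row, mul_one] using h3 x y
  · simp only [chiLow, crossRow, mul_one]
    exact fun hc => mul_ne_zero (h.norm_b_ne_zero x) (h.norm_a_ne_zero x) (add_eq_zero.1 hc).2
  · simp only [chiLow, crossRow, mul_one]
    exact ENNReal.add_ne_top.2 ⟨h.tail, ENNReal.mul_ne_top (h.norm_b_ne_top 0) (h.norm_a_ne_top 0)⟩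

/-- This bound and its analogue for `chiUp` are the only links between `χ` and the row that the
Hardy-type estimates below require. -/
lemma Low.exists_norm_b_mul_a_le (h : P.Low) :
    ∃ C : ℝ≥0, ∀ x, lpOn P.r (Iio x) P.b * P.a x ≤ C * P.chiLow x := by
  obtain ⟨C, hC⟩ := h.exists_a_le
  refine ⟨C, fun x => ?_⟩
  calc lpOn P.r (Iio x) P.b * P.a x ≤ lpOn P.r (Iio x) P.b * (C * lpOn P.q (Ioi x) P.a) := by
        gcongr; exact hC x _ (Or.inr fun _ hu => hu.1)
    _ = C * P.crossRow (fun _ => 1) x := by simp only [crossRow, mul_one]; ring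
    _ ≤ _ := by gcongr; exact le_add_self

/-- For `s < x - 1` the interval `(s, x)` contains a unit interval ending at `x`, so its norm of `a`
controls `a x`; shortening the range of `s` by `1` changes the norm of `b` only by a constant
factor. -/
lemma Regular.exists_norm_b_mul_a_le (h : P.Regular) :
    ∃ C : ℝ≥0, ∀ x, lpOn P.r (Iio x) P.b * P.a x ≤ C * P.chiUp x := by
  obtain ⟨C, hC⟩ := h.exists_a_le
  obtain ⟨D, hD⟩ := h.b_sv.vary 1 one_pos
  obtain ⟨E, hE⟩ := exists_nnreal_eq (varyConst_ne_top D 1)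
  refine ⟨E * C, fun x => ?_⟩
  have h1 : lpOn P.r (Iio x) P.b ≤ E * lpOn P.r (Iio (x - 1)) P.b := by
    have := hD.lpOn_Iio (q := P.r) x (x - 1)
    simpa [hE] using this
  calc lpOn P.r (Iio x) P.b * P.a x ≤ (E * lpOn P.r (Iio (x - 1)) P.b) * P.a x := by gcongr
    _ = E * (P.a x * lpOn P.r (Iio (x - 1)) P.b) := by ring
    _ ≤ E * (lpOn P.r (Iio (x - 1)) fun s => C * (P.b s * lpOn P.q (Ioo s x) P.a)) := by
        gcongr
        refine mul_le_lpOn (h.a_sv.ne_top x) measurableSet_Iio fun s hs => ?_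
        calc P.a x * P.b s ≤ (C * lpOn P.q (Ioo s x) P.a) * P.b s := by
              gcongr
              exact hC x _ (Or.inl (Ioo_subset_Ioo_left (le_of_lt hs)))
          _ = _ := by ring
    _ ≤ E * (C * P.chiUp x) := by
        rw [lpOn_const_mul ENNReal.coe_ne_top]
        simp only [chiUp, headRow, row, mul_one]
        gcongr
        exact lpOn_mono_set (Iio_subset_Iio (by linarith))
    _ = _ := by push_cast; ring

lemma Up.chiUp_sv (h : P.Up) : SVar P.chiUp := by
  refine SVar.of_vary (y := 0) (fun ε hε => ?_) (fun x => ?_) h.head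
  · obtain ⟨C, hC⟩ := h.a_sv.vary (ε / 2) (by positivity)
    obtain ⟨D, hD⟩ := h.b_sv.vary (ε / 2) (by positivity)
    refine ⟨D * C, ?_⟩
    have h3 := hD.lpOn_Iio_lpOn_Ioo (r := P.r) (q := P.q) hC
    rw [add_halves] at h3
    intro x y
    simpa only [chiUp, headRow, row, mul_one] using h3 x y
  · obtain ⟨C, hC⟩ := h.toRegular.exists_norm_b_mul_a_le
    exact ne_zero_of_le_mul (mul_ne_zero (h.norm_b_ne_zero x) (h.a_sv.ne_zero x)) (hC x)

lemma Up.norm_b_ne_top (h : P.Up) (x : ℝ) : lpOn P.r (Iio x) P.b ≠ ∞ := by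
  obtain ⟨C, hC⟩ := h.toRegular.exists_norm_b_mul_a_le
  intro hcon
  have := ne_top_of_le_ne_top (ENNReal.mul_ne_top ENNReal.coe_ne_top (h.chiUp_sv.ne_top x)) (hC x)
  rw [hcon, ENNReal.top_mul (h.a_sv.ne_zero x)] at this
  exact this rfl

/-! ### Estimates of iterated norms -/

/-- The quasi-triangle inequality is used for the inner and then the outer norm; `J` antitone makes
the inner norms monotone in `s`, hence measurable. -/
lemma Regular.exists_row_add (h : P.Regular) :
    ∃ D : ℝ≥0, ∀ (A : ℝ≥0) (I : Set ℝ) (J : ℝ → Set ℝ) (k g l : ℝ → ℝ≥0∞),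
      Measurable g → Measurable l → Antitone J → (∀ u, k u ≤ A * (g u + l u)) →
        P.row I J k ≤ A * D * (P.row I J g + P.row I J l) := by
  obtain ⟨C, hC⟩ := h.a_sv.vary 1 one_pos
  obtain ⟨C', hC'⟩ := h.b_sv.vary 1 one_pos
  obtain ⟨D, hD⟩ := hC.lpOn_mul_add zero_le_one P.q
  obtain ⟨D', hD'⟩ := hC'.lpOn_mul_add zero_le_one P.r
  refine ⟨D * D', fun A I J k g l hg hl hJ hk => ?_⟩
  have hm : ∀ g : ℝ → ℝ≥0∞, Measurable fun s => lpOn P.q (J s) fun u => P.a u * g u :=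
    fun g => Antitone.measurable fun s t hst => lpOn_mono_set (hJ hst)
  calc P.row I J k
      ≤ lpOn P.r I fun s => (A * D : ℝ≥0) * (P.b s * ((lpOn P.q (J s) fun u => P.a u * g u)
          + lpOn P.q (J s) fun u => P.a u * l u)) := by
        refine lpOn_mono fun s => ?_
        calc P.b s * lpOn P.q (J s) (fun u => P.a u * k u)
            ≤ P.b s * lpOn P.q (J s) (fun u => A * (P.a u * (g u + l u))) := by
              refine mul_le_mul' le_rfl (lpOn_mono fun u => ?_)
              calc P.a u * k u ≤ P.a u * (A * (g u + l u)) := by gcongr; exact hk u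
                _ = _ := by ring
          _ ≤ P.b s * (A * (D * ((lpOn P.q (J s) fun u => P.a u * g u)
              + lpOn P.q (J s) fun u => P.a u * l u))) := by
              rw [lpOn_const_mul ENNReal.coe_ne_top]
              gcongr
              exact hD _ _ _ hg hl
          _ = _ := by push_cast; ring
    _ ≤ (A * D : ℝ≥0) * (D' * (P.row I J g + P.row I J l)) := by
        rw [lpOn_const_mul ENNReal.coe_ne_top]
        gcongr
        exact hD' _ _ _ (hm g) (hm l)
    _ = _ := by push_cast; ring

lemma Regular.exists_crossRow_add (h : P.Regular) :
    ∃ D : ℝ≥0, ∀ (A : ℝ≥0) (k g l : ℝ → ℝ≥0∞) (x : ℝ),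
      Measurable g → Measurable l → (∀ u, k u ≤ A * (g u + l u)) →
        P.crossRow k x ≤ A * D * (P.crossRow g x + P.crossRow l x) := by
  obtain ⟨C, hC⟩ := h.a_sv.vary 1 one_pos
  obtain ⟨D, hD⟩ := hC.lpOn_mul_add zero_le_one P.q
  refine ⟨D, fun A k g l x hg hl hk => ?_⟩
  calc P.crossRow k x
      ≤ lpOn P.r (Iio x) P.b * (A * (D * ((lpOn P.q (Ioi x) fun u => P.a u * g u)
          + lpOn P.q (Ioi x) fun u => P.a u * l u))) := by
        refine mul_le_mul' le_rfl ?_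
        refine (lpOn_le_mul (G := fun u => P.a u * (g u + l u)) (c := A) ENNReal.coe_ne_top
          measurableSet_Ioi fun u _ => ?_).trans ?_
        · calc P.a u * k u ≤ P.a u * (A * (g u + l u)) := by gcongr; exact hk u
            _ = _ := by ring
        · gcongr
          exact hD _ _ _ hg hl
    _ = _ := by simp only [crossRow]; ring

/-- For `u > x` one has `k u ≥ k x`. The tail part of `χ₀` then sits in the range `s > x` of the
full norm and the cross part in `s < x`, whence the factor `2`. -/
lemma chiLow_mul_le_fullRow {k : ℝ → ℝ≥0∞} (hk : Monotone k) {x : ℝ} (hx : k x ≠ ∞)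
    (hP : P.Low) : P.chiLow x * k x ≤ 2 * P.fullRow k := by
  have key : ∀ s, x ≤ s → k x * lpOn P.q (Ioi s) P.a ≤ lpOn P.q (Ioi s) fun u => P.a u * k u :=
    fun s hs => mul_le_lpOn hx measurableSet_Ioi fun u hu => by
      rw [mul_comm]; exact mul_le_mul' le_rfl (hk (hs.trans (le_of_lt hu)))
  rw [chiLow, add_mul, two_mul]
  refine add_le_add ?_ ?_
  · rw [mul_comm]
    refine (mul_le_lpOn (I := Ioi x) hx measurableSet_Ioi fun s hs => ?_).trans
      (tailRow_le_fullRow k x)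
    simp only [mul_one]
    rw [mul_left_comm]
    exact mul_le_mul' le_rfl (key s (le_of_lt hs))
  · have ht : k x * lpOn P.q (Ioi x) P.a ≠ ∞ := ENNReal.mul_ne_top hx (hP.norm_a_ne_top x)
    calc P.crossRow (fun _ => 1) x * k x
        = (k x * lpOn P.q (Ioi x) P.a) * lpOn P.r (Iio x) P.b := by
          simp only [crossRow, mul_one]; ring
      _ ≤ lpOn P.r (Iio x) fun s => P.b s * lpOn P.q (Ioi s) fun u => P.a u * k u := by
          refine mul_le_lpOn ht measurableSet_Iio fun s hs => ?_
          rw [mul_comm]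
          exact mul_le_mul' le_rfl ((key x le_rfl).trans
            (lpOn_mono_set (Ioi_subset_Ioi (le_of_lt hs))))
      _ ≤ _ := lpOn_mono_set (subset_univ _)

lemma chiUp_mul_le_fullRow {k : ℝ → ℝ≥0∞} (hk : Antitone k) {x : ℝ} (hx : k x ≠ ∞) :
    P.chiUp x * k x ≤ P.fullRow k := by
  refine le_trans ?_ (headRow_le_fullRow k x)
  rw [mul_comm]
  refine mul_le_lpOn (I := Iio x) hx measurableSet_Iio fun s hs => ?_
  rw [mul_left_comm]
  refine mul_le_mul' le_rfl (mul_le_lpOn hx measurableSet_Ioo fun u hu => ?_)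
  rw [mul_one, mul_comm]
  exact mul_le_mul' le_rfl (hk hu.2.le)

lemma mul_le_of_weight_le {χ a : ℝ → ℝ≥0∞} (hχ : SVar χ) {k m e : ℝ≥0∞} {u : ℝ}
    (h : χ u * k ≤ m * e) : a u * k ≤ m * (a u * (χ u)⁻¹ * e) := by
  calc a u * k = a u * (χ u)⁻¹ * (χ u * k) := by
        rw [mul_assoc, ← mul_assoc (χ u)⁻¹, ENNReal.inv_mul_cancel (hχ.ne_zero u) (hχ.ne_top u),
          one_mul]
    _ ≤ a u * (χ u)⁻¹ * (m * e) := by gcongr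
    _ = _ := by ring

lemma mul_inv_le_of_le_mul {χ : ℝ≥0∞} (h0 : χ ≠ 0) (ht : χ ≠ ∞) {y : ℝ≥0∞} {C : ℝ≥0}
    (h : y ≤ C * χ) : y * χ⁻¹ ≤ C := by
  calc y * χ⁻¹ ≤ C * χ * χ⁻¹ := by gcongr
    _ = C := by rw [mul_assoc, ENNReal.mul_inv_cancel h0 ht, mul_one]

/-- Dividing by `χ`, the inner norm concentrates at `u = x` and is at most a multiple of `m * a x /
χ x`, uniformly in `s`. The outer norm then produces `‖b‖_{(-∞,x)} * a x / χ x`, bounded by `hB`. -/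
lemma Regular.exists_headRow_le (h : P.Regular) {χ : ℝ → ℝ≥0∞} (hχ : SVar χ)
    (hB : ∃ C : ℝ≥0, ∀ x, lpOn P.r (Iio x) P.b * P.a x ≤ C * χ x) {δ : ℝ} (hδ : 0 < δ) :
    ∃ D : ℝ≥0, ∀ (k : ℝ → ℝ≥0∞) (x : ℝ) (m : ℝ≥0∞), m ≠ ∞ →
      (∀ u, u < x → χ u * k u ≤ m * expE (-δ * |x - u|)) → P.headRow k x ≤ D * m := by
  obtain ⟨C, hC⟩ := hB
  have hw := h.a_sv.mul hχ.inv
  obtain ⟨D, hD⟩ := hw.exists_lpOn_mul_expE_le P.q hδ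
  refine ⟨D * C, fun k x m hm hk => ?_⟩
  set c : ℝ≥0∞ := m * (D * (P.a x * (χ x)⁻¹)) with hc
  have hct : c ≠ ∞ := ENNReal.mul_ne_top hm
    (ENNReal.mul_ne_top ENNReal.coe_ne_top (hw.ne_top x))
  calc P.headRow k x ≤ c * lpOn P.r (Iio x) P.b := by
        refine lpOn_le_mul (I := Iio x) hct measurableSet_Iio fun s _ => ?_
        rw [mul_comm]
        refine mul_le_mul' ?_ le_rfl
        refine (lpOn_le_mul hm measurableSet_Ioo fun u hu =>
          mul_le_of_weight_le hχ (hk u hu.2)).trans ?_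
        exact mul_le_mul' le_rfl (hD x _ measurableSet_Ioo)
    _ = m * D * (lpOn P.r (Iio x) P.b * P.a x * (χ x)⁻¹) := by rw [hc]; ring
    _ ≤ m * D * C := by
        gcongr
        exact mul_inv_le_of_le_mul (hχ.ne_zero x) (hχ.ne_top x) (hC x)
    _ = _ := by push_cast; ring

/-- Half of the decay concentrates the inner norm at `u = s`; the other half remains in `s` and
concentrates the outer norm of the tail at `s = x`. -/
lemma Regular.exists_crossRow_add_tailRow_le (h : P.Regular) {χ : ℝ → ℝ≥0∞} (hχ : SVar χ)
    (hB : ∃ C : ℝ≥0, ∀ x, lpOn P.r (Iio x) P.b * P.a x ≤ C * χ x) {δ : ℝ} (hδ : 0 < δ) :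
    ∃ D : ℝ≥0, ∀ (k : ℝ → ℝ≥0∞) (x : ℝ) (m : ℝ≥0∞), m ≠ ∞ →
      (∀ u, x < u → χ u * k u ≤ m * expE (-δ * |x - u|)) →
        P.crossRow k x + P.tailRow k x ≤ D * m := by
  obtain ⟨C, hC⟩ := hB
  have hw := h.a_sv.mul hχ.inv
  have hv := h.b_sv.mul hw
  obtain ⟨D, hD⟩ := hw.exists_lpOn_mul_expE_le P.q (half_pos hδ)
  obtain ⟨E, hE⟩ := hv.exists_lpOn_mul_expE_le P.r (half_pos hδ)
  obtain ⟨B, hB⟩ := h.exists_b_le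
  have hb : ∀ x, P.b x * (P.a x * (χ x)⁻¹) ≤ B * C := by
    intro x
    calc P.b x * (P.a x * (χ x)⁻¹) ≤ (B * lpOn P.r (Iio x) P.b) * (P.a x * (χ x)⁻¹) := by
          gcongr; exact hB x _ (Or.inl fun _ hu => hu.2)
      _ = B * (lpOn P.r (Iio x) P.b * P.a x * (χ x)⁻¹) := by ring
      _ ≤ _ := by
        gcongr
        exact mul_inv_le_of_le_mul (hχ.ne_zero x) (hχ.ne_top x) (hC x)
  refine ⟨D * C + D * (E * (B * C)), fun k x m hm hk => ?_⟩
  have hinner : ∀ s, x ≤ s → lpOn P.q (Ioi s) (fun u => P.a u * k u)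
      ≤ m * D * (expE (-(δ / 2) * |x - s|) * (P.a s * (χ s)⁻¹)) := by
    intro s hs
    have hmt : m * expE (-(δ / 2) * |x - s|) ≠ ∞ := ENNReal.mul_ne_top hm (expE_ne_top _)
    calc lpOn P.q (Ioi s) (fun u => P.a u * k u)
        ≤ m * expE (-(δ / 2) * |x - s|) *
            lpOn P.q (Ioi s) (fun u => P.a u * (χ u)⁻¹ * expE (-(δ / 2) * |s - u|)) := by
          refine lpOn_le_mul hmt measurableSet_Ioi fun u hu => ?_
          have hu' : s < u := hu
          refine (mul_le_of_weight_le hχ (hk u (hs.trans_lt hu'))).trans ?_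
          calc m * (P.a u * (χ u)⁻¹ * expE (-δ * |x - u|))
              ≤ m * (P.a u * (χ u)⁻¹ *
                  (expE (-(δ / 2) * |x - s|) * expE (-(δ / 2) * |s - u|))) := by
                gcongr
                rw [← expE_add]
                refine expE_le_expE ?_
                rw [abs_of_nonpos (by linarith : x - u ≤ 0), abs_of_nonpos (by linarith : x - s ≤ 0),
                  abs_of_nonpos (by linarith : s - u ≤ 0)]
                nlinarith
            _ = _ := by ring
      _ ≤ m * expE (-(δ / 2) * |x - s|) * (D * (P.a s * (χ s)⁻¹)) := by
          gcongr
          exact hD s _ measurableSet_Ioi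
      _ = _ := by ring
  have hmD : m * D ≠ ∞ := ENNReal.mul_ne_top hm ENNReal.coe_ne_top
  have h1 : P.crossRow k x ≤ D * C * m := by
    calc P.crossRow k x
        ≤ lpOn P.r (Iio x) P.b * (m * D * (expE (-(δ / 2) * |x - x|) * (P.a x * (χ x)⁻¹))) :=
          mul_le_mul' le_rfl (hinner x le_rfl)
      _ = m * D * (lpOn P.r (Iio x) P.b * P.a x * (χ x)⁻¹) := by simp; ring
      _ ≤ m * D * C := by
        gcongr
        exact mul_inv_le_of_le_mul (hχ.ne_zero x) (hχ.ne_top x) (hC x)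
      _ = _ := by ring
  have h2 : P.tailRow k x ≤ D * (E * (B * C)) * m := by
    calc P.tailRow k x
        ≤ m * D * lpOn P.r (Ioi x)
            (fun s => P.b s * (P.a s * (χ s)⁻¹) * expE (-(δ / 2) * |x - s|)) := by
          refine lpOn_le_mul (I := Ioi x) hmD measurableSet_Ioi fun s hs => ?_
          refine (mul_le_mul' le_rfl (hinner s (le_of_lt hs))).trans (le_of_eq ?_)
          ring
      _ ≤ m * D * (E * (P.b x * (P.a x * (χ x)⁻¹))) := by
          gcongr
          exact hE x _ measurableSet_Ioi
      _ ≤ m * D * (E * (B * C)) := mul_le_mul' le_rfl (mul_le_mul' le_rfl (hb x))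
      _ = _ := by ring
  calc P.crossRow k x + P.tailRow k x ≤ D * C * m + D * (E * (B * C)) * m := add_le_add h1 h2
    _ = _ := by push_cast; ring

lemma row_univ_le (P : RowParams) : ∃ C : ℝ≥0, ∀ (k : ℝ → ℝ≥0∞) (x : ℝ),
    P.fullRow k ≤ C * (P.row (Iio x) Ioi k + P.tailRow k x) := by
  obtain ⟨C, hC⟩ := lpOn_union P.r
  refine ⟨C, fun k x => ?_⟩
  have := hC (Iio x) (Ici x) fun s => P.b s * lpOn P.q (Ioi s) fun u => P.a u * k u
  rwa [Iio_union_Ici, lpOn_Ici] at this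

/-- The inner interval `(s, ∞)` is cut at `x`. The far piece does not depend on `s`, so it factors
out of the outer norm and becomes the cross term. -/
lemma Regular.exists_row_Iio_le (h : P.Regular) : ∃ C : ℝ≥0, ∀ (k g l : ℝ → ℝ≥0∞) (x : ℝ),
    (∀ u, u < x → k u ≤ g u) → (∀ u, x < u → k u ≤ l u) →
      P.row (Iio x) Ioi k ≤ C * (P.headRow g x + P.crossRow l x) := by
  obtain ⟨C, hC⟩ := lpOn_union P.q
  obtain ⟨C', hC'⟩ := h.b_sv.vary 1 one_pos
  obtain ⟨D, hD⟩ := hC'.lpOn_mul_add zero_le_one P.r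
  refine ⟨C * D + 1, fun k g l x hg hl => ?_⟩
  set c : ℝ≥0∞ := lpOn P.q (Ioi x) fun u => P.a u * l u with hc
  by_cases hct : c = ∞
  · have : P.crossRow l x = ∞ := by
      rw [crossRow, ← hc, hct, ENNReal.mul_top (h.norm_b_ne_zero x)]
    rw [this, add_top, ENNReal.mul_top (by simp)]
    exact le_top
  have hm : Measurable fun s => lpOn P.q (Ioo s x) fun u => P.a u * g u :=
    Antitone.measurable fun s t hst => lpOn_mono_set (Ioo_subset_Ioo_left hst)
  calc P.row (Iio x) Ioi k
      ≤ C * lpOn P.r (Iio x)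
          fun s => P.b s * ((lpOn P.q (Ioo s x) fun u => P.a u * g u) + c) := by
        refine lpOn_le_mul ENNReal.coe_ne_top measurableSet_Iio fun s hs => ?_
        have hs' : s < x := hs
        rw [mul_left_comm]
        refine mul_le_mul' le_rfl ?_
        have := hC (Ioo s x) (Ici x) fun u => P.a u * k u
        rw [Ioo_union_Ici_eq_Ioi hs', lpOn_Ici] at this
        refine this.trans ?_
        gcongr
        · exact lpOn_mono_on measurableSet_Ioo fun u hu => mul_le_mul' le_rfl (hg u hu.2)
        · exact lpOn_mono_on measurableSet_Ioi fun u hu => mul_le_mul' le_rfl (hl u hu)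
    _ ≤ C * (D * (P.headRow g x + lpOn P.r (Iio x) fun s => P.b s * c)) := by
        gcongr
        exact hD _ _ _ hm measurable_const
    _ = (C * D) * (P.headRow g x + P.crossRow l x) := by
        simp only [mul_comm _ c]
        rw [lpOn_const_mul hct, crossRow, ← hc, mul_comm c]; ring
    _ ≤ _ := by gcongr; simp

lemma row_const_mul (P : RowParams) (I : Set ℝ) (J : ℝ → Set ℝ) (k : ℝ → ℝ≥0∞) {c : ℝ≥0∞}
    (hc : c ≠ ∞) : P.row I J (fun u => c * k u) = c * P.row I J k := by
  simp only [row, mul_left_comm _ c, lpOn_const_mul hc]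

lemma crossRow_const_mul (P : RowParams) (k : ℝ → ℝ≥0∞) (x : ℝ) {c : ℝ≥0∞}
    (hc : c ≠ ∞) : P.crossRow (fun u => c * k u) x = c * P.crossRow k x := by
  simp only [crossRow, mul_left_comm _ c, lpOn_const_mul hc]

lemma row_const (P : RowParams) (I : Set ℝ) (J : ℝ → Set ℝ) {c : ℝ≥0∞} (hc : c ≠ ∞) :
    P.row I J (fun _ => c) = P.row I J (fun _ => 1) * c := by
  simpa [mul_comm c] using P.row_const_mul I J (fun _ => 1) hc

/-- This explains the shape of `χ₀`: past `x` the function `g` is bounded by the constant `k x`,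
which contributes a cross term from `s < x < u` and a tail term from `x < s < u`. It is applied to
the `A₀`-component of a decomposition at `x`. -/
lemma Low.exists_fullRow_le (h : P.Low) : ∃ C : ℝ≥0, ∀ (g k : ℝ → ℝ≥0∞) (x : ℝ), k x ≠ ∞ →
    (∀ u, u ≤ x → g u ≤ k u) → (∀ u, x ≤ u → g u ≤ k x) →
      P.fullRow g ≤ C * (P.headRow k x + P.chiLow x * k x) := by
  obtain ⟨C, hC⟩ := P.row_univ_le
  obtain ⟨D, hD⟩ := h.toRegular.exists_row_Iio_le
  refine ⟨C * (D + 1), fun g k x hx h1 h2 => ?_⟩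
  have hcross : P.crossRow (fun _ => k x) x = P.crossRow (fun _ => 1) x * k x := by
    simpa [mul_comm (k x)] using P.crossRow_const_mul (fun _ => 1) x hx
  calc P.fullRow g ≤ C * (P.row (Iio x) Ioi g + P.tailRow g x) := hC g x
    _ ≤ C * (D * (P.headRow k x + P.crossRow (fun _ => k x) x) + P.tailRow (fun _ => k x) x) := by
        gcongr
        · exact hD _ _ _ _ (fun u hu => h1 u hu.le) fun u hu => h2 u hu.le
        · refine lpOn_mono_on measurableSet_Ioi fun s hs => mul_le_mul' le_rfl
            (lpOn_mono_on measurableSet_Ioi fun u hu => mul_le_mul' le_rfl (h2 u ?_))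
          exact (lt_trans hs hu : x < u).le
    _ = C * (D * (P.headRow k x + P.crossRow (fun _ => 1) x * k x)
          + P.tailRow (fun _ => 1) x * k x) := by
        rw [hcross, tailRow, row_const _ _ _ hx]; rfl
    _ ≤ C * ((D + 1) * (P.headRow k x + P.crossRow (fun _ => 1) x * k x)
          + (D + 1) * (P.tailRow (fun _ => 1) x * k x)) := by
        refine mul_le_mul' le_rfl (add_le_add (mul_le_mul' le_self_add le_rfl) ?_)
        exact le_mul_of_one_le_left' le_add_self
    _ = _ := by rw [chiLow]; push_cast; ring

/-- The mirror image, for the `A₁`-component: the constant bound now lies to the left of `x`, and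
its contribution over `s < u < x` is `χ₁ x * k x`. -/
lemma Regular.exists_fullRow_le (h : P.Regular) : ∃ C : ℝ≥0, ∀ (g k : ℝ → ℝ≥0∞) (x : ℝ), k x ≠ ∞ →
    (∀ u, u ≤ x → g u ≤ k x) → (∀ u, x ≤ u → g u ≤ k u) →
      P.fullRow g ≤ C * (P.chiUp x * k x + (P.crossRow k x + P.tailRow k x)) := by
  obtain ⟨C, hC⟩ := P.row_univ_le
  obtain ⟨D, hD⟩ := h.exists_row_Iio_le
  refine ⟨C * (D + 1), fun g k x hx h1 h2 => ?_⟩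
  calc P.fullRow g ≤ C * (P.row (Iio x) Ioi g + P.tailRow g x) := hC g x
    _ ≤ C * (D * (P.headRow (fun _ => k x) x + P.crossRow k x) + P.tailRow k x) := by
        gcongr
        · exact hD _ _ _ _ (fun u hu => h1 u hu.le) fun u hu => h2 u hu.le
        · refine lpOn_mono_on measurableSet_Ioi fun s hs => mul_le_mul' le_rfl
            (lpOn_mono_on measurableSet_Ioi fun u hu => mul_le_mul' le_rfl (h2 u ?_))
          exact (lt_trans hs hu : x < u).le
    _ = C * (D * (P.chiUp x * k x + P.crossRow k x) + P.tailRow k x) := by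
        rw [headRow, row_const _ _ _ hx]; rfl
    _ ≤ C * ((D + 1) * (P.chiUp x * k x + P.crossRow k x) + (D + 1) * P.tailRow k x) := by
        refine mul_le_mul' le_rfl (add_le_add (mul_le_mul' le_self_add le_rfl) ?_)
        exact le_mul_of_one_le_left' le_add_self
    _ = _ := by push_cast; ring

end RowParams

/-! ### The Holmstedt functional of a quasi-concave function -/

/-- `k` in the form relevant for the upper endpoint. -/
noncomputable def twist (k : ℝ → ℝ≥0∞) (u : ℝ) : ℝ≥0∞ := expE (-u) * k u

lemma expE_mul_twist (k : ℝ → ℝ≥0∞) (u : ℝ) : expE u * twist k u = k u := by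
  rw [twist, ← mul_assoc, expE_mul_expE_neg, one_mul]

/-- Finite quasi-concave functions, in the logarithmic variable. -/
structure QuasiConc (k : ℝ → ℝ≥0∞) : Prop where
  mono : Monotone k
  anti : Antitone (twist k)
  ne_top : ∀ x, k x ≠ ∞

lemma QuasiConc.twist_ne_top {k : ℝ → ℝ≥0∞} (hk : QuasiConc k) (x : ℝ) : twist k x ≠ ∞ :=
  ENNReal.mul_ne_top (expE_ne_top _) (hk.ne_top x)

/-- The functional equivalent to the `K`-functional of the couple of limiting spaces. -/
noncomputable def holm (P₀ P₁ : RowParams) (R : ℝ → ℝ) (k : ℝ → ℝ≥0∞) (x : ℝ) : ℝ≥0∞ :=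
  P₀.headRow k x + P₀.chiLow x * k x
    + expE (R x) * (P₁.crossRow (twist k) x + P₁.tailRow (twist k) x)

section holm

variable {P₀ P₁ : RowParams} {R : ℝ → ℝ}

lemma exists_holm_add (h₀ : P₀.Low) (h₁ : P₁.Up) (R : ℝ → ℝ) :
    ∃ D : ℝ≥0, ∀ (A : ℝ≥0) (k g l : ℝ → ℝ≥0∞) (x : ℝ), QuasiConc g → QuasiConc l →
      (∀ u, k u ≤ A * (g u + l u)) →
        holm P₀ P₁ R k x ≤ A * D * (holm P₀ P₁ R g x + holm P₀ P₁ R l x) := by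
  obtain ⟨D₀, hD₀⟩ := h₀.toRegular.exists_row_add
  obtain ⟨D₁, hD₁⟩ := h₁.toRegular.exists_row_add
  obtain ⟨D₂, hD₂⟩ := h₁.toRegular.exists_crossRow_add
  refine ⟨D₀ + 1 + D₁ + D₂, fun A k g l x hg hl hk => ?_⟩
  have hk' : ∀ u, twist k u ≤ A * (twist g u + twist l u) := fun u => by
    calc twist k u ≤ expE (-u) * (A * (g u + l u)) := mul_le_mul' le_rfl (hk u)
      _ = _ := by simp only [twist]; ring
  set D : ℝ≥0∞ := ((D₀ + 1 + D₁ + D₂ : ℝ≥0) : ℝ≥0∞) with hD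
  have e0 : (D₀ : ℝ≥0∞) ≤ D := by
    rw [hD]; exact_mod_cast le_add_right (le_add_right le_self_add)
  have e1 : (1 : ℝ≥0∞) ≤ D := by
    rw [hD]; exact_mod_cast le_add_right (le_add_right le_add_self)
  have e2 : (D₁ : ℝ≥0∞) ≤ D := by
    rw [hD]; exact_mod_cast le_add_right le_add_self
  have e3 : (D₂ : ℝ≥0∞) ≤ D := by
    rw [hD]; exact_mod_cast le_add_self
  have t1 : P₀.headRow k x ≤ A * D * (P₀.headRow g x + P₀.headRow l x) :=
    (hD₀ A _ _ k g l hg.mono.measurable hl.mono.measurable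
      (fun _ _ h => Ioo_subset_Ioo_left h) hk).trans (by gcongr; rfl; rfl)
  have t2 : P₀.chiLow x * k x ≤ A * D * (P₀.chiLow x * g x + P₀.chiLow x * l x) :=
    calc P₀.chiLow x * k x ≤ P₀.chiLow x * (A * (g x + l x)) := mul_le_mul' le_rfl (hk x)
      _ = A * 1 * (P₀.chiLow x * g x + P₀.chiLow x * l x) := by ring
      _ ≤ _ := by gcongr
  have t3 : P₁.crossRow (twist k) x ≤
      A * D * (P₁.crossRow (twist g) x + P₁.crossRow (twist l) x) :=
    (hD₂ A _ _ _ x hg.anti.measurable hl.anti.measurable hk').trans (by gcongr)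
  have t4 : P₁.tailRow (twist k) x ≤
      A * D * (P₁.tailRow (twist g) x + P₁.tailRow (twist l) x) :=
    (hD₁ A _ _ _ _ _ hg.anti.measurable hl.anti.measurable
      (fun _ _ h => Ioi_subset_Ioi h) hk').trans (by gcongr; rfl; rfl)
  calc holm P₀ P₁ R k x
      ≤ A * D * (P₀.headRow g x + P₀.headRow l x)
        + A * D * (P₀.chiLow x * g x + P₀.chiLow x * l x)
        + expE (R x) * (A * D * (P₁.crossRow (twist g) x + P₁.crossRow (twist l) x)
          + A * D * (P₁.tailRow (twist g) x + P₁.tailRow (twist l) x)) := by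
        unfold holm; gcongr
    _ = _ := by simp only [holm]; ring

/-- The relation between the parameters of the `K`-functionals of the two couples. -/
def IsParam (P₀ P₁ : RowParams) (R : ℝ → ℝ) : Prop :=
  ∀ x, expE (R x) * P₁.chiUp x = expE x * P₀.chiLow x

lemma IsParam.expE_eq (hR : IsParam P₀ P₁ R) (h₁ : P₁.Up) (x : ℝ) :
    expE (R x) = expE x * (P₀.chiLow x / P₁.chiUp x) := by
  rw [← mul_div_assoc, ← hR x, ENNReal.mul_div_cancel_right (h₁.chiUp_sv.ne_zero x)
    (h₁.chiUp_sv.ne_top x)]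

/-- `exp (R x - x)` equals `χ₀ / χ₁`, and the logarithm of the slow variation inequality for this
quotient is the claim, with `c = log C`. -/
lemma IsParam.coarse (hR : IsParam P₀ P₁ R) (h₀ : P₀.Low) (h₁ : P₁.Up) {ε : ℝ} (hε : 0 < ε) :
    ∃ c : ℝ, ∀ x y, |R x - R y - (x - y)| ≤ ε * |x - y| + c := by
  have hS := h₀.chiLow_sv.div h₁.chiUp_sv
  obtain ⟨C, hC⟩ := hS.vary ε hε
  have hC0 : 0 < (C : ℝ) := by
    rcases eq_or_ne C 0 with rfl | h
    · have := hC 0 0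
      simp only [ENNReal.coe_zero, zero_mul, nonpos_iff_eq_zero] at this
      exact absurd this (hS.ne_zero 0)
    · exact NNReal.coe_pos.2 (pos_iff_ne_zero.2 h)
  have key : ∀ x y, R x - R y - (x - y) ≤ ε * |x - y| + Real.log C := by
    intro x y
    have h := hC x y
    have e : ∀ z, P₀.chiLow z / P₁.chiUp z = expE (R z - z) := by
      intro z
      rw [sub_eq_add_neg, expE_add, hR.expE_eq h₁, mul_right_comm, expE_mul_expE_neg, one_mul]
    have eC : (C : ℝ≥0∞) = expE (Real.log C) := by
      rw [expE, Real.exp_log hC0, ENNReal.ofReal_coe_nnreal]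
    simp only [e] at h
    rw [eC, ← expE_add, ← expE_add, expE, expE,
      ENNReal.ofReal_le_ofReal_iff (Real.exp_pos _).le, Real.exp_le_exp] at h
    linarith
  refine ⟨Real.log C, fun x y => abs_le.2 ⟨?_, key x y⟩⟩
  have := key y x
  rw [abs_sub_comm] at this
  linarith

lemma IsParam.measurable (hR : IsParam P₀ P₁ R) (h₁ : P₁.Up) : Measurable R := by
  have h : Measurable fun x => Real.log (expE (R x)).toReal := by
    simp only [hR.expE_eq h₁]
    exact Real.measurable_log.comp (measurable_expE.mul
      (RowParams.measurable_chiLow.div RowParams.measurable_chiUp)).ennreal_toReal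
  have e : R = fun x => Real.log (expE (R x)).toReal := by
    funext x
    rw [expE, ENNReal.toReal_ofReal (Real.exp_pos _).le, Real.log_exp]
  rw [e]; exact h

lemma IsParam.exists_le (hR : IsParam P₀ P₁ R) (h₀ : P₀.Low) (h₁ : P₁.Up) :
    ∃ C : ℝ≥0, ∀ x y,
      expE (R y - R x) ≤ C * expE (y - x + 1 / 2 * |x - y|) := by
  obtain ⟨c, hc⟩ := hR.coarse h₀ h₁ (ε := 1 / 2) (by norm_num)
  obtain ⟨C, hC⟩ := exists_nnreal_eq (expE_ne_top c)
  refine ⟨C, fun x y => ?_⟩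
  rw [hC, ← expE_add]
  refine expE_le_expE ?_
  have := (abs_le.1 (hc y x)).2
  rw [abs_sub_comm y x] at this
  linarith

/-- Head and middle terms are at most multiples of the full norm. For the rest, `χ₁ * twist g = exp
(-R) * χ₀ * g ≤ 2 * exp (-R) * N`, and `exp (-R u)` decays to the right of `x` at rate `1 / 2` up to
a constant, so the Hardy-type estimate applies. -/
lemma exists_holm_le_low (hR : IsParam P₀ P₁ R) (h₀ : P₀.Low) (h₁ : P₁.Up) :
    ∃ C : ℝ≥0, ∀ (g : ℝ → ℝ≥0∞) (x : ℝ), QuasiConc g →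
      holm P₀ P₁ R g x ≤ C * P₀.fullRow g := by
  obtain ⟨c, hc⟩ := hR.exists_le h₀ h₁
  obtain ⟨D, hD⟩ := h₁.toRegular.exists_crossRow_add_tailRow_le h₁.chiUp_sv
    h₁.toRegular.exists_norm_b_mul_a_le (δ := 1 / 2) (by norm_num)
  refine ⟨1 + 2 + D * (c * 2), fun g x hg => ?_⟩
  set N := P₀.fullRow g with hN
  by_cases hNt : N = ∞
  · rw [hNt, ENNReal.mul_top (by norm_num)]; exact le_top
  have hg0 := fun u => RowParams.chiLow_mul_le_fullRow hg.mono (hg.ne_top u) h₀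
  set m : ℝ≥0∞ := expE (-R x) * (c * 2 * N) with hm
  have hmt : m ≠ ∞ := ENNReal.mul_ne_top (expE_ne_top _)
    (ENNReal.mul_ne_top (ENNReal.mul_ne_top ENNReal.coe_ne_top (by norm_num)) hNt)
  have hJ := hD (twist g) x m hmt fun u hu => by
    have e : P₁.chiUp u * expE (-u) = expE (-R u) * P₀.chiLow u := by
      calc P₁.chiUp u * expE (-u)
          = expE (-R u) * (expE (R u) * P₁.chiUp u) * expE (-u) := by
            rw [← mul_assoc, mul_comm (expE (-R u)), expE_mul_expE_neg, one_mul]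
        _ = expE (-R u) * P₀.chiLow u * (expE u * expE (-u)) := by rw [hR u]; ring
        _ = _ := by rw [expE_mul_expE_neg, mul_one]
    calc P₁.chiUp u * twist g u = expE (-R u) * (P₀.chiLow u * g u) := by
          rw [twist, ← mul_assoc, e, mul_assoc]
      _ ≤ (expE (-R x) * (c * expE (x - u + 1 / 2 * |u - x|))) * (2 * N) := by
          refine mul_le_mul' ?_ (hg0 u)
          have := hc u x
          rw [sub_eq_add_neg, expE_add] at this
          calc expE (-R u) = expE (-R x) * (expE (R x) * expE (-R u)) := by
                rw [← mul_assoc, mul_comm (expE (-R x)), expE_mul_expE_neg, one_mul]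
            _ ≤ _ := by gcongr
      _ = m * expE (-(1 / 2) * |x - u|) := by
          have : x - u + 1 / 2 * |u - x| = -(1 / 2) * |x - u| := by
            rw [abs_of_pos (by linarith : 0 < u - x), abs_of_neg (by linarith : x - u < 0)]; ring
          rw [this, hm]; ring
  calc holm P₀ P₁ R g x ≤ N + 2 * N + expE (R x) * (D * m) := by
        exact add_le_add (add_le_add (RowParams.headRow_le_fullRow _ _) (hg0 x))
          (mul_le_mul' le_rfl hJ)
    _ = N + 2 * N + D * (c * 2 * N) * (expE (R x) * expE (-R x)) := by rw [hm]; ring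
    _ = _ := by rw [expE_mul_expE_neg]; push_cast; ring

/-- Dually, `χ₀ * g = exp R * χ₁ * twist g ≤ exp R * N`, which decays to the left of `x`; this
bounds the head and middle terms. -/
lemma exists_holm_le_up (hR : IsParam P₀ P₁ R) (h₀ : P₀.Low) (h₁ : P₁.Up) :
    ∃ C : ℝ≥0, ∀ (g : ℝ → ℝ≥0∞) (x : ℝ), QuasiConc g →
      holm P₀ P₁ R g x ≤ C * (expE (R x) * P₁.fullRow (twist g)) := by
  obtain ⟨c, hc⟩ := hR.exists_le h₀ h₁
  obtain ⟨D, hD⟩ := h₀.toRegular.exists_headRow_le h₀.chiLow_sv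
    h₀.exists_norm_b_mul_a_le (δ := 1 / 2) (by norm_num)
  refine ⟨D * c + 1 + (1 + 1), fun g x hg => ?_⟩
  set N := P₁.fullRow (twist g) with hN
  by_cases hNt : N = ∞
  · rw [hNt, ENNReal.mul_top (expE_ne_zero _), ENNReal.mul_top (by norm_num)]; exact le_top
  have hg1 : ∀ u, P₀.chiLow u * g u ≤ expE (R u) * N := fun u => by
    calc P₀.chiLow u * g u = expE u * P₀.chiLow u * twist g u := by
          rw [← expE_mul_twist g u]; ring
      _ = expE (R u) * (P₁.chiUp u * twist g u) := by rw [← hR u]; ring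
      _ ≤ _ := mul_le_mul' le_rfl (RowParams.chiUp_mul_le_fullRow hg.anti (hg.twist_ne_top u))
  set m : ℝ≥0∞ := expE (R x) * (c * N) with hm
  have hmt : m ≠ ∞ := ENNReal.mul_ne_top (expE_ne_top _)
    (ENNReal.mul_ne_top ENNReal.coe_ne_top hNt)
  have hI := hD g x m hmt fun u hu => by
    calc P₀.chiLow u * g u ≤ expE (R u) * N := hg1 u
      _ = expE (R x) * expE (R u - R x) * N := by rw [← expE_add]; ring_nf
      _ ≤ expE (R x) * (c * expE (u - x + 1 / 2 * |x - u|)) * N := by gcongr; exact hc x u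
      _ = m * expE (-(1 / 2) * |x - u|) := by
          have : u - x + 1 / 2 * |x - u| = -(1 / 2) * |x - u| := by
            rw [abs_of_pos (by linarith : 0 < x - u)]; ring
          rw [this, hm]; ring
  have hJ2 : P₁.tailRow (twist g) x ≤ N := RowParams.tailRow_le_fullRow _ _
  have hJ1 : P₁.crossRow (twist g) x ≤ N := by
    have hle : ∀ s, s ≤ x → (lpOn P₁.q (Ioi x) fun u => P₁.a u * twist g u)
        ≤ lpOn P₁.q (Ioi s) fun u => P₁.a u * twist g u := fun s hs =>
      lpOn_mono_set (Ioi_subset_Ioi hs)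
    -- If the norm over `u > x` were infinite, so would be the inner norm for every `s < x`, and
    -- hence `N`.
    refine RowParams.crossRow_le_fullRow _ _ fun hcon => hNt ?_
    rw [hN, eq_top_iff]
    calc (∞ : ℝ≥0∞) = lpOn P₁.r (Iio x) (fun _ => ∞) := by
          rw [lpOn_univ_const_top h₁.r_ne (by simp)]
      _ ≤ lpOn P₁.r (Iio x) fun s => P₁.b s * lpOn P₁.q (Ioi s) fun u => P₁.a u * twist g u := by
          refine lpOn_mono_on measurableSet_Iio fun s hs => ?_
          have := hle s (le_of_lt hs)
          rw [hcon, top_le_iff] at this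
          rw [this, ENNReal.mul_top (h₁.b_sv.ne_zero s)]
      _ ≤ _ := lpOn_mono_set (subset_univ _)
  calc holm P₀ P₁ R g x ≤ D * m + expE (R x) * N + expE (R x) * (N + N) := by
        exact add_le_add (add_le_add hI (hg1 x)) (mul_le_mul' le_rfl (add_le_add hJ1 hJ2))
    _ = _ := by rw [hm]; push_cast; ring

end holm

/-! ### The `K`-functional in the logarithmic variable -/

section KFunctional

variable {E : Type*} [AddCommGroup E]

/-- The `K`-functional in the logarithmic variable. -/
noncomputable def klog (X Y : QSpace E) (f : E) (x : ℝ) : ℝ≥0∞ := Kfun X Y (Real.exp x) f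

lemma klog_le {X Y : QSpace E} {f g h : E} (hg : g ∈ X.carrier) (hh : h ∈ Y.carrier)
    (hf : f = g + h) (x : ℝ) : klog X Y f x ≤ X.qnorm g + expE x * Y.qnorm h :=
  iInf₂_le_of_le g hg <| iInf₂_le_of_le h hh <| iInf_le_of_le hf le_rfl

lemma le_klog {X Y : QSpace E} {f : E} {x : ℝ} {c : ℝ≥0∞}
    (h : ∀ g ∈ X.carrier, ∀ h ∈ Y.carrier, f = g + h → c ≤ X.qnorm g + expE x * Y.qnorm h) :
    c ≤ klog X Y f x :=
  le_iInf₂ fun g hg => le_iInf₂ fun h' hh => le_iInf fun hf => h g hg h' hh hf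

lemma exists_of_klog_lt {X Y : QSpace E} {f : E} {x : ℝ} {c : ℝ≥0∞} (h : klog X Y f x < c) :
    ∃ g ∈ X.carrier, ∃ h ∈ Y.carrier, f = g + h ∧ X.qnorm g + expE x * Y.qnorm h < c := by
  by_contra! hcon
  exact absurd (le_klog fun g hg h hh hf => hcon g hg h hh hf) (not_le.2 h)

lemma klog_mono (X Y : QSpace E) (f : E) : Monotone (klog X Y f) := fun x y hxy =>
  le_klog fun g hg h hh hf => (klog_le hg hh hf x).trans (by gcongr; exact expE_le_expE hxy)

lemma twist_klog_anti (X Y : QSpace E) (f : E) : Antitone (twist (klog X Y f)) := by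
  intro x y hxy
  have : expE (x - y) * klog X Y f y ≤ klog X Y f x := by
    refine le_klog fun g hg h hh hf => ?_
    calc expE (x - y) * klog X Y f y ≤ expE (x - y) * (X.qnorm g + expE y * Y.qnorm h) := by
          gcongr; exact klog_le hg hh hf y
      _ = expE (x - y) * X.qnorm g + expE x * Y.qnorm h := by
          rw [mul_add, ← mul_assoc, ← expE_add, sub_add_cancel]
      _ ≤ _ := by
          gcongr
          refine mul_le_of_le_one_left' ?_
          rw [← expE_zero]
          exact expE_le_expE (by linarith)
  calc twist (klog X Y f) y = expE (-x) * (expE (x - y) * klog X Y f y) := by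
        rw [twist, ← mul_assoc, ← expE_add]; ring_nf
    _ ≤ _ := mul_le_mul' le_rfl this

lemma varyBound_klog (X Y : QSpace E) (f : E) : VaryBound 1 1 (klog X Y f) :=
  .of_monotone (klog_mono X Y f) (twist_klog_anti X Y f)

lemma mem_sumSet_of_klog_ne_top {X Y : QSpace E} {f : E} {x : ℝ} (h : klog X Y f x ≠ ∞) :
    f ∈ sumSet X Y := by
  obtain ⟨g, hg, l, hl, hf, -⟩ := exists_of_klog_lt (lt_top_iff_ne_top.2 h)
  exact ⟨g, hg, l, hl, hf⟩

variable {𝕜 : Type*} [RCLike 𝕜] [Module 𝕜 E]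

lemma QSpace.IsQuasiBanach.qnorm_zero {X : QSpace E} (h : X.IsQuasiBanach 𝕜) : X.qnorm 0 = 0 :=
  (h.qnorm_eq_zero_iff 0 h.zero_mem).2 rfl

lemma QSpace.IsQuasiBanach.neg_mem {X : QSpace E} (h : X.IsQuasiBanach 𝕜) {f : E}
    (hf : f ∈ X.carrier) : -f ∈ X.carrier := by
  simpa using h.smul_mem (-1) f hf

lemma QSpace.IsQuasiBanach.qnorm_neg {X : QSpace E} (h : X.IsQuasiBanach 𝕜) {f : E}
    (hf : f ∈ X.carrier) : X.qnorm (-f) = X.qnorm f := by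
  simpa using h.qnorm_smul (-1) f hf

lemma quasiConc_klog {X Y : QSpace E} (hX : X.IsQuasiBanach 𝕜) (hY : Y.IsQuasiBanach 𝕜)
    {f : E} (hf : f ∈ sumSet X Y) : QuasiConc (klog X Y f) where
  mono := klog_mono X Y f
  anti := twist_klog_anti X Y f
  ne_top x := by
    obtain ⟨g, hg, h, hh, rfl⟩ := hf
    refine ne_top_of_le_ne_top ?_ (klog_le hg hh rfl x)
    exact ENNReal.add_ne_top.2 ⟨(hX.qnorm_lt_top g hg).ne,
      ENNReal.mul_ne_top (expE_ne_top _) (hY.qnorm_lt_top h hh).ne⟩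

lemma klog_neg {X Y : QSpace E} (hX : X.IsQuasiBanach 𝕜) (hY : Y.IsQuasiBanach 𝕜)
    (f : E) (x : ℝ) : klog X Y (-f) x = klog X Y f x := by
  have key : ∀ f, klog X Y (-f) x ≤ klog X Y f x := fun f =>
    le_klog fun g hg h hh hf => by
      rw [← hX.qnorm_neg hg, ← hY.qnorm_neg hh]
      exact klog_le (hX.neg_mem hg) (hY.neg_mem hh) (by rw [hf, neg_add]) x
  exact le_antisymm (key f) (by simpa using key (-f))

lemma exists_klog_add_le {X Y : QSpace E} (hX : X.IsQuasiBanach 𝕜) (hY : Y.IsQuasiBanach 𝕜) :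
    ∃ C : ℝ≥0, ∀ f g x,
    klog X Y (f + g) x ≤ C * (klog X Y f x + klog X Y g x) := by
  obtain ⟨A, hA⟩ := hX.qnorm_add_le
  obtain ⟨B, hB⟩ := hY.qnorm_add_le
  refine ⟨A + B + 1, fun f g x => ?_⟩
  set C : ℝ≥0∞ := ((A + B + 1 : ℝ≥0) : ℝ≥0∞) with hC
  have hC0 : C ≠ 0 := by rw [hC]; exact_mod_cast (by positivity : (A + B + 1 : ℝ≥0) ≠ 0)
  have hAC : (A : ℝ≥0∞) ≤ C := by rw [hC]; exact_mod_cast le_add_right le_self_add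
  have hBC : (B : ℝ≥0∞) ≤ C := by rw [hC]; exact_mod_cast le_add_right le_add_self
  by_cases hfin : klog X Y f x = ∞ ∨ klog X Y g x = ∞
  · have : klog X Y f x + klog X Y g x = ∞ := by rcases hfin with h | h <;> simp [h]
    rw [this, ENNReal.mul_top hC0]; exact le_top
  push Not at hfin
  refine ENNReal.le_of_forall_pos_le_add fun ε hε _ => ?_
  -- The infima need not be attained; each nearly optimal decomposition gets slack `ε / (2 * C)`.
  have hε' : (ε : ℝ≥0∞) / (2 * C) ≠ 0 := by
    refine (ENNReal.div_pos (by exact_mod_cast hε.ne') ?_).ne'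
    exact ENNReal.mul_ne_top (by norm_num) ENNReal.coe_ne_top
  obtain ⟨f₀, hf₀, f₁, hf₁, hf, hfl⟩ := exists_of_klog_lt (ENNReal.lt_add_right hfin.1 hε')
  obtain ⟨g₀, hg₀, g₁, hg₁, hg, hgl⟩ := exists_of_klog_lt (ENNReal.lt_add_right hfin.2 hε')
  calc klog X Y (f + g) x ≤ X.qnorm (f₀ + g₀) + expE x * Y.qnorm (f₁ + g₁) :=
        klog_le (hX.add_mem _ hf₀ _ hg₀) (hY.add_mem _ hf₁ _ hg₁) (by rw [hf, hg]; abel) x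
    _ ≤ C * (X.qnorm f₀ + X.qnorm g₀) + expE x * (C * (Y.qnorm f₁ + Y.qnorm g₁)) := by
        gcongr
        · exact (hA _ hf₀ _ hg₀).trans (by gcongr)
        · exact (hB _ hf₁ _ hg₁).trans (by gcongr)
    _ = C * ((X.qnorm f₀ + expE x * Y.qnorm f₁) + (X.qnorm g₀ + expE x * Y.qnorm g₁)) := by ring
    _ ≤ C * ((klog X Y f x + ε / (2 * C)) + (klog X Y g x + ε / (2 * C))) := by gcongr
    _ = C * (klog X Y f x + klog X Y g x) + 2 * C * (ε / (2 * C)) := by ring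
    _ = _ := by
        rw [ENNReal.mul_div_cancel (mul_ne_zero (by norm_num) hC0)
          (ENNReal.mul_ne_top (by norm_num) ENNReal.coe_ne_top)]

end KFunctional

/-! ### Nearly optimal decompositions and Holmstedt's formula. -/

section decomposition

variable {𝕜 : Type*} [RCLike 𝕜] {E : Type*} [AddCommGroup E] [Module 𝕜 E]
  [TopologicalSpace E] [IsTopologicalAddGroup E] [T2Space E] {A₀ A₁ : QSpace E}

/-- Both components of `f` can be made so small that the continuous embeddings place them in `V`,
while `V + V` misses `f`; such a `V` exists because the ambient space is Hausdorff. -/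
lemma eq_zero_of_klog_eq_zero (hA : CompatibleCouple 𝕜 A₀ A₁) {f : E} {x : ℝ}
    (h : klog A₀ A₁ f x = 0) : f = 0 := by
  by_contra hf
  obtain ⟨V, hV, hVV⟩ := exists_nhds_zero_half
    (show {f}ᶜ ∈ 𝓝 (0 : E) from isOpen_compl_singleton.mem_nhds (by simpa using Ne.symm hf))
  obtain ⟨δ₀, hδ₀, h₀⟩ := hA.embeds₀ V hV
  obtain ⟨δ₁, hδ₁, h₁⟩ := hA.embeds₁ V hV
  have hpos : klog A₀ A₁ f x < min δ₀ (expE x * δ₁) := by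
    rw [h]
    exact lt_min hδ₀ (ENNReal.mul_pos (expE_ne_zero _) hδ₁.ne')
  obtain ⟨g, hg, l, hl, hfe, hlt⟩ := exists_of_klog_lt hpos
  have hg' := h₀ g hg ((le_self_add.trans_lt hlt).trans_le (min_le_left _ _))
  have hl' := h₁ l hl ((ENNReal.mul_lt_mul_iff_right (expE_ne_zero x) (expE_ne_top x)).1
    ((le_add_self.trans_lt hlt).trans_le (min_le_right _ _)))
  exact hVV g hg' l hl' hfe.symm

lemma exists_decomp (hA : CompatibleCouple 𝕜 A₀ A₁) {f : E} (hf : f ∈ sumSet A₀ A₁) (x : ℝ) :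
    ∃ g ∈ A₀.carrier, ∃ h ∈ A₁.carrier, f = g + h ∧
      A₀.qnorm g ≤ 2 * klog A₀ A₁ f x ∧ expE x * A₁.qnorm h ≤ 2 * klog A₀ A₁ f x := by
  -- A vanishing `K`-functional leaves no room below `2 * klog A₀ A₁ f x`, but then `f = 0`.
  by_cases h : klog A₀ A₁ f x = 0
  · refine ⟨0, hA.quasiBanach₀.zero_mem, 0, hA.quasiBanach₁.zero_mem, ?_, ?_, ?_⟩
    · rw [eq_zero_of_klog_eq_zero hA h, add_zero]
    · simp [hA.quasiBanach₀.qnorm_zero]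
    · simp [hA.quasiBanach₁.qnorm_zero]
  · have hlt : klog A₀ A₁ f x < 2 * klog A₀ A₁ f x := by
      rw [two_mul]
      exact ENNReal.lt_add_right ((quasiConc_klog hA.quasiBanach₀ hA.quasiBanach₁ hf).ne_top x) h
    obtain ⟨g, hg, l, hl, hfe, hlt⟩ := exists_of_klog_lt hlt
    exact ⟨g, hg, l, hl, hfe, le_self_add.trans hlt.le, le_add_self.trans hlt.le⟩

/-- Holmstedt's formula for the couple of limiting spaces. -/
lemma exists_klog_rows_equiv (hA : CompatibleCouple 𝕜 A₀ A₁) {P₀ P₁ : RowParams} {R : ℝ → ℝ}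
    (hR : IsParam P₀ P₁ R) (h₀ : P₀.Low) (h₁ : P₁.Up) {X₀ X₁ : QSpace E}
    (hX₀ : X₀ = finiteSpace A₀ A₁ fun f => P₀.fullRow (klog A₀ A₁ f))
    (hX₁ : X₁ = finiteSpace A₀ A₁ fun f => P₁.fullRow (twist (klog A₀ A₁ f))) :
    ∃ C : ℝ≥0, ∀ f ∈ sumSet A₀ A₁, ∀ x,
      klog X₀ X₁ f (R x) ≤ C * holm P₀ P₁ R (klog A₀ A₁ f) x ∧
        holm P₀ P₁ R (klog A₀ A₁ f) x ≤ C * klog X₀ X₁ f (R x) := by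
  have hq₀ := hA.quasiBanach₀
  have hq₁ := hA.quasiBanach₁
  obtain ⟨A, hAdd⟩ := exists_klog_add_le hq₀ hq₁
  obtain ⟨D, hD⟩ := exists_holm_add h₀ h₁ R
  obtain ⟨C₀, hC₀⟩ := exists_holm_le_low hR h₀ h₁
  obtain ⟨C₁, hC₁⟩ := exists_holm_le_up hR h₀ h₁
  obtain ⟨B₀, hB₀⟩ := h₀.exists_fullRow_le
  obtain ⟨B₁, hB₁⟩ := h₁.toRegular.exists_fullRow_le
  -- `2` comes from the nearly optimal decomposition; `3 * A` from writing one component as `f`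
  -- minus the other, which costs `A * (k + 2 * k)`.
  set c : ℝ≥0 := 3 * A + 2 with hc
  have hct : (c : ℝ≥0∞) ≠ ∞ := ENNReal.coe_ne_top
  set U : ℝ≥0 := (B₀ + B₁) * c with hU
  set L : ℝ≥0 := A * D * (C₀ + C₁) + 1 with hL
  refine ⟨U + L, fun f hf x => ⟨?_, ?_⟩⟩
  · set k := klog A₀ A₁ f with hk
    have hkq : QuasiConc k := quasiConc_klog hq₀ hq₁ hf
    obtain ⟨g, hg, l, hl, hfe, hgn, hln⟩ := exists_decomp hA hf x
    have hgS : g ∈ sumSet A₀ A₁ := ⟨g, hg, 0, hq₁.zero_mem, by simp⟩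
    have hlS : l ∈ sumSet A₀ A₁ := ⟨0, hq₀.zero_mem, l, hl, by simp⟩
    have hg1 : ∀ u, klog A₀ A₁ g u ≤ 2 * k x := fun u => by
      refine (klog_le hg hq₁.zero_mem (add_zero g).symm u).trans ?_
      simpa [hq₁.qnorm_zero] using hgn
    have hl1 : ∀ u, twist (klog A₀ A₁ l) u ≤ 2 * twist k x := fun u => by
      calc twist (klog A₀ A₁ l) u ≤ expE (-u) * (expE u * A₁.qnorm l) := by
            refine mul_le_mul' le_rfl ((klog_le hq₀.zero_mem hl (zero_add l).symm u).trans ?_)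
            simp [hq₀.qnorm_zero]
        _ = expE (-x) * (expE x * A₁.qnorm l) := by
            rw [← mul_assoc, ← mul_assoc, mul_comm, mul_comm (expE (-u)), expE_mul_expE_neg,
              mul_comm (expE (-x)), expE_mul_expE_neg, mul_comm]
        _ ≤ expE (-x) * (2 * k x) := by gcongr
        _ = _ := by rw [twist]; ring
    have hg2 : ∀ u, u ≤ x → klog A₀ A₁ g u ≤ 3 * A * k u := fun u hu => by
      calc klog A₀ A₁ g u = klog A₀ A₁ (f + -l) u := by rw [hfe]; simp
        _ ≤ A * (k u + klog A₀ A₁ (-l) u) := hAdd _ _ _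
        _ ≤ A * (k u + 2 * k u) := by
            rw [klog_neg hq₀ hq₁]
            gcongr
            calc klog A₀ A₁ l u = expE u * twist (klog A₀ A₁ l) u := (expE_mul_twist _ u).symm
              _ ≤ expE u * (2 * twist k u) :=
                mul_le_mul' le_rfl ((hl1 u).trans (mul_le_mul' le_rfl (hkq.anti hu)))
              _ = 2 * (expE u * twist k u) := by ring
              _ = 2 * k u := by rw [expE_mul_twist]
        _ = _ := by ring
    have hl2 : ∀ u, x ≤ u → twist (klog A₀ A₁ l) u ≤ 3 * A * twist k u := fun u hu => by
      have : klog A₀ A₁ l u ≤ 3 * A * k u := by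
        calc klog A₀ A₁ l u = klog A₀ A₁ (f + -g) u := by rw [hfe]; simp
          _ ≤ A * (k u + klog A₀ A₁ (-g) u) := hAdd _ _ _
          _ ≤ A * (k u + 2 * k u) := by
              rw [klog_neg hq₀ hq₁]
              gcongr
              exact (hg1 u).trans (mul_le_mul' le_rfl (hkq.mono hu))
          _ = _ := by ring
      calc twist (klog A₀ A₁ l) u ≤ expE (-u) * (3 * A * k u) := mul_le_mul' le_rfl this
        _ = _ := by rw [twist]; ring
    have hc2 : (2 : ℝ≥0∞) ≤ c := by rw [hc]; push_cast; exact le_add_self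
    have hc3 : (3 * A : ℝ≥0∞) ≤ c := by rw [hc]; push_cast; exact le_self_add
    set H := holm P₀ P₁ R k x with hH
    have n₀ : P₀.fullRow (klog A₀ A₁ g) ≤ B₀ * c * H := by
      calc P₀.fullRow (klog A₀ A₁ g)
          ≤ B₀ * (P₀.headRow (fun u => c * k u) x + P₀.chiLow x * (c * k x)) :=
            hB₀ _ (fun u => c * k u) x (ENNReal.mul_ne_top hct (hkq.ne_top x))
              (fun u hu => (hg2 u hu).trans (mul_le_mul' hc3 le_rfl))
              (fun u _ => (hg1 u).trans (mul_le_mul' hc2 le_rfl))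
        _ = B₀ * c * (P₀.headRow k x + P₀.chiLow x * k x) := by
            rw [RowParams.headRow, RowParams.row_const_mul _ _ _ _ hct, RowParams.headRow]; ring
        _ ≤ _ := by gcongr; exact le_self_add
    have n₁ : expE (R x) * P₁.fullRow (twist (klog A₀ A₁ l)) ≤ B₁ * c * H := by
      have e : expE (R x) * (P₁.chiUp x * twist k x) = P₀.chiLow x * k x := by
        rw [← mul_assoc, hR x, mul_right_comm, expE_mul_twist, mul_comm]
      calc expE (R x) * P₁.fullRow (twist (klog A₀ A₁ l))
          ≤ expE (R x) * (B₁ * (P₁.chiUp x * (c * twist k x)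
              + (P₁.crossRow (fun u => c * twist k u) x
                + P₁.tailRow (fun u => c * twist k u) x))) := by
            refine mul_le_mul' le_rfl (hB₁ _ (fun u => c * twist k u) x
              (ENNReal.mul_ne_top hct (hkq.twist_ne_top x))
              (fun u _ => (hl1 u).trans (mul_le_mul' hc2 le_rfl))
              (fun u hu => (hl2 u hu).trans (mul_le_mul' hc3 le_rfl)))
        _ = B₁ * c * (expE (R x) * (P₁.chiUp x * twist k x)
              + expE (R x) * (P₁.crossRow (twist k) x + P₁.tailRow (twist k) x)) := by
            rw [RowParams.tailRow, RowParams.row_const_mul _ _ _ _ hct,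
              RowParams.crossRow_const_mul _ _ _ hct, RowParams.tailRow]; ring
        _ ≤ _ := by
            rw [e, hH, holm]
            gcongr
            exact le_add_self
    -- Only when `H` is finite do the two estimates place `g` in `X₀` and `l` in `X₁`.
    by_cases hHt : H = ∞
    · rw [hHt, ENNReal.mul_top]
      · exact le_top
      · rw [hL]; exact_mod_cast (by positivity)
    have f₀ : P₀.fullRow (klog A₀ A₁ g) < ∞ := n₀.trans_lt
      (ENNReal.mul_lt_top (ENNReal.mul_lt_top ENNReal.coe_lt_top hct.lt_top) (lt_top_iff_ne_top.2 hHt))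
    have f₁ : P₁.fullRow (twist (klog A₀ A₁ l)) < ∞ := by
      have := n₁.trans_lt (ENNReal.mul_lt_top (ENNReal.mul_lt_top ENNReal.coe_lt_top hct.lt_top)
        (lt_top_iff_ne_top.2 hHt))
      by_contra hcon
      rw [not_lt, top_le_iff] at hcon
      rw [hcon, ENNReal.mul_top (expE_ne_zero _)] at this
      exact this.ne rfl
    have hg' : g ∈ X₀.carrier := by rw [hX₀]; exact ⟨hgS, f₀⟩
    have hl' : l ∈ X₁.carrier := by rw [hX₁]; exact ⟨hlS, f₁⟩
    calc klog X₀ X₁ f (R x) ≤ X₀.qnorm g + expE (R x) * X₁.qnorm l := klog_le hg' hl' hfe _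
      _ ≤ B₀ * c * H + B₁ * c * H := by
          rw [hX₀, hX₁]; exact add_le_add n₀ n₁
      _ = U * H := by rw [hU]; push_cast; ring
      _ ≤ _ := by gcongr; simp
  -- The lower bound is proved for an arbitrary decomposition in `X₀ + X₁` through
  -- quasi-subadditivity of `holm`; dividing by `L` allows the infimum to be taken.
  · have hL0 : (L : ℝ≥0∞) ≠ 0 := by rw [hL]; exact_mod_cast (by positivity)
    have : holm P₀ P₁ R (klog A₀ A₁ f) x / L ≤ klog X₀ X₁ f (R x) := by
      refine le_klog fun g hg l hl hfe => ENNReal.div_le_of_le_mul ?_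
      rw [hX₀] at hg ⊢
      rw [hX₁] at hl ⊢
      have hgq := quasiConc_klog hq₀ hq₁ hg.1
      have hlq := quasiConc_klog hq₀ hq₁ hl.1
      calc holm P₀ P₁ R (klog A₀ A₁ f) x
          ≤ A * D * (holm P₀ P₁ R (klog A₀ A₁ g) x + holm P₀ P₁ R (klog A₀ A₁ l) x) :=
            hD A _ _ _ x hgq hlq fun u => by rw [hfe]; exact hAdd g l u
        _ ≤ A * D * (C₀ * P₀.fullRow (klog A₀ A₁ g)
              + C₁ * (expE (R x) * P₁.fullRow (twist (klog A₀ A₁ l)))) := by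
            gcongr
            · exact hC₀ _ x hgq
            · exact hC₁ _ x hlq
        _ ≤ A * D * ((C₀ + C₁) * P₀.fullRow (klog A₀ A₁ g)
              + (C₀ + C₁) * (expE (R x) * P₁.fullRow (twist (klog A₀ A₁ l)))) := by
            gcongr
            · exact le_self_add
            · exact le_add_self
        _ = (A * D * (C₀ + C₁)) * (P₀.fullRow (klog A₀ A₁ g)
              + expE (R x) * P₁.fullRow (twist (klog A₀ A₁ l))) := by ring
        _ ≤ L * (P₀.fullRow (klog A₀ A₁ g)
              + expE (R x) * P₁.fullRow (twist (klog A₀ A₁ l))) := by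
            rw [hL]; push_cast; gcongr; exact le_self_add
        _ = _ := mul_comm _ _
    calc holm P₀ P₁ R (klog A₀ A₁ f) x = L * (holm P₀ P₁ R (klog A₀ A₁ f) x / L) :=
          (ENNReal.mul_div_cancel hL0 ENNReal.coe_ne_top).symm
      _ ≤ (U + L : ℝ≥0) * klog X₀ X₁ f (R x) := by
          gcongr; simp

end decomposition

/-! ### Norms of the Holmstedt functional -/

section reiteration

variable {P₀ P₁ : RowParams} {R : ℝ → ℝ} {α : ℝ → ℝ≥0∞}

/-- The weight of the interpolation space with parameter `θ`. -/
noncomputable def expWeight (θ : ℝ) (α : ℝ → ℝ≥0∞) (y : ℝ) : ℝ≥0∞ := expE (-θ * y) * α y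

lemma SVar.exists_varyBound_expWeight (hα : SVar α) (θ : ℝ) :
    ∃ C : ℝ≥0, VaryBound C (|θ| + 1) (expWeight θ α) := by
  obtain ⟨C, hC⟩ := hα.vary 1 one_pos
  refine ⟨1 * C, ?_⟩
  have := (varyBound_expE (-θ)).mul hC
  rwa [abs_neg] at this

lemma expWeight_ne_zero (hα : SVar α) (θ y : ℝ) : expWeight θ α y ≠ 0 :=
  mul_ne_zero (expE_ne_zero _) (hα.ne_zero y)

lemma expWeight_ne_top (hα : SVar α) (θ y : ℝ) : expWeight θ α y ≠ ∞ :=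
  ENNReal.mul_ne_top (expE_ne_top _) (hα.ne_top y)

/-- Decay of the weights along the parametrisation. -/
lemma IsParam.exists_weight_le (hR : IsParam P₀ P₁ R) (h₀ : P₀.Low) (h₁ : P₁.Up) (hα : SVar α)
    {η : ℝ} (hη : η ≠ 0) : ∃ C : ℝ≥0, ∀ x y, η * (x - y) ≤ 0 →
      expE (η * R x) * α (R x) ≤
        C * expE (-(|η| / 4) * |x - y|) * (expE (η * R y) * α (R y)) := by
  have hη' : 0 < |η| := abs_pos.2 hη
  obtain ⟨c, hc⟩ := hR.coarse h₀ h₁ (ε := 1 / 2) (by norm_num)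
  -- Since `|R x - R y| ≤ 3/2 * |x - y| + c`, the exponent `|η| / 6` costs a rate `|η| / 4` out of
  -- the `|η| / 2` left by the coarse estimate.
  obtain ⟨C, hC⟩ := hα.vary (|η| / 6) (by positivity)
  obtain ⟨D, hD⟩ := exists_nnreal_eq (varyConst_ne_top C (|η| * c + |η| / 6 * c))
  refine ⟨D, fun x y hxy => ?_⟩
  have e : η * (x - y) = -(|η| * |x - y|) := by rw [← abs_mul, abs_of_nonpos hxy, neg_neg]
  have h1 : η * R x ≤ η * R y + (-(|η| / 2) * |x - y| + |η| * c) := by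
    have h2 : η * (R x - R y - (x - y)) ≤ |η| * (1 / 2 * |x - y| + c) :=
      (le_abs_self _).trans (by rw [abs_mul]; gcongr; exact hc x y)
    nlinarith
  have h3 : |η| / 6 * |R x - R y| ≤ |η| / 4 * |x - y| + |η| / 6 * c := by
    have := abs_sub_le_of_coarse hc x y
    nlinarith
  calc expE (η * R x) * α (R x)
      ≤ (expE (η * R y) * (expE (-(|η| / 2) * |x - y| + |η| * c))) *
          (C * expE (|η| / 4 * |x - y| + |η| / 6 * c) * α (R y)) := by
        refine mul_le_mul' ?_ ((hC (R x) (R y)).trans ?_)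
        · rw [← expE_add]; exact expE_le_expE h1
        · gcongr; exact expE_le_expE h3
    _ = C * expE ((-(|η| / 2) * |x - y| + |η| * c) + (|η| / 4 * |x - y| + |η| / 6 * c)) *
          (expE (η * R y) * α (R y)) := by
        rw [expE_add (-(|η| / 2) * |x - y| + |η| * c) (|η| / 4 * |x - y| + |η| / 6 * c)]; ring
    _ = _ := by rw [hD, mul_assoc (C : ℝ≥0∞) (expE _) (expE _), ← expE_add]; ring_nf

lemma IsParam.exists_varyBound (hR : IsParam P₀ P₁ R) (h₀ : P₀.Low) (h₁ : P₁.Up) (hα : SVar α)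
    (θ : ℝ) : ∃ (C : ℝ≥0) (M : ℝ), 0 ≤ M ∧ VaryBound C M fun x => expWeight θ α (R x) := by
  obtain ⟨c, hc⟩ := hR.coarse h₀ h₁ (ε := 1 / 2) (by norm_num)
  obtain ⟨C, hC⟩ := hα.exists_varyBound_expWeight θ
  obtain ⟨D, hD⟩ := hC.comp_coarse (by positivity) hc
  exact ⟨D, _, by positivity, hD⟩

lemma IsParam.exists_varyBound_mul (hR : IsParam P₀ P₁ R) (h₀ : P₀.Low) (h₁ : P₁.Up)
    (hα : SVar α) (θ : ℝ) : ∃ (C : ℝ≥0) (M : ℝ), 0 ≤ M ∧ ∀ k, QuasiConc k →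
      VaryBound C M fun x => expWeight θ α (R x) * (P₀.chiLow x * k x) := by
  obtain ⟨C, M, hM, hC⟩ := hR.exists_varyBound h₀ h₁ hα θ
  obtain ⟨D, hD⟩ := h₀.chiLow_sv.vary 1 one_pos
  exact ⟨_, _, by positivity, fun k hk => hC.mul (hD.mul (.of_monotone hk.mono hk.anti))⟩

/-- The decay `e * e` between the weights `W` at `x` and `w` at `u` is split: one factor is absorbed
by the local bound `m`, the other remains as the decay needed by the Hardy-type estimates. Hence the
rates `θ / 8` and `(1 - θ) / 8` below. -/
lemma mul_le_of_local {W K m A e : ℝ≥0∞} {w : ℝ≥0∞} (hW0 : W ≠ 0) (hWt : W ≠ ∞)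
    (h : W ≤ A * (e * e) * w) (hm : e * (w * K) ≤ m) :
    K ≤ W⁻¹ * (A * m) * e := by
  calc K = W⁻¹ * (W * K) := by rw [← mul_assoc, ENNReal.inv_mul_cancel hW0 hWt, one_mul]
    _ ≤ W⁻¹ * (A * (e * e) * w * K) := by gcongr
    _ = W⁻¹ * (A * (e * (w * K))) * e := by ring
    _ ≤ _ := by gcongr

/-- For `θ > 0` and `u < x` the weight at `x` is exponentially smaller than at `u`, so the weighted
head at `x` is dominated by a local supremum of the weighted middle term, and the maximal inequality
applies. -/
lemma exists_headRow_norm_le (hR : IsParam P₀ P₁ R) (h₀ : P₀.Low) (h₁ : P₁.Up) (hα : SVar α)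
    {r : ℝ≥0∞} (hr : r ≠ 0) {θ : ℝ} (hθ : 0 < θ) : ∃ C : ℝ≥0, ∀ k, QuasiConc k →
      lpOn r univ (fun x => expWeight θ α (R x) * P₀.headRow k x) ≤
        C * lpOn r univ (fun x => expWeight θ α (R x) * (P₀.chiLow x * k x)) := by
  obtain ⟨C, M, hM, hC⟩ := hR.exists_varyBound_mul h₀ h₁ hα θ
  obtain ⟨A, hA⟩ := hR.exists_weight_le h₀ h₁ hα (neg_ne_zero.2 hθ.ne')
  obtain ⟨D, hD⟩ := h₀.toRegular.exists_headRow_le h₀.chiLow_sv h₀.exists_norm_b_mul_a_le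
    (δ := θ / 8) (by positivity)
  obtain ⟨B, hB⟩ := exists_lpOn_le_of_local hr C hM (δ := θ / 8) (by positivity)
  refine ⟨B * (D * A + 1), fun k hk => ?_⟩
  refine (hB _ (hC k hk) (D * A) _ fun x m hm hloc => ?_).trans_eq (by push_cast; rfl)
  have hW0 := expWeight_ne_zero hα θ (R x)
  have hWt := expWeight_ne_top hα θ (R x)
  set W := expWeight θ α (R x) with hW
  have := hD k x (W⁻¹ * (A * m)) (ENNReal.mul_ne_top (ENNReal.inv_ne_top.2 hW0)
    (ENNReal.mul_ne_top ENNReal.coe_ne_top hm)) fun u hu => by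
      refine mul_le_of_local hW0 hWt ?_ (hloc u)
      have h := hA x u (by nlinarith)
      rw [abs_neg, abs_of_pos hθ] at h
      rw [← expE_add]
      refine h.trans_eq ?_
      congr 3; ring
  calc W * P₀.headRow k x ≤ W * (D * (W⁻¹ * (A * m))) := by gcongr
    _ = D * A * m * (W * W⁻¹) := by ring
    _ = _ := by rw [ENNReal.mul_inv_cancel hW0 hWt]; push_cast; ring

/-- The factor `exp R` turns the weight into `exp ((1 - θ) * R) * α(R)`, which grows to the right
for `θ < 1`; the identity `exp R * χ₁ * twist k = χ₀ * k` returns the middle term. -/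
lemma exists_tail_norm_le (hR : IsParam P₀ P₁ R) (h₀ : P₀.Low) (h₁ : P₁.Up) (hα : SVar α)
    {r : ℝ≥0∞} (hr : r ≠ 0) {θ : ℝ} (hθ : θ < 1) : ∃ C : ℝ≥0, ∀ k, QuasiConc k →
      lpOn r univ (fun x => expWeight θ α (R x) *
          (expE (R x) * (P₁.crossRow (twist k) x + P₁.tailRow (twist k) x))) ≤
        C * lpOn r univ (fun x => expWeight θ α (R x) * (P₀.chiLow x * k x)) := by
  have hη : 0 < 1 - θ := sub_pos.2 hθ
  obtain ⟨C, M, hM, hC⟩ := hR.exists_varyBound_mul h₀ h₁ hα θ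
  obtain ⟨A, hA⟩ := hR.exists_weight_le h₀ h₁ hα hη.ne'
  obtain ⟨D, hD⟩ := h₁.toRegular.exists_crossRow_add_tailRow_le h₁.chiUp_sv
    h₁.toRegular.exists_norm_b_mul_a_le (δ := (1 - θ) / 8) (by positivity)
  obtain ⟨B, hB⟩ := exists_lpOn_le_of_local hr C hM (δ := (1 - θ) / 8) (by positivity)
  refine ⟨B * (D * A + 1), fun k hk => ?_⟩
  refine (hB _ (hC k hk) (D * A) _ fun x m hm hloc => ?_).trans_eq (by push_cast; rfl)
  have hV : ∀ y, expE ((1 - θ) * R y) * α (R y) = expWeight θ α (R y) * expE (R y) := by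
    intro y
    rw [expWeight, mul_right_comm, ← expE_add]
    congr 2; ring
  set V := expE ((1 - θ) * R x) * α (R x) with hVdef
  have hV0 : V ≠ 0 := mul_ne_zero (expE_ne_zero _) (hα.ne_zero _)
  have hVt : V ≠ ∞ := ENNReal.mul_ne_top (expE_ne_top _) (hα.ne_top _)
  have := hD (twist k) x (V⁻¹ * (A * m)) (ENNReal.mul_ne_top (ENNReal.inv_ne_top.2 hV0)
    (ENNReal.mul_ne_top ENNReal.coe_ne_top hm)) fun u hu => by
      refine mul_le_of_local (w := expE ((1 - θ) * R u) * α (R u)) hV0 hVt ?_ ?_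
      · have h := hA x u (by nlinarith)
        rw [abs_of_pos hη] at h
        rw [← expE_add]
        refine h.trans_eq ?_
        congr 3; ring
      · refine le_trans (le_of_eq ?_) (hloc u)
        rw [hV]
        congr 1
        calc expWeight θ α (R u) * expE (R u) * (P₁.chiUp u * twist k u)
            = expWeight θ α (R u) * (expE (R u) * P₁.chiUp u * twist k u) := by ring
          _ = expWeight θ α (R u) * (P₀.chiLow u * (expE u * twist k u)) := by rw [hR u]; ring
          _ = _ := by rw [expE_mul_twist]
  calc expWeight θ α (R x) * (expE (R x) * (P₁.crossRow (twist k) x + P₁.tailRow (twist k) x))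
      = V * (P₁.crossRow (twist k) x + P₁.tailRow (twist k) x) := by rw [hVdef, hV]; ring
    _ ≤ V * (D * (V⁻¹ * (A * m))) := by gcongr
    _ = D * A * m * (V * V⁻¹) := by ring
    _ = _ := by rw [ENNReal.mul_inv_cancel hV0 hVt]; push_cast; ring

lemma exists_holm_norm_le (hR : IsParam P₀ P₁ R) (h₀ : P₀.Low) (h₁ : P₁.Up) (hα : SVar α)
    (r : ℝ≥0∞) (θ : ℝ) : ∃ C : ℝ≥0, ∀ k, QuasiConc k →
      lpOn r univ (fun x => expWeight θ α (R x) * holm P₀ P₁ R k x) ≤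
        C * (lpOn r univ (fun x => expWeight θ α (R x) * P₀.headRow k x)
          + lpOn r univ (fun x => expWeight θ α (R x) * (P₀.chiLow x * k x))
          + lpOn r univ (fun x => expWeight θ α (R x) *
              (expE (R x) * (P₁.crossRow (twist k) x + P₁.tailRow (twist k) x)))) := by
  obtain ⟨C, M, hM, hC⟩ := hR.exists_varyBound h₀ h₁ hα θ
  obtain ⟨D, hD⟩ := hC.lpOn_mul_add hM r
  have hRm := hR.measurable h₁
  refine ⟨D * (D + 1), fun k hk => ?_⟩
  have m1 : Measurable (P₀.headRow k) := (RowParams.headRow_mono k).measurable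
  have m2 : Measurable fun x => P₀.chiLow x * k x :=
    RowParams.measurable_chiLow.mul hk.mono.measurable
  have m3 : Measurable fun x =>
      expE (R x) * (P₁.crossRow (twist k) x + P₁.tailRow (twist k) x) :=
    (measurable_expE.comp hRm).mul
      ((RowParams.measurable_crossRow _).add (RowParams.tailRow_anti _).measurable)
  refine (hD univ _ _ (m1.add m2) m3).trans ?_
  refine (mul_le_mul' le_rfl (add_le_add (hD univ _ _ m1 m2) le_rfl)).trans ?_
  push_cast
  rw [mul_assoc]
  refine mul_le_mul' le_rfl ?_
  rw [mul_add ((D : ℝ≥0∞) + 1)]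
  exact add_le_add (mul_le_mul' le_self_add le_rfl) (le_mul_of_one_le_left' le_add_self)

variable {𝕜 : Type*} [RCLike 𝕜] {E : Type*} [AddCommGroup E] [Module 𝕜 E]
  [TopologicalSpace E] [IsTopologicalAddGroup E] [T2Space E] {A₀ A₁ : QSpace E}

/-- The coarse change of variables `y = R x` moves the norm to the points where Holmstedt's formula
describes the `K`-functional. -/
lemma exists_klog_norm_equiv (hA : CompatibleCouple 𝕜 A₀ A₁)
    (hR : IsParam P₀ P₁ R) (h₀ : P₀.Low) (h₁ : P₁.Up) {X₀ X₁ : QSpace E}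
    (hX₀ : X₀ = finiteSpace A₀ A₁ fun f => P₀.fullRow (klog A₀ A₁ f))
    (hX₁ : X₁ = finiteSpace A₀ A₁ fun f => P₁.fullRow (twist (klog A₀ A₁ f)))
    (hα : SVar α) {r : ℝ≥0∞} (hr : r ≠ 0) (θ : ℝ) :
    ∃ C : ℝ≥0, ∀ f ∈ sumSet A₀ A₁,
      lpOn r univ (fun y => expWeight θ α y * klog X₀ X₁ f y) ≤
          C * lpOn r univ (fun x => expWeight θ α (R x) * holm P₀ P₁ R (klog A₀ A₁ f) x) ∧
        lpOn r univ (fun x => expWeight θ α (R x) * holm P₀ P₁ R (klog A₀ A₁ f) x) ≤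
          C * lpOn r univ (fun y => expWeight θ α y * klog X₀ X₁ f y) := by
  obtain ⟨C, hC⟩ := exists_klog_rows_equiv hA hR h₀ h₁ hX₀ hX₁
  obtain ⟨A, hA'⟩ := hα.exists_varyBound_expWeight θ
  obtain ⟨c, hc⟩ := hR.coarse h₀ h₁ (ε := 1 / 2) (by norm_num)
  obtain ⟨D, hD⟩ := exists_lpOn_comp_le hr (A * 1) (M := |θ| + 1 + 1) (by positivity)
    (hR.measurable h₁) hc
  refine ⟨D * C, fun f hf => ?_⟩
  obtain ⟨hD₁, hD₂⟩ := hD _ (hA'.mul (varyBound_klog X₀ X₁ f))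
  constructor
  · refine hD₂.trans ?_
    rw [ENNReal.coe_mul, mul_assoc]
    refine mul_le_mul' le_rfl (lpOn_le_mul ENNReal.coe_ne_top MeasurableSet.univ fun x _ => ?_)
    rw [mul_left_comm]
    exact mul_le_mul' le_rfl (hC f hf x).1
  · calc _ ≤ C * lpOn r univ (fun x => expWeight θ α (R x) * klog X₀ X₁ f (R x)) := by
          refine lpOn_le_mul ENNReal.coe_ne_top MeasurableSet.univ fun x _ => ?_
          rw [mul_left_comm]
          exact mul_le_mul' le_rfl (hC f hf x).2
      _ ≤ C * (D * _) := mul_le_mul' le_rfl hD₁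
      _ = _ := by push_cast; ring

end reiteration

/-! ### Equality of spaces -/

section spaces

variable {E : Type*} [AddCommGroup E]

lemma finiteSpace_inter (A₀ A₁ : QSpace E) (N N' : E → ℝ≥0∞) :
    (finiteSpace A₀ A₁ N).inter (finiteSpace A₀ A₁ N') =
      finiteSpace A₀ A₁ fun f => max (N f) (N' f) := by
  simp only [finiteSpace, QSpace.inter, QSpace.mk.injEq, and_true]
  ext f
  simp only [mem_inter_iff, mem_ofPred_eq, max_lt_iff]
  tauto

/-- The two carriers refer to different sums; finiteness of `N` recovers membership in `X₀ + X₁`, so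
comparing the quasi-norms on `A₀ + A₁` suffices. -/
lemma finiteSpace_same {A₀ A₁ X₀ X₁ : QSpace E} {N N' : E → ℝ≥0∞}
    (hsub : sumSet X₀ X₁ ⊆ sumSet A₀ A₁) (hmem : ∀ f, N f < ∞ → f ∈ sumSet X₀ X₁)
    (h : ∃ C : ℝ≥0, ∀ f ∈ sumSet A₀ A₁, N f ≤ C * N' f)
    (h' : ∃ C : ℝ≥0, ∀ f ∈ sumSet A₀ A₁, N' f ≤ C * N f) :
    (finiteSpace X₀ X₁ N).Same (finiteSpace A₀ A₁ N') := by
  obtain ⟨C, hC⟩ := h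
  obtain ⟨D, hD⟩ := h'
  refine ⟨⟨fun f hf => ⟨hsub hf.1, ?_⟩, D, fun f hf => hD f (hsub hf.1)⟩,
    ⟨fun f hf => ?_, C, fun f hf => hC f hf.1⟩⟩
  · exact (hD f (hsub hf.1)).trans_lt (ENNReal.mul_lt_top ENNReal.coe_lt_top hf.2)
  · have : N f < ∞ := (hC f hf.1).trans_lt (ENNReal.mul_lt_top ENNReal.coe_lt_top hf.2)
    exact ⟨hmem f this, this⟩

lemma sumSet_finiteSpace_subset {𝕜 : Type*} [RCLike 𝕜] [Module 𝕜 E] {A₀ A₁ : QSpace E}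
    (h₀ : A₀.IsQuasiBanach 𝕜) (h₁ : A₁.IsQuasiBanach 𝕜) (N N' : E → ℝ≥0∞) :
    sumSet (finiteSpace A₀ A₁ N) (finiteSpace A₀ A₁ N') ⊆ sumSet A₀ A₁ := by
  rintro _ ⟨_, ⟨⟨g₀, hg₀, g₁, hg₁, rfl⟩, -⟩, _, ⟨⟨l₀, hl₀, l₁, hl₁, rfl⟩, -⟩, rfl⟩
  exact ⟨g₀ + l₀, h₀.add_mem _ hg₀ _ hl₀, g₁ + l₁, h₁.add_mem _ hg₁ _ hl₁, by abel⟩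

lemma mem_sumSet_of_norm_lt_top {X₀ X₁ : QSpace E} {α : ℝ → ℝ≥0∞} (hα : SVar α) {r : ℝ≥0∞}
    (hr : r ≠ 0) (θ : ℝ) {f : E}
    (h : lpOn r univ (fun y => expWeight θ α y * klog X₀ X₁ f y) < ∞) : f ∈ sumSet X₀ X₁ := by
  obtain ⟨A, hA⟩ := hα.exists_varyBound_expWeight θ
  obtain ⟨D, hD⟩ := exists_le_lpOn hr (A * 1) (M := |θ| + 1 + 1) (by positivity)
  have h0 := (hD _ (hA.mul (varyBound_klog X₀ X₁ f)) 0 univ (Or.inl (subset_univ _))).trans_lt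
    (ENNReal.mul_lt_top ENNReal.coe_lt_top h)
  refine mem_sumSet_of_klog_ne_top (x := 0) fun hcon => ?_
  rw [hcon, ENNReal.mul_top (expWeight_ne_zero hα θ 0)] at h0
  exact h0.ne rfl

end spaces

/-! ### Passage to the logarithmic variable -/

/-- A weight on `(0, ∞)` in the logarithmic variable. -/
noncomputable def logWeight (b : ℝ → ℝ) (x : ℝ) : ℝ≥0∞ := ENNReal.ofReal (b (Real.exp x))

lemma logWeight_le_of_le {b : ℝ → ℝ} {C ε x y : ℝ} (hC : 0 < C)
    (h : b (Real.exp x) ≤ C * Real.exp (ε * |x - y|) * b (Real.exp y)) :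
    logWeight b x ≤ C.toNNReal * expE (ε * |x - y|) * logWeight b y := by
  rw [logWeight, logWeight, expE, ← ENNReal.ofReal, ← ENNReal.ofReal_mul hC.le,
    ← ENNReal.ofReal_mul (by positivity)]
  exact ENNReal.ofReal_le_ofReal h

lemma exp_rpow (x ε : ℝ) : Real.exp x ^ ε = Real.exp (ε * x) := by
  rw [← Real.exp_mul, mul_comm]

/-- The almost increasing function `t ^ ε * b t` serves `x ≤ y`, the almost decreasing `t ^ (-ε) * b
t` serves `y ≤ x`; each equivalence is used twice, hence the squared constants. -/
lemma SlowlyVarying.exists_le {b : ℝ → ℝ} (hb : SlowlyVarying b) {ε : ℝ} (hε : 0 < ε) :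
    ∃ C : ℝ, 0 < C ∧ ∀ x y, b (Real.exp x) ≤ C * Real.exp (ε * |x - y|) * b (Real.exp y) := by
  obtain ⟨g, hg, C, hC, hCg⟩ := hb.equiv_increasing ε hε
  obtain ⟨h, hh, D, hD, hDh⟩ := hb.equiv_decreasing ε hε
  refine ⟨max (C * C) (D * D), by positivity, fun x y => ?_⟩
  have hx := Real.exp_pos x
  have hy := Real.exp_pos y
  have hby := hb.pos _ hy
  rcases le_total x y with hxy | hxy
  · have h1 := (hCg _ hx).1.trans (mul_le_mul_of_nonneg_left (hg hx hy (Real.exp_le_exp.2 hxy)) hC.le)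
    have h2 := h1.trans (mul_le_mul_of_nonneg_left (hCg _ hy).2 hC.le)
    simp only [exp_rpow] at h2
    rw [abs_of_nonpos (by linarith)]
    calc b (Real.exp x) = Real.exp (-(ε * x)) * (Real.exp (ε * x) * b (Real.exp x)) := by
          rw [← mul_assoc, ← Real.exp_add]; simp
      _ ≤ Real.exp (-(ε * x)) * (C * (C * (Real.exp (ε * y) * b (Real.exp y)))) := by gcongr
      _ = C * C * Real.exp (ε * -(x - y)) * b (Real.exp y) := by
          have : ε * -(x - y) = -(ε * x) + ε * y := by ring
          rw [this, Real.exp_add]; ring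
      _ ≤ _ := by gcongr; exact le_max_left _ _
  · have h1 := (hDh _ hx).1.trans (mul_le_mul_of_nonneg_left (hh hy hx (Real.exp_le_exp.2 hxy)) hD.le)
    have h2 := h1.trans (mul_le_mul_of_nonneg_left (hDh _ hy).2 hD.le)
    simp only [exp_rpow] at h2
    rw [abs_of_nonneg (by linarith)]
    calc b (Real.exp x) = Real.exp (ε * x) * (Real.exp (-ε * x) * b (Real.exp x)) := by
          rw [← mul_assoc, ← Real.exp_add]; simp
      _ ≤ Real.exp (ε * x) * (D * (D * (Real.exp (-ε * y) * b (Real.exp y)))) := by gcongr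
      _ = D * D * Real.exp (ε * (x - y)) * b (Real.exp y) := by
          have : ε * (x - y) = ε * x + -ε * y := by ring
          rw [this, Real.exp_add]; ring
      _ ≤ _ := by gcongr; exact le_max_right _ _

lemma SlowlyVarying.logWeight_sv {b : ℝ → ℝ} (hb : SlowlyVarying b) : SVar (logWeight b) where
  ne_zero x := by simpa [logWeight] using hb.pos _ (Real.exp_pos x)
  ne_top x := ENNReal.ofReal_ne_top
  vary ε hε := by
    obtain ⟨C, hC, h⟩ := hb.exists_le hε
    exact ⟨C.toNNReal, fun x y => logWeight_le_of_le hC (h x y)⟩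

lemma exp_image_preimage {I : Set ℝ} (hI : I ⊆ Ioi 0) : Real.exp '' (Real.exp ⁻¹' I) = I := by
  rw [image_preimage_eq_inter_range, Real.range_exp, inter_eq_left.2 hI]

lemma lintegral_exp_image (I : Set ℝ) (hI : I ⊆ Ioi 0) (hm : MeasurableSet I) (g : ℝ → ℝ≥0∞) :
    ∫⁻ u in I, g u = ∫⁻ x in Real.exp ⁻¹' I, expE x * g (Real.exp x) := by
  have := lintegral_image_eq_lintegral_abs_deriv_mul (Real.measurable_exp hm)
    (fun x _ => (Real.hasDerivAt_exp x).hasDerivWithinAt) Real.exp_injective.injOn g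
  rw [exp_image_preimage hI] at this
  rw [this]
  simp only [abs_of_pos (Real.exp_pos _), expE]

lemma measurableEmbedding_exp : MeasurableEmbedding Real.exp :=
  Real.continuous_exp.measurableEmbedding Real.exp_injective

/-- No measurability of `g` is assumed: the two measures have the same null sets, which determines
the essential supremum. -/
lemma essSup_exp (I : Set ℝ) (hI : I ⊆ Ioi 0) (hm : MeasurableSet I) (g : ℝ → ℝ≥0∞) :
    essSup g (volume.restrict I) =
      essSup (fun x => g (Real.exp x)) (volume.restrict (Real.exp ⁻¹' I)) := by
  have hnull : ∀ S : Set ℝ, MeasurableSet S → (volume.restrict I S = 0 ↔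
      (volume.restrict (Real.exp ⁻¹' I)).map Real.exp S = 0) := by
    intro S hS
    rw [Measure.restrict_apply hS, Measure.map_apply Real.measurable_exp hS,
      Measure.restrict_apply (Real.measurable_exp hS), ← setLIntegral_one,
      lintegral_exp_image (S ∩ I) (inter_subset_right.trans hI) (hS.inter hm)]
    simp only [mul_one]
    rw [setLIntegral_eq_zero_iff (Real.measurable_exp (hS.inter hm)) measurable_expE,
      ← preimage_inter, ae_iff]
    simp only [mem_preimage, expE_ne_zero, imp_false, not_not]
    rfl
  have h1 : volume.restrict I ≪ (volume.restrict (Real.exp ⁻¹' I)).map Real.exp :=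
    Measure.AbsolutelyContinuous.mk fun S hS h => (hnull S hS).2 h
  have h2 : (volume.restrict (Real.exp ⁻¹' I)).map Real.exp ≪ volume.restrict I :=
    Measure.AbsolutelyContinuous.mk fun S hS h => (hnull S hS).1 h
  rw [le_antisymm (essSup_mono_measure h1) (essSup_mono_measure h2),
    measurableEmbedding_exp.essSup_map_measure]
  rfl

lemma wnorm_eq_lpOn {q : ℝ≥0∞} (hq : q ≠ 0) {I : Set ℝ} (hI : I ⊆ Ioi 0) (hm : MeasurableSet I)
    (θ : ℝ) (b : ℝ → ℝ) (F : ℝ → ℝ≥0∞) :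
    wnorm q I θ b F = lpOn q (Real.exp ⁻¹' I)
      fun x => expE (-θ * x) * (logWeight b x * F (Real.exp x)) := by
  have hsplit : ∀ x, ENNReal.ofReal (Real.exp x ^ (-θ - (1 / q).toReal) * b (Real.exp x))
      * F (Real.exp x) = expE (-(1 / q).toReal * x) *
        (expE (-θ * x) * (logWeight b x * F (Real.exp x))) := by
    intro x
    rw [ENNReal.ofReal_mul (by positivity), exp_rpow, sub_eq_add_neg, add_mul, Real.exp_add,
      ENNReal.ofReal_mul (Real.exp_pos _).le, logWeight, expE, expE]
    ring
  change lpOn q I _ = _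
  rcases eq_or_ne q ∞ with rfl | ht
  · rw [lpOn_top, lpOn_top, essSup_exp I hI hm]
    simp only [hsplit]
    simp
  · rw [lpOn_eq_lintegral hq ht, lpOn_eq_lintegral hq ht, lintegral_exp_image I hI hm]
    have hq' := ENNReal.toReal_pos hq ht
    congr 1
    refine lintegral_congr fun x => ?_
    rw [hsplit, ENNReal.mul_rpow_of_nonneg _ _ hq'.le, expE_rpow, ← mul_assoc, ← expE_add]
    -- The Jacobian `exp x` cancels against the `q`-th power of `u ^ (-1/q)`.
    have : x + -(1 / q).toReal * x * q.toReal = 0 := by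
      rw [one_div, ENNReal.toReal_inv]; field_simp; ring
    rw [this, expE_zero, one_mul]

section intervals

variable {q : ℝ≥0∞} (θ : ℝ) (b : ℝ → ℝ) (F : ℝ → ℝ≥0∞)

lemma wnorm_Ioi_zero (hq : q ≠ 0) : wnorm q (Ioi 0) θ b F =
    lpOn q univ fun x => expE (-θ * x) * (logWeight b x * F (Real.exp x)) := by
  rw [wnorm_eq_lpOn hq subset_rfl measurableSet_Ioi]
  congr 1
  ext x; simp [Real.exp_pos]

lemma wnorm_Ioi_exp (hq : q ≠ 0) (x : ℝ) : wnorm q (Ioi (Real.exp x)) θ b F =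
    lpOn q (Ioi x) fun x => expE (-θ * x) * (logWeight b x * F (Real.exp x)) := by
  rw [wnorm_eq_lpOn hq (Ioi_subset_Ioi (Real.exp_pos x).le) measurableSet_Ioi]
  congr 1
  ext y; simp

lemma wnorm_Ioo_zero_exp (hq : q ≠ 0) (x : ℝ) : wnorm q (Ioo 0 (Real.exp x)) θ b F =
    lpOn q (Iio x) fun x => expE (-θ * x) * (logWeight b x * F (Real.exp x)) := by
  rw [wnorm_eq_lpOn hq Ioo_subset_Ioi_self measurableSet_Ioo]
  congr 1
  ext y; simp [Real.exp_pos]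

lemma wnorm_Ioo_exp_exp (hq : q ≠ 0) (x y : ℝ) :
    wnorm q (Ioo (Real.exp x) (Real.exp y)) θ b F =
      lpOn q (Ioo x y) fun x => expE (-θ * x) * (logWeight b x * F (Real.exp x)) := by
  rw [wnorm_eq_lpOn hq (Ioo_subset_Ioi_self.trans (Ioi_subset_Ioi (Real.exp_pos x).le))
    measurableSet_Ioo]
  congr 1
  ext y; simp

end intervals

/-- The data of an iterated norm on `(0, ∞)`, in the logarithmic variable. -/
noncomputable def logParams (r : ℝ≥0∞) (b : ℝ → ℝ) (q : ℝ≥0∞) (a : ℝ → ℝ) : RowParams :=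
  ⟨r, logWeight b, q, logWeight a⟩

section rows

variable {r q : ℝ≥0∞} (b a : ℝ → ℝ) (F : ℝ → ℝ≥0∞)

lemma wnorm_tailRow (hr : r ≠ 0) (hq : q ≠ 0) (θ x : ℝ) :
    wnorm r (Ioi (Real.exp x)) 0 b (fun s => wnorm q (Ioi s) θ a F) =
      (logParams r b q a).tailRow (fun u => expE (-θ * u) * F (Real.exp u)) x := by
  simp only [wnorm_Ioi_exp _ _ _ hr, wnorm_Ioi_exp _ _ _ hq, neg_zero, zero_mul, expE_zero, one_mul]
  simp only [RowParams.tailRow, RowParams.row, logParams, mul_left_comm (expE _)]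

lemma wnorm_fullRow (hr : r ≠ 0) (hq : q ≠ 0) (θ : ℝ) :
    wnorm r (Ioi 0) 0 b (fun s => wnorm q (Ioi s) θ a F) =
      (logParams r b q a).fullRow (fun u => expE (-θ * u) * F (Real.exp u)) := by
  simp only [wnorm_Ioi_zero _ _ _ hr, wnorm_Ioi_exp _ _ _ hq, neg_zero, zero_mul, expE_zero,
    one_mul]
  simp only [RowParams.fullRow, RowParams.row, logParams, mul_left_comm (expE _)]

lemma wnorm_headRow (hr : r ≠ 0) (hq : q ≠ 0) (θ x : ℝ) :
    wnorm r (Ioo 0 (Real.exp x)) 0 b (fun s => wnorm q (Ioo s (Real.exp x)) θ a F) =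
      (logParams r b q a).headRow (fun u => expE (-θ * u) * F (Real.exp u)) x := by
  simp only [wnorm_Ioo_zero_exp _ _ _ hr, wnorm_Ioo_exp_exp _ _ _ hq, neg_zero, zero_mul,
    expE_zero, one_mul]
  simp only [RowParams.headRow, RowParams.row, logParams, mul_left_comm (expE _)]

lemma wnorm_norm_b (hr : r ≠ 0) (x : ℝ) :
    wnorm r (Ioo 0 (Real.exp x)) 0 b (fun _ => 1) = lpOn r (Iio x) (logWeight b) := by
  simp [wnorm_Ioo_zero_exp _ _ _ hr]

lemma wnorm_norm_a (hq : q ≠ 0) (θ x : ℝ) :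
    wnorm q (Ioi (Real.exp x)) θ a F =
      lpOn q (Ioi x) fun u => logWeight a u * (expE (-θ * u) * F (Real.exp u)) := by
  simp only [wnorm_Ioi_exp _ _ _ hq, mul_left_comm (expE _)]

lemma chiZero_exp (hr : r ≠ 0) (hq : q ≠ 0) (x : ℝ) :
    chiZero r b q a (Real.exp x) = ((logParams r b q a).chiLow x).toReal := by
  rw [chiZero, wnorm_tailRow _ _ _ hr hq, wnorm_norm_b _ hr, wnorm_norm_a _ _ hq]
  simp [RowParams.chiLow, RowParams.crossRow, logParams]

lemma chiOne_exp (hr : r ≠ 0) (hq : q ≠ 0) (x : ℝ) :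
    chiOne r b q a (Real.exp x) = ((logParams r b q a).chiUp x).toReal := by
  rw [chiOne, wnorm_headRow _ _ _ hr hq]
  simp [RowParams.chiUp]

lemma low_logParams (hr : r ≠ 0) (hq : q ≠ 0) (ha : SlowlyVarying a) (hb : SlowlyVarying b)
    (h : wnorm r (Ioo 0 1) 0 b (fun _ => 1) < ∞)
    (h' : wnorm r (Ioi 1) 0 b (fun s => wnorm q (Ioi s) 0 a fun _ => 1) < ∞) :
    (logParams r b q a).Low where
  r_ne := hr
  q_ne := hq
  b_sv := hb.logWeight_sv
  a_sv := ha.logWeight_sv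
  norm_b := by
    rw [← Real.exp_zero, wnorm_norm_b _ hr] at h
    exact h.ne
  tail := by
    rw [← Real.exp_zero, wnorm_tailRow _ _ _ hr hq] at h'
    simpa using h'.ne

lemma up_logParams (hr : r ≠ 0) (hq : q ≠ 0) (ha : SlowlyVarying a) (hb : SlowlyVarying b)
    (h : wnorm r (Ioo 0 1) 0 b (fun s => wnorm q (Ioo s 1) 0 a fun _ => 1) < ∞) :
    (logParams r b q a).Up where
  r_ne := hr
  q_ne := hq
  b_sv := hb.logWeight_sv
  a_sv := ha.logWeight_sv
  head := by
    rw [← Real.exp_zero, wnorm_headRow _ _ _ hr hq] at h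
    simpa using h.ne

end rows

/-! ### The reiteration theorem -/

lemma spaceR_zero_eq {E : Type*} [AddCommGroup E] (A₀ A₁ : QSpace E) {r q : ℝ≥0∞} (hr : r ≠ 0)
    (hq : q ≠ 0) (b a : ℝ → ℝ) : spaceR A₀ A₁ 0 r b q a =
      finiteSpace A₀ A₁ fun f => (logParams r b q a).fullRow (klog A₀ A₁ f) := by
  simp only [spaceR, wnorm_fullRow _ _ _ hr hq, neg_zero, zero_mul, expE_zero, one_mul]
  rfl

lemma spaceR_one_eq {E : Type*} [AddCommGroup E] (A₀ A₁ : QSpace E) {r q : ℝ≥0∞} (hr : r ≠ 0)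
    (hq : q ≠ 0) (b a : ℝ → ℝ) : spaceR A₀ A₁ 1 r b q a =
      finiteSpace A₀ A₁ fun f => (logParams r b q a).fullRow (twist (klog A₀ A₁ f)) := by
  simp only [spaceR, wnorm_fullRow _ _ _ hr hq, neg_mul, one_mul]
  rfl

lemma stdSpace_eq {E : Type*} [AddCommGroup E] (A₀ A₁ : QSpace E) {r : ℝ≥0∞} (hr : r ≠ 0)
    (θ : ℝ) (a : ℝ → ℝ) : stdSpace A₀ A₁ θ r a = finiteSpace A₀ A₁ fun f =>
      lpOn r univ fun y => expWeight θ (logWeight a) y * klog A₀ A₁ f y := by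
  simp only [stdSpace, wnorm_Ioi_zero _ _ _ hr, expWeight, mul_assoc]
  rfl

/-- Substituting `R = x + log c - log d` matches both exponents. With `c = χ₀` and `d = χ₁`, it
identifies the norm with weight `a^#` as that of the middle term of `holm`. -/
lemma exp_mul_rpow_eq {c d x R : ℝ} (θ : ℝ) (hc : 0 < c) (hd : 0 < d)
    (hR : Real.exp R = Real.exp x * (c / d)) :
    Real.exp (-θ * x) * (c ^ (1 - θ) * d ^ θ) = Real.exp (-θ * R) * c := by
  have hR' : R = x + (Real.log c - Real.log d) := by
    rw [← Real.log_exp R, hR, Real.log_mul (Real.exp_pos x).ne' (div_pos hc hd).ne', Real.log_exp,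
      Real.log_div hc.ne' hd.ne']
  rw [Real.rpow_def_of_pos hc, Real.rpow_def_of_pos hd, hR']
  conv_rhs => rw [← Real.exp_log hc]
  rw [← Real.exp_add, ← Real.exp_add, ← Real.exp_add, Real.log_exp]
  congr 1; ring

lemma le_mul_max_two {N H T₁ T₂ T₃ : ℝ≥0∞} {C C' D₃ : ℝ≥0} (h : N ≤ C * H)
    (h' : H ≤ C' * (T₁ + T₂ + T₃)) (h₃ : T₃ ≤ D₃ * T₂) :
    N ≤ (C * (C' * (1 + 1 + D₃)) : ℝ≥0) * max T₂ T₁ := by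
  have m₁ : T₁ ≤ max T₂ T₁ := le_max_right _ _
  have m₂ : T₂ ≤ max T₂ T₁ := le_max_left _ _
  calc N ≤ C * (C' * (max T₂ T₁ + max T₂ T₁ + D₃ * max T₂ T₁)) :=
        h.trans (mul_le_mul' le_rfl (h'.trans (mul_le_mul' le_rfl
          (add_le_add (add_le_add m₁ m₂) (h₃.trans (mul_le_mul' le_rfl m₂))))))
    _ = _ := by push_cast; ring

lemma le_mul_max_three {N H T₁ T₂ T₃ T₄ T : ℝ≥0∞} {C C' D₁ D : ℝ≥0} (h : N ≤ C * H)
    (h' : H ≤ C' * (T₁ + T₂ + T)) (h₁ : T₁ ≤ D₁ * T₂) (hT : T ≤ D * (T₃ + T₄)) :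
    N ≤ (C * (C' * (D₁ + 1 + D * (1 + 1))) : ℝ≥0) * max (max T₂ T₃) T₄ := by
  set M := max (max T₂ T₃) T₄
  have m₂ : T₂ ≤ M := (le_max_left _ _).trans (le_max_left _ _)
  have m₃ : T₃ ≤ M := (le_max_right _ _).trans (le_max_left _ _)
  have m₄ : T₄ ≤ M := le_max_right _ _
  calc N ≤ C * (C' * (D₁ * M + M + D * (M + M))) :=
        h.trans (mul_le_mul' le_rfl (h'.trans (mul_le_mul' le_rfl (add_le_add
          (add_le_add (h₁.trans (mul_le_mul' le_rfl m₂)) m₂)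
          (hT.trans (mul_le_mul' le_rfl (add_le_add m₃ m₄)))))))
    _ = _ := by push_cast; ring

theorem theorem51 {𝕜 : Type*} [RCLike 𝕜] {E : Type*} [AddCommGroup E] [Module 𝕜 E]
    [TopologicalSpace E] [IsTopologicalAddGroup E] [ContinuousSMul 𝕜 E] [T2Space E]
    (A₀ A₁ : QSpace E) (hA : CompatibleCouple 𝕜 A₀ A₁)
    (r r₀ q₀ r₁ q₁ : ℝ≥0∞) (hr : 0 < r) (hr₀ : 0 < r₀) (hq₀ : 0 < q₀) (hr₁ : 0 < r₁) (hq₁ : 0 < q₁)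
    (a a₀ b₀ a₁ b₁ : ℝ → ℝ) (ha : SlowlyVarying a) (ha₀ : SlowlyVarying a₀)
    (hb₀ : SlowlyVarying b₀) (ha₁ : SlowlyVarying a₁) (hb₁ : SlowlyVarying b₁)
    (h₀ : wnorm r₀ (Ioo 0 1) 0 b₀ (fun _ => 1) < ∞)
    (h₀' : wnorm r₀ (Ioi 1) 0 b₀ (fun s => wnorm q₀ (Ioi s) 0 a₀ fun _ => 1) < ∞)
    (h₁ : wnorm r₁ (Ioo 0 1) 0 b₁ (fun s => wnorm q₁ (Ioo s 1) 0 a₁ fun _ => 1) < ∞)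
    (χ₀ χ₁ ρ B₁ : ℝ → ℝ) (hχ₀ : χ₀ = chiZero r₀ b₀ q₀ a₀) (hχ₁ : χ₁ = chiOne r₁ b₁ q₁ a₁)
    (hρ : ∀ t, ρ t = t * (χ₀ t / χ₁ t))
    (hB₁ : ∀ t, B₁ t = (wnorm r₁ (Ioo 0 t) 0 b₁ fun _ => 1).toReal * a (ρ t))
    (aSharp : ℝ → ℝ → ℝ) (haSharp : ∀ θ t, aSharp θ t = χ₀ t ^ (1 - θ) * χ₁ t ^ θ * a (ρ t))
    (X₀ X₁ : QSpace E) (hX₀ : X₀ = spaceR A₀ A₁ 0 r₀ b₀ q₀ a₀)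
    (hX₁ : X₁ = spaceR A₀ A₁ 1 r₁ b₁ q₁ a₁) :
    (∀ θ : ℝ, 0 < θ → θ < 1 →
      (stdSpace X₀ X₁ θ r a).Same (stdSpace A₀ A₁ θ r (aSharp θ))) ∧
    (wnorm r (Ioi 1) 0 a (fun _ => 1) < ∞ →
      (stdSpace X₀ X₁ 0 r a).Same
        ((stdSpace A₀ A₁ 0 r (aSharp 0)).inter
          (spaceRL A₀ A₁ 0 r (a ∘ ρ) r₀ b₀ q₀ a₀))) ∧
    (wnorm r (Ioo 0 1) 0 a (fun _ => 1) < ∞ →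
      (stdSpace X₀ X₁ 1 r a).Same
        (((stdSpace A₀ A₁ 1 r (aSharp 1)).inter
          (spaceR A₀ A₁ 1 r B₁ q₁ a₁)).inter
          (spaceRR A₀ A₁ 1 r (a ∘ ρ) r₁ b₁ q₁ a₁))) := by
  have hr' := hr.ne'
  have h₀L := low_logParams b₀ a₀ hr₀.ne' hq₀.ne' ha₀ hb₀ h₀ h₀'
  have h₁U := up_logParams b₁ a₁ hr₁.ne' hq₁.ne' ha₁ hb₁ h₁
  rw [spaceR_zero_eq A₀ A₁ hr₀.ne' hq₀.ne'] at hX₀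
  rw [spaceR_one_eq A₀ A₁ hr₁.ne' hq₁.ne'] at hX₁
  have hα := ha.logWeight_sv
  set P₀ := logParams r₀ b₀ q₀ a₀ with hP₀
  set P₁ := logParams r₁ b₁ q₁ a₁ with hP₁
  set α := logWeight a with hαdef
  have hc0 : ∀ x, ENNReal.ofReal (χ₀ (Real.exp x)) = P₀.chiLow x := fun x => by
    rw [hχ₀, chiZero_exp _ _ hr₀.ne' hq₀.ne', ENNReal.ofReal_toReal (h₀L.chiLow_sv.ne_top x)]
  have hc1 : ∀ x, ENNReal.ofReal (χ₁ (Real.exp x)) = P₁.chiUp x := fun x => by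
    rw [hχ₁, chiOne_exp _ _ hr₁.ne' hq₁.ne', ENNReal.ofReal_toReal (h₁U.chiUp_sv.ne_top x)]
  have hc0' : ∀ x, 0 < χ₀ (Real.exp x) := fun x => by
    rw [← ENNReal.ofReal_pos, hc0]; exact pos_iff_ne_zero.2 (h₀L.chiLow_sv.ne_zero x)
  have hc1' : ∀ x, 0 < χ₁ (Real.exp x) := fun x => by
    rw [← ENNReal.ofReal_pos, hc1]; exact pos_iff_ne_zero.2 (h₁U.chiUp_sv.ne_zero x)
  set R : ℝ → ℝ := fun x => Real.log (ρ (Real.exp x)) with hRdef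
  have hρR : ∀ x, ρ (Real.exp x) = Real.exp (R x) := fun x => by
    rw [hRdef, Real.exp_log]
    rw [hρ]
    exact mul_pos (Real.exp_pos x) (div_pos (hc0' x) (hc1' x))
  have hRx : ∀ x, Real.exp (R x) = Real.exp x * (χ₀ (Real.exp x) / χ₁ (Real.exp x)) := fun x => by
    rw [← hρR, hρ]
  have hR : IsParam P₀ P₁ R := fun x => by
    rw [expE, expE, ← hc0, ← hc1, ← ENNReal.ofReal_mul (Real.exp_pos _).le,
      ← ENNReal.ofReal_mul (Real.exp_pos _).le, hRx, mul_assoc, div_mul_cancel₀ _ (hc1' x).ne']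
  have hsub : sumSet X₀ X₁ ⊆ sumSet A₀ A₁ := by
    rw [hX₀, hX₁]
    exact sumSet_finiteSpace_subset hA.quasiBanach₀ hA.quasiBanach₁ _ _
  have hqc : ∀ f ∈ sumSet A₀ A₁, QuasiConc (klog A₀ A₁ f) := fun f hf =>
    quasiConc_klog hA.quasiBanach₀ hA.quasiBanach₁ hf
  have hαρ : ∀ x, ENNReal.ofReal (a (ρ (Real.exp x))) = α (R x) := fun x => by
    rw [hρR]; rfl
  have hsharp : ∀ θ x, expWeight θ (logWeight (aSharp θ)) x
      = expWeight θ α (R x) * P₀.chiLow x := fun θ x => by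
    rw [expWeight, expWeight, logWeight, haSharp, ENNReal.ofReal_mul
      (mul_nonneg (Real.rpow_nonneg (hc0' x).le _) (Real.rpow_nonneg (hc1' x).le _)), hαρ,
      mul_right_comm, ← hc0, expE, expE, ← mul_assoc, ← ENNReal.ofReal_mul (Real.exp_pos _).le,
      ← ENNReal.ofReal_mul (Real.exp_pos _).le, exp_mul_rpow_eq θ (hc0' x) (hc1' x) (hRx x)]
  have hstd : ∀ θ, stdSpace A₀ A₁ θ r (aSharp θ) = finiteSpace A₀ A₁ fun f =>
      lpOn r univ fun x => expWeight θ α (R x) * (P₀.chiLow x * klog A₀ A₁ f x) := fun θ => by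
    rw [stdSpace_eq _ _ hr']
    simp only [hsharp, mul_assoc]
  have hmem : ∀ θ f, lpOn r univ (fun y => expWeight θ α y * klog X₀ X₁ f y) < ∞ →
      f ∈ sumSet X₀ X₁ := fun θ f => mem_sumSet_of_norm_lt_top hα hr' θ
  have hholm₁ : ∀ k x, P₀.headRow k x ≤ holm P₀ P₁ R k x := fun k x =>
    le_add_right le_self_add
  have hholm₂ : ∀ k x, P₀.chiLow x * k x ≤ holm P₀ P₁ R k x := fun k x =>
    le_add_right le_add_self
  have hholm₃ : ∀ k x, expE (R x) * P₁.crossRow (twist k) x ≤ holm P₀ P₁ R k x := fun k x =>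
    le_add_left (mul_le_mul' le_rfl le_self_add)
  have hholm₄ : ∀ k x, expE (R x) * P₁.tailRow (twist k) x ≤ holm P₀ P₁ R k x := fun k x =>
    le_add_left (mul_le_mul' le_rfl le_add_self)
  have hmono : ∀ (θ : ℝ) (F G : ℝ → ℝ≥0∞), (∀ x, F x ≤ G x) →
      lpOn r univ (fun x => expWeight θ α (R x) * F x) ≤
        lpOn r univ (fun x => expWeight θ α (R x) * G x) := fun θ F G h =>
    lpOn_mono fun x => mul_le_mul' le_rfl (h x)
  refine ⟨fun θ hθ0 hθ1 => ?_, fun _ => ?_, fun _ => ?_⟩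
  · rw [stdSpace_eq _ _ hr', hstd]
    obtain ⟨C, hC⟩ := exists_klog_norm_equiv hA hR h₀L h₁U hX₀ hX₁ hα hr' θ
    obtain ⟨C', hC'⟩ := exists_holm_norm_le hR h₀L h₁U hα r θ
    obtain ⟨D₁, hD₁⟩ := exists_headRow_norm_le hR h₀L h₁U hα hr' hθ0
    obtain ⟨D₃, hD₃⟩ := exists_tail_norm_le hR h₀L h₁U hα hr' hθ1
    refine finiteSpace_same hsub (hmem θ) ⟨C * (C' * (D₁ + 1 + D₃)), fun f hf => ?_⟩
      ⟨C, fun f hf => (hmono θ _ _ (hholm₂ _)).trans (hC f hf).2⟩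
    have hk := hqc f hf
    refine ((hC f hf).1.trans (mul_le_mul' le_rfl ((hC' _ hk).trans (mul_le_mul' le_rfl
      (add_le_add (add_le_add (hD₁ _ hk) le_rfl) (hD₃ _ hk)))))).trans_eq ?_
    push_cast; ring
  -- At `θ = 0` the cross and tail terms are still absorbed, but the head is not; its norm is
  -- exactly that of the `R,L` space.
  · have hRL : spaceRL A₀ A₁ 0 r (a ∘ ρ) r₀ b₀ q₀ a₀ = finiteSpace A₀ A₁ fun f =>
        lpOn r univ fun x => expWeight 0 α (R x) * P₀.headRow (klog A₀ A₁ f) x := by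
      simp only [spaceRL, wnorm_Ioi_zero _ _ _ hr', wnorm_headRow _ _ _ hr₀.ne' hq₀.ne', expWeight,
        neg_zero, zero_mul, expE_zero, one_mul, logWeight, Function.comp_apply, hαρ]
      rfl
    rw [stdSpace_eq _ _ hr', hstd, hRL, finiteSpace_inter]
    obtain ⟨C, hC⟩ := exists_klog_norm_equiv hA hR h₀L h₁U hX₀ hX₁ hα hr' 0
    obtain ⟨C', hC'⟩ := exists_holm_norm_le hR h₀L h₁U hα r 0
    obtain ⟨D₃, hD₃⟩ := exists_tail_norm_le hR h₀L h₁U hα hr' one_pos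
    refine finiteSpace_same hsub (hmem 0) ⟨C * (C' * (1 + 1 + D₃)), fun f hf => ?_⟩
      ⟨C, fun f hf => max_le ((hmono 0 _ _ (hholm₂ _)).trans (hC f hf).2)
        ((hmono 0 _ _ (hholm₁ _)).trans (hC f hf).2)⟩
    exact le_mul_max_two (hC f hf).1 (hC' _ (hqc f hf)) (hD₃ _ (hqc f hf))
  -- At `θ = 1` the head is absorbed, and `exp (-R)` cancels the factor `exp R` of the cross and
  -- tail terms, whose norms are those of the `R` and `R,R` spaces.
  · have hW1 : ∀ x, expWeight 1 α (R x) * expE (R x) = α (R x) := fun x => by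
      rw [expWeight, neg_one_mul, mul_right_comm, mul_comm (expE (-R x)), expE_mul_expE_neg, one_mul]
    have hRsp : spaceR A₀ A₁ 1 r B₁ q₁ a₁ = finiteSpace A₀ A₁ fun f =>
        lpOn r univ fun x => expWeight 1 α (R x) *
          (expE (R x) * P₁.crossRow (twist (klog A₀ A₁ f)) x) := by
      simp only [spaceR, wnorm_Ioi_zero _ _ _ hr', wnorm_norm_a _ _ hq₁.ne', neg_zero, zero_mul,
        expE_zero, one_mul]
      congr 1; funext f; congr 1; funext x
      -- The `toReal` in `B₁` is harmless, the norm of `b₁` over `(0, t)` being finite.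
      rw [← mul_assoc, hW1, logWeight, hB₁, wnorm_norm_b _ hr₁.ne',
        ENNReal.ofReal_mul ENNReal.toReal_nonneg, hαρ,
        ENNReal.ofReal_toReal (show lpOn r₁ (Iio x) (logWeight b₁) ≠ ∞ from h₁U.norm_b_ne_top x),
        mul_comm _ (α (R x)), mul_assoc]
      simp only [neg_mul, one_mul]
      rfl
    have hRR : spaceRR A₀ A₁ 1 r (a ∘ ρ) r₁ b₁ q₁ a₁ = finiteSpace A₀ A₁ fun f =>
        lpOn r univ fun x => expWeight 1 α (R x) *
          (expE (R x) * P₁.tailRow (twist (klog A₀ A₁ f)) x) := by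
      simp only [spaceRR, wnorm_Ioi_zero _ _ _ hr', wnorm_tailRow _ _ _ hr₁.ne' hq₁.ne', neg_zero,
        zero_mul, expE_zero, one_mul, logWeight, Function.comp_apply, hαρ, ← mul_assoc, hW1]
      simp only [neg_mul, one_mul]
      rfl
    rw [stdSpace_eq _ _ hr', hstd, hRsp, hRR, finiteSpace_inter, finiteSpace_inter]
    obtain ⟨C, hC⟩ := exists_klog_norm_equiv hA hR h₀L h₁U hX₀ hX₁ hα hr' 1
    obtain ⟨C', hC'⟩ := exists_holm_norm_le hR h₀L h₁U hα r 1
    obtain ⟨D₁, hD₁⟩ := exists_headRow_norm_le hR h₀L h₁U hα hr' one_pos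
    obtain ⟨K, M, hM, hK⟩ := hR.exists_varyBound h₀L h₁U hα 1
    obtain ⟨D, hD⟩ := hK.lpOn_mul_add hM r
    refine finiteSpace_same hsub (hmem 1) ⟨C * (C' * (D₁ + 1 + D * (1 + 1))), fun f hf => ?_⟩
      ⟨C, fun f hf => max_le (max_le ((hmono 1 _ _ (hholm₂ _)).trans (hC f hf).2)
        ((hmono 1 _ _ (hholm₃ _)).trans (hC f hf).2))
          ((hmono 1 _ _ (hholm₄ _)).trans (hC f hf).2)⟩
    have hk := hqc f hf
    have hEm : Measurable fun x => expE (R x) := measurable_expE.comp (hR.measurable h₁U)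
    have hsum := hD univ (fun x => expE (R x) * P₁.crossRow (twist (klog A₀ A₁ f)) x)
      (fun x => expE (R x) * P₁.tailRow (twist (klog A₀ A₁ f)) x)
      (hEm.mul (RowParams.measurable_crossRow _)) (hEm.mul (RowParams.tailRow_anti _).measurable)
    simp only [← mul_add] at hsum
    exact le_mul_max_three (hC f hf).1 (hC' _ hk) (hD₁ _ hk) hsum
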